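/- **Setting.** Let $n,N,p\in\mathbb N$ with $p\ge 2$, let $T>0$ and let $\gamma>1/3$ with $\gamma>n/(2p)$. All functions on $\mathbb R^n$ are real-valued. For $q\ge1$ put $\mathcal B_q=L^q(\mathbb R^n)$. Let $S_t\varphi=g_t*\varphi$ with $g_t(\xi)=(2\pi t)^{-n/2}e^{-|\xi|^2/(2t)}$ for $t>0$, and $S_0=\mathrm{Id}$; let $A$ be the generator of $S$, so that $AS_t\varphi=(\partial_t g_t)*\varphi$ for $t>0$. Write $S_{ts}=S_{t-s}$ and $a_{ts}=S_{t-s}-\mathrm{Id}$ for $s\le t$. For $0<\alpha<1/2$ let $\mathcal B_{\alpha,p}=(\mathrm{Id}-\Delta)^{-\alpha}(L^p(\mathbb R^n))$ with norm $\|\varphi\|_{L^p}+\|(-\Delta)^\alpha\varphi\|_{L^p}$. For a function $z$ of one time variable put $(\delta z)_{ts}=z_t-z_s$; for a function $y$ of two time variables put $(\delta y)_{tus}=y_{ts}-y_{tu}-y_{us}$ and $(\hat\delta y)_{tus}=(\delta y)_{tus}-a_{tu}y_{us}$. For a normed space $V$, $\mathcal C_2^\mu(V)$ is the set of continuous maps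 $(t,s)\mapsto y_{ts}\in V$ on $\{0\le s\le t\le T\}$ with $\sup_{s<t}\|y_{ts}\|_V/|t-s|^\mu<\infty$. $\mathcal L(V,W)$ (respectively $\mathcal L(V_1\times V_2,W)$) denotes bounded linear (respectively bilinear) maps with the operator norm. For $\varphi,\psi\in\mathcal B_p$, $\varphi\cdot\psi\in\mathcal B_{p/2}$ is the pointwise product. **Hypothesis.** Let $x=(x^1,\dots,x^N):[0,T]\to\mathbb R^N$ be $\gamma$-Hölder and let $x^2=(x^{2,ij})\in\mathcal C_2^{2\gamma}(\mathbb R^N\otimes\mathbb R^N)$ satisfy $(\delta x^{2,ij})_{tus}=(\delta x^i)_{tu}(\delta x^j)_{us}$ for all $i,j$ and $0\le s\le u\le t\le T$. **Formulas.** For $0\le s\le t\le T$ and $\varphi,\psi\in C_c^\infty(\mathbb R^n)$ set $$X^{x,i}_{ts}\varphi=(\delta x^i)_{ts}\varphi+\int_s^tAS_{tu}\varphi\,(\delta x^i)_{us}\,du,\qquad X^{ax,i}_{ts}\varphi=\int_s^tAS_{tu}\varphi\,(\delta x^i)_{us}\,du,$$ $$X^{xa,i}_{ts}(\varphi,\psi)=\int_s^tX^{x,i}_{tu}\big((AS_{us}\varphi)\cdot\psi\big)\,du,\qquad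 X^{xx,ij}_{ts}\varphi=x^{2,ij}_{ts}\varphi+\int_s^tAS_{tu}\varphi\;x^{2,ij}_{us}\,du .$$ **Proposition.** These operators extend to families of bounded operators $X^{x,i}_{ts}$ (on $\mathcal B_p$ and from $\mathcal B_{p/2}$ to $\mathcal B_p$, the two agreeing on $\mathcal B_p\cap\mathcal B_{p/2}$), $X^{ax,i}_{ts}$ and $X^{xx,ij}_{ts}$ (on $\mathcal B_p$), and $X^{xa,i}_{ts}$ (bilinear from $\mathcal B_{\alpha,p}\times\mathcal B_p$ to $\mathcal B_p$ for every $\alpha\in(0,1/2)$ with $2\alpha p>n$, the versions for different $\alpha$ agreeing), such that the following hold for all $i,j\in\{1,\dots,N\}$. (H1) For all $0\le s\le u\le t\le T$, $$\hat\delta X^{x,i}=0,\qquad X^{x,i}=X^{ax,i}+\delta x^i,\qquad (\hat\delta X^{xx,ij})_{tus}=X^{x,i}_{tu}(\delta x^j)_{us},$$ $$(\hat\delta X^{xa,i})_{tus}(\varphi,\psi)=X^{xa,i}_{tu}(a_{us}\varphi,\psi)+X^{x,i}_{tu}\big((a_{us}\varphi)\cdot\psi\big),$$ the last identity for $\varphi\in\mathcal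 B_{\alpha,p}$, $\psi\in\mathcal B_p$, $\alpha\in(0,1/2)$, $2\alpha p>n$. (H2) For every $\alpha\in(0,1/2)$ with $2\alpha p>n$, $$X^{x,i}\in\mathcal C_2^\gamma(\mathcal L(\mathcal B_p,\mathcal B_p))\cap\mathcal C_2^\gamma(\mathcal L(\mathcal B_{\alpha,p},\mathcal B_{\alpha,p}))\cap\mathcal C_2^{\gamma-n/(2p)}(\mathcal L(\mathcal B_{p/2},\mathcal B_p)),$$ $$X^{ax,i}\in\mathcal C_2^{\gamma+\alpha}(\mathcal L(\mathcal B_{\alpha,p},\mathcal B_p)),$$ $$X^{xa,i}\in\mathcal C_2^{\gamma+\alpha-n/(2p)}(\mathcal L(\mathcal B_{\alpha,p}\times\mathcal B_p,\mathcal B_p))\cap\mathcal C_2^\gamma(\mathcal L(\mathcal B_{\alpha,p}\times\mathcal B_{\alpha,p},\mathcal B_{\alpha,p})),$$ $$X^{xx,ij}\in\mathcal C_2^{2\gamma}(\mathcal L(\mathcal B_p,\mathcal B_p))\cap\mathcal C_2^{2\gamma}(\mathcal L(\mathcal B_{\alpha,p},\mathcal B_{\alpha,p}))\cap\mathcal C_2^{2\gamma}(\mathcal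 L(\mathcal B_{\alpha,p},\mathcal B_p)).$$ (The memberships not involving $\alpha$ hold whether or not such an $\alpha$ exists.) -/

import Mathlib

open MeasureTheory Filter Topology Set
open scoped ENNReal

noncomputable section

namespace HeatRough

/-! ### The heat semigroup on `L^q(ℝⁿ)` -/

/-- The space `ℝⁿ`. -/
abbrev Space (n : ℕ) := EuclideanSpace ℝ (Fin n)

/-- Real-valued `L^q(ℝⁿ)`, i.e. the space `𝓑_q`. -/
abbrev LSp (n : ℕ) (q : ℝ≥0∞) := Lp ℝ q (volume : Measure (Space n))

/-- The Gaussian kernel `g_t(ξ) = (2πt)^{-n/2} exp(-|ξ|²/(2t))`, for `t > 0`. -/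
def gaussKernel (n : ℕ) (t : ℝ) (ξ : Space n) : ℝ :=
  (2 * Real.pi * t) ^ (-(n : ℝ) / 2) * Real.exp (-‖ξ‖ ^ 2 / (2 * t))

/-- Translation on `L^q`: `(τ_y f)(ξ) = f(ξ - y)`. -/
def transl {n : ℕ} (q : ℝ≥0∞) [Fact (1 ≤ q)] (y : Space n) : LSp n q →L[ℝ] LSp n q :=
  (Lp.compMeasurePreservingₗᵢ ℝ (fun ξ : Space n => ξ - y)
    (measurePreserving_sub_right volume y)).toContinuousLinearMap

theorem norm_transl {n : ℕ} {q : ℝ≥0∞} [Fact (1 ≤ q)] (y : Space n) (f : LSp n q) :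
    ‖transl q y f‖ = ‖f‖ :=
  LinearIsometry.norm_map _ f

theorem coeFn_transl {n : ℕ} {q : ℝ≥0∞} [Fact (1 ≤ q)] (y : Space n) (f : LSp n q) :
    transl q y f =ᵐ[volume] fun ξ => f (ξ - y) :=
  Lp.coeFn_compMeasurePreserving f (measurePreserving_sub_right volume y)

theorem transl_comm {n : ℕ} {q : ℝ≥0∞} [Fact (1 ≤ q)] (y z : Space n) (f : LSp n q) :
    transl q y (transl q z f) = transl q z (transl q y f) := by
  apply Lp.ext
  have h1 := coeFn_transl y (transl q z f)
  have h2 := coeFn_transl z (transl q y f)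
  have h3 := (measurePreserving_sub_right volume y).quasiMeasurePreserving.ae_eq_comp
    (coeFn_transl z f)
  have h4 := (measurePreserving_sub_right volume z).quasiMeasurePreserving.ae_eq_comp
    (coeFn_transl y f)
  filter_upwards [h1, h2, h3, h4] with ξ e1 e2 e3 e4
  simp only [Function.comp_apply] at e3 e4
  rw [e1, e2, e3, e4, sub_right_comm]

theorem continuous_transl {n : ℕ} {q : ℝ≥0∞} [Fact (1 ≤ q)] [Fact (q ≠ ⊤)] (f : LSp n q) :
    Continuous fun y : Space n => transl q y f := by
  have hc : Continuous fun y : Space n =>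
      (ContinuousMap.mk (fun ξ : Space n => ξ - y) (by fun_prop) : C(Space n, Space n)) := by
    refine ContinuousMap.continuous_of_continuous_uncurry _ ?_
    change Continuous fun z : Space n × Space n => z.2 - z.1
    fun_prop
  exact (continuous_const (y := f)).compMeasurePreservingLp hc
    (fun y => measurePreserving_sub_right volume y) Fact.out

theorem integrable_smul_transl {n : ℕ} {q : ℝ≥0∞} [Fact (1 ≤ q)] [Fact (q ≠ ⊤)]
    {k : Space n → ℝ} (hk : Integrable k volume) (f : LSp n q) :
    Integrable (fun y => k y • transl q y f) volume := by
  refine (hk.norm.mul_const ‖f‖).mono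
    (hk.aestronglyMeasurable.smul (continuous_transl f).aestronglyMeasurable) ?_
  filter_upwards with y
  simp [norm_smul, norm_transl]

/-- Convolution `k * f = ∫ k(y) f(· - y) dy` of an integrable kernel `k` with `f ∈ L^q`, as an
operator on `L^q` (set to `0` if `k` is not integrable). -/
def convLp {n : ℕ} (q : ℝ≥0∞) [Fact (1 ≤ q)] [Fact (q ≠ ⊤)] (k : Space n → ℝ) :
    LSp n q →L[ℝ] LSp n q :=
  open Classical in
  if hk : Integrable k volume then
    LinearMap.mkContinuous
      { toFun := fun f => ∫ y, k y • transl q y f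
        map_add' := fun f g => by
          rw [← integral_add (integrable_smul_transl hk f) (integrable_smul_transl hk g)]
          simp only [map_add, smul_add]
        map_smul' := fun c f => by
          rw [RingHom.id_apply, ← integral_smul]
          simp only [map_smul, smul_comm c] }
      (∫ y, ‖k y‖) (fun f => by
        refine (norm_integral_le_integral_norm _).trans ?_
        simp only [norm_smul, norm_transl, integral_mul_const]
        exact le_rfl)
  else 0

theorem convLp_apply {n : ℕ} {q : ℝ≥0∞} [Fact (1 ≤ q)] [Fact (q ≠ ⊤)] {k : Space n → ℝ}
    (hk : Integrable k volume) (f : LSp n q) :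
    convLp q k f = ∫ y, k y • transl q y f := by
  simp [convLp, hk]

theorem norm_convLp_le {n : ℕ} {q : ℝ≥0∞} [Fact (1 ≤ q)] [Fact (q ≠ ⊤)] {k : Space n → ℝ}
    (hk : Integrable k volume) (f : LSp n q) :
    ‖convLp q k f‖ ≤ (∫ y, ‖k y‖) * ‖f‖ := by
  rw [convLp_apply hk]
  refine (norm_integral_le_integral_norm _).trans ?_
  simp only [norm_smul, norm_transl, integral_mul_const]
  exact le_rfl

theorem convLp_transl {n : ℕ} {q : ℝ≥0∞} [Fact (1 ≤ q)] [Fact (q ≠ ⊤)] (k : Space n → ℝ)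
    (y : Space n) (f : LSp n q) :
    convLp q k (transl q y f) = transl q y (convLp q k f) := by
  by_cases hk : Integrable k volume
  · rw [convLp_apply hk, convLp_apply hk,
      ← ContinuousLinearMap.integral_comp_comm _ (integrable_smul_transl hk f)]
    simp only [map_smul, transl_comm y]
  · simp [convLp, hk]

theorem convLp_comm {n : ℕ} {q : ℝ≥0∞} [Fact (1 ≤ q)] [Fact (q ≠ ⊤)] (k l : Space n → ℝ)
    (f : LSp n q) : convLp q k (convLp q l f) = convLp q l (convLp q k f) := by
  by_cases hl : Integrable l volume
  · rw [convLp_apply hl, convLp_apply hl,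
      ← ContinuousLinearMap.integral_comp_comm _ (integrable_smul_transl hl f)]
    simp only [map_smul, convLp_transl]
  · simp [convLp, hl]

/-- The heat semigroup `S_t φ = g_t * φ` on `L^q`, with `S_0 = Id`. Its generator is
`A = Δ/2`. -/
def heatS (n : ℕ) (q : ℝ≥0∞) [Fact (1 ≤ q)] [Fact (q ≠ ⊤)] (t : ℝ) : LSp n q →L[ℝ] LSp n q :=
  open Classical in
  if 0 < t then convLp q (gaussKernel n t) else ContinuousLinearMap.id ℝ _

theorem integrable_gaussKernel (n : ℕ) {t : ℝ} (ht : 0 < t) :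
    Integrable (gaussKernel n t) volume := by
  have h := GaussianFourier.integrable_cexp_neg_mul_sq_norm_add (V := Space n)
    (b := ((1 / (2 * t) : ℝ) : ℂ)) (by rw [Complex.ofReal_re]; positivity) 0 0
  have h2 := h.norm
  refine (h2.const_mul ((2 * Real.pi * t) ^ (-(n : ℝ) / 2))).congr ?_
  filter_upwards with ξ
  simp only [gaussKernel, Complex.norm_exp]
  congr 2
  simp only [zero_mul, add_zero]
  norm_cast
  ring

theorem integral_gaussKernel (n : ℕ) {t : ℝ} (ht : 0 < t) :
    ∫ ξ, gaussKernel n t ξ = 1 := by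
  have h := GaussianFourier.integral_rexp_neg_mul_sq_norm (V := Space n) (b := 1 / (2 * t))
    (by positivity)
  have h2 : ∀ ξ : Space n, gaussKernel n t ξ =
      (2 * Real.pi * t) ^ (-(n : ℝ) / 2) * Real.exp (-(1 / (2 * t)) * ‖ξ‖ ^ 2) := by
    intro ξ
    simp only [gaussKernel]
    congr 2
    ring
  simp only [h2, integral_const_mul, h]
  have h3 : Real.pi / (1 / (2 * t)) = 2 * Real.pi * t := by field_simp
  rw [h3, finrank_euclideanSpace_fin, ← Real.rpow_add (by positivity)]
  have : -(n : ℝ) / 2 + n / 2 = 0 := by ring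
  rw [this, Real.rpow_zero]

theorem gaussKernel_nonneg (n : ℕ) {t : ℝ} (ht : 0 < t) (ξ : Space n) :
    0 ≤ gaussKernel n t ξ := by
  unfold gaussKernel; positivity

theorem norm_heatS_le {n : ℕ} {q : ℝ≥0∞} [Fact (1 ≤ q)] [Fact (q ≠ ⊤)] (t : ℝ) (f : LSp n q) :
    ‖heatS n q t f‖ ≤ ‖f‖ := by
  by_cases ht : 0 < t
  · simp only [heatS, ht, if_true]
    refine (norm_convLp_le (integrable_gaussKernel n ht) f).trans ?_
    have : ∀ ξ, ‖gaussKernel n t ξ‖ = gaussKernel n t ξ := fun ξ =>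
      Real.norm_of_nonneg (gaussKernel_nonneg n ht ξ)
    simp [this, integral_gaussKernel n ht]
  · simp [heatS, ht]

theorem heatS_convLp {n : ℕ} {q : ℝ≥0∞} [Fact (1 ≤ q)] [Fact (q ≠ ⊤)] (t : ℝ) (k : Space n → ℝ)
    (f : LSp n q) : heatS n q t (convLp q k f) = convLp q k (heatS n q t f) := by
  by_cases ht : 0 < t
  · simp only [heatS, ht, if_true, convLp_comm k]
  · simp [heatS, ht]

theorem heatS_comm {n : ℕ} {q : ℝ≥0∞} [Fact (1 ≤ q)] [Fact (q ≠ ⊤)] (t r : ℝ)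
    (f : LSp n q) : heatS n q t (heatS n q r f) = heatS n q r (heatS n q t f) := by
  by_cases hr : 0 < r
  · have : heatS n q r = convLp q (gaussKernel n r) := by simp [heatS, hr]
    rw [this, heatS_convLp]
  · simp [heatS, hr]

/-! ### Bessel potential spaces -/

/-- Admissible orders of smoothness `α ∈ (0, 1/2)`. -/
abbrev Order := Set.Ioo (0 : ℝ) (1 / 2)

/-- The kernel of `(Id - Δ)^{-α} = Γ(α)⁻¹ ∫₀^∞ r^{α-1} e^{-r} e^{rΔ} dr`, where the kernel of
`e^{rΔ}` is `g_{2r}`. -/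
def besselKernel (n : ℕ) (α : ℝ) (ξ : Space n) : ℝ :=
  (Real.Gamma α)⁻¹ * ∫ r in Ioi (0 : ℝ), r ^ (α - 1) * Real.exp (-r) * gaussKernel n (2 * r) ξ

/-- The truncated integral `α/Γ(1-α) ∫_ε^∞ r^{-α-1} (φ - e^{rΔ} φ) dr` in `L^q`. -/
def fracLapTrunc {n : ℕ} {q : ℝ≥0∞} [Fact (1 ≤ q)] [Fact (q ≠ ⊤)] (α ε : ℝ) (φ : LSp n q) :
    LSp n q :=
  (α / Real.Gamma (1 - α)) • ∫ r in Ioi ε, r ^ (-α - 1) • (φ - heatS n q (2 * r) φ)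

/-- `(-Δ)^α φ = g` in `L^q`, for `0 < α < 1`: the standard (Balakrishnan) formula
`(-Δ)^α φ = α/Γ(1-α) ∫_0^∞ r^{-α-1} (φ - e^{rΔ} φ) dr`, as a strong limit in `L^q`. -/
def IsFracLap {n : ℕ} {q : ℝ≥0∞} [Fact (1 ≤ q)] [Fact (q ≠ ⊤)] (α : ℝ) (φ g : LSp n q) : Prop :=
  Tendsto (fun ε => fracLapTrunc α ε φ) (𝓝[>] 0) (𝓝 g)

theorem integrableOn_fracLap {n : ℕ} {q : ℝ≥0∞} [Fact (1 ≤ q)] [Fact (q ≠ ⊤)] {α ε : ℝ}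
    (hα : 0 < α) (hε : 0 < ε) (φ : LSp n q) :
    IntegrableOn (fun r : ℝ => r ^ (-α - 1) • (φ - heatS n q (2 * r) φ)) (Ioi ε) volume := by
  have h1 : IntegrableOn (fun r : ℝ => r ^ (-α - 1)) (Ioi ε) volume :=
    integrableOn_Ioi_rpow_of_lt (by linarith) hε
  have hm : AEStronglyMeasurable (fun r : ℝ => heatS n q (2 * r) φ)
      (volume.restrict (Ioi ε)) := by
    have h2 : Measurable fun r : ℝ => 2 * r := by fun_prop
    have hk : Measurable fun z : ℝ × Space n => gaussKernel n (2 * z.1) z.2 := by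
      unfold gaussKernel; fun_prop
    have h : StronglyMeasurable fun z : ℝ × Space n =>
        gaussKernel n (2 * z.1) z.2 • transl q z.2 φ :=
      hk.stronglyMeasurable.smul
        ((continuous_transl φ).comp continuous_snd).stronglyMeasurable
    refine (h.integral_prod_right' (ν := volume)).aestronglyMeasurable.congr ?_
    filter_upwards [ae_restrict_mem measurableSet_Ioi] with r hr
    have hr : 0 < 2 * r := by have : ε < r := hr; linarith
    rw [heatS, if_pos hr, convLp_apply (integrable_gaussKernel n hr)]
  refine (h1.norm.mul_const (2 * ‖φ‖)).mono
    (h1.aestronglyMeasurable.smul (aestronglyMeasurable_const.sub hm)) ?_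
  filter_upwards with r
  rw [norm_smul]
  have h3 : ‖φ - heatS n q (2 * r) φ‖ ≤ 2 * ‖φ‖ :=
    (norm_sub_le _ _).trans (by linarith [norm_heatS_le (2 * r) φ])
  refine (mul_le_mul_of_nonneg_left h3 (norm_nonneg _)).trans ?_
  simp

theorem fracLapTrunc_add {n : ℕ} {q : ℝ≥0∞} [Fact (1 ≤ q)] [Fact (q ≠ ⊤)] {α ε : ℝ}
    (hα : 0 < α) (hε : 0 < ε) (φ ψ : LSp n q) :
    fracLapTrunc α ε (φ + ψ) = fracLapTrunc α ε φ + fracLapTrunc α ε ψ := by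
  rw [fracLapTrunc, fracLapTrunc, fracLapTrunc, ← smul_add, ← integral_add
    (integrableOn_fracLap hα hε φ) (integrableOn_fracLap hα hε ψ)]
  congr 2
  ext1 r
  rw [map_add, ← smul_add, add_sub_add_comm]

theorem fracLapTrunc_clm {n : ℕ} {q : ℝ≥0∞} [Fact (1 ≤ q)] [Fact (q ≠ ⊤)] {α ε : ℝ}
    (hα : 0 < α) (hε : 0 < ε) (L : LSp n q →L[ℝ] LSp n q)
    (hL : ∀ r f, L (heatS n q r f) = heatS n q r (L f)) (φ : LSp n q) :
    fracLapTrunc α ε (L φ) = L (fracLapTrunc α ε φ) := by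
  rw [fracLapTrunc, fracLapTrunc, map_smul,
    ← ContinuousLinearMap.integral_comp_comm _ (integrableOn_fracLap hα hε φ)]
  simp only [map_smul, map_sub, hL]

theorem IsFracLap.add {n : ℕ} {q : ℝ≥0∞} [Fact (1 ≤ q)] [Fact (q ≠ ⊤)] {α : ℝ} (hα : 0 < α)
    {φ ψ g h : LSp n q} (h1 : IsFracLap α φ g) (h2 : IsFracLap α ψ h) :
    IsFracLap α (φ + ψ) (g + h) := by
  refine (Tendsto.add h1 h2).congr' ?_
  filter_upwards [self_mem_nhdsWithin] with ε hε
  exact (fracLapTrunc_add hα hε φ ψ).symm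

theorem IsFracLap.clm {n : ℕ} {q : ℝ≥0∞} [Fact (1 ≤ q)] [Fact (q ≠ ⊤)] {α : ℝ} (hα : 0 < α)
    (L : LSp n q →L[ℝ] LSp n q) (hL : ∀ r f, L (heatS n q r f) = heatS n q r (L f))
    {φ g : LSp n q} (h : IsFracLap α φ g) : IsFracLap α (L φ) (L g) := by
  refine ((L.continuous.tendsto g).comp h).congr' ?_
  filter_upwards [self_mem_nhdsWithin] with ε hε
  exact (fracLapTrunc_clm hα hε L hL φ).symm

theorem IsFracLap.smul {n : ℕ} {q : ℝ≥0∞} [Fact (1 ≤ q)] [Fact (q ≠ ⊤)] {α : ℝ}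
    (c : ℝ) {φ g : LSp n q} (h : IsFracLap α φ g) : IsFracLap α (c • φ) (c • g) := by
  have h0 : ∀ ε, fracLapTrunc α ε (c • φ) = c • fracLapTrunc α ε φ := by
    intro ε
    have h1 : ∀ r : ℝ, r ^ (-α - 1) • (c • φ - heatS n q (2 * r) (c • φ)) =
        c • (r ^ (-α - 1) • (φ - heatS n q (2 * r) φ)) := fun r => by
      rw [map_smul, ← smul_sub, smul_comm c]
    simp only [fracLapTrunc, h1]
    rw [integral_smul, smul_comm c]
  unfold IsFracLap
  simp only [h0]
  exact Tendsto.const_smul h c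

theorem IsFracLap.unique {n : ℕ} {q : ℝ≥0∞} [Fact (1 ≤ q)] [Fact (q ≠ ⊤)] {α : ℝ}
    {φ g h : LSp n q} (h1 : IsFracLap α φ g) (h2 : IsFracLap α φ h) : g = h :=
  tendsto_nhds_unique h1 h2

/-- The subspace `(Id - Δ)^{-α}(L^q)` of `L^q`. The second clause, that `(-Δ)^α φ` exists in `L^q`,
is automatic; it is listed so that the norm below can be written down. -/
def besselSubmodule (n : ℕ) (q : ℝ≥0∞) [Fact (1 ≤ q)] [Fact (q ≠ ⊤)] (α : Order) :
    Submodule ℝ (LSp n q) where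
  carrier := {φ | (∃ f : LSp n q, φ = convLp q (besselKernel n α) f) ∧ ∃ g, IsFracLap α φ g}
  add_mem' := by
    rintro φ ψ ⟨⟨f, hf⟩, g, hg⟩ ⟨⟨f', hf'⟩, g', hg'⟩
    exact ⟨⟨f + f', by rw [map_add, hf, hf']⟩, g + g', hg.add α.2.1 hg'⟩
  zero_mem' := ⟨⟨0, by simp⟩, 0, by simp [IsFracLap, fracLapTrunc]⟩
  smul_mem' := by
    rintro c φ ⟨⟨f, hf⟩, g, hg⟩
    exact ⟨⟨c • f, by rw [map_smul, hf]⟩, c • g, hg.smul c⟩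

/-- The space `𝓑_{α,q} = (Id - Δ)^{-α}(L^q(ℝⁿ))`, to be normed by
`‖φ‖_{L^q} + ‖(-Δ)^α φ‖_{L^q}`. -/
def BesselSp (n : ℕ) (q : ℝ≥0∞) [Fact (1 ≤ q)] [Fact (q ≠ ⊤)] (α : Order) : Type :=
  besselSubmodule n q α

namespace BesselSp

instance {n : ℕ} {q : ℝ≥0∞} [Fact (1 ≤ q)] [Fact (q ≠ ⊤)] {α : Order} :
    AddCommGroup (BesselSp n q α) :=
  inferInstanceAs (AddCommGroup (besselSubmodule n q α))

instance {n : ℕ} {q : ℝ≥0∞} [Fact (1 ≤ q)] [Fact (q ≠ ⊤)] {α : Order} :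
    Module ℝ (BesselSp n q α) :=
  inferInstanceAs (Module ℝ (besselSubmodule n q α))

/-- The inclusion `𝓑_{α,q} → L^q`, as a linear map. -/
def inclₗ {n : ℕ} {q : ℝ≥0∞} [Fact (1 ≤ q)] [Fact (q ≠ ⊤)] {α : Order} :
    BesselSp n q α →ₗ[ℝ] LSp n q :=
  (besselSubmodule n q α).subtype

/-- The operator `(-Δ)^α : 𝓑_{α,q} → L^q`. -/
def fracLap {n : ℕ} {q : ℝ≥0∞} [Fact (1 ≤ q)] [Fact (q ≠ ⊤)] {α : Order} :
    BesselSp n q α →ₗ[ℝ] LSp n q where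
  toFun φ := φ.2.2.choose
  map_add' φ ψ := IsFracLap.unique (φ + ψ).2.2.choose_spec
    (φ.2.2.choose_spec.add α.2.1 ψ.2.2.choose_spec)
  map_smul' c φ := IsFracLap.unique (c • φ).2.2.choose_spec (φ.2.2.choose_spec.smul c)

theorem isFracLap {n : ℕ} {q : ℝ≥0∞} [Fact (1 ≤ q)] [Fact (q ≠ ⊤)] {α : Order}
    (φ : BesselSp n q α) : IsFracLap α (inclₗ φ) (fracLap φ) :=
  φ.2.2.choose_spec

instance {n : ℕ} {q : ℝ≥0∞} [Fact (1 ≤ q)] [Fact (q ≠ ⊤)] {α : Order} :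
    NormedAddCommGroup (BesselSp n q α) :=
  AddGroupNorm.toNormedAddCommGroup
    { toFun := fun φ => ‖inclₗ φ‖ + ‖fracLap φ‖
      map_zero' := by simp
      add_le' := fun φ ψ => by
        rw [map_add, map_add]
        linarith [norm_add_le (inclₗ φ) (inclₗ ψ), norm_add_le (fracLap φ) (fracLap ψ)]
      neg' := fun φ => by simp
      eq_zero_of_map_eq_zero' := fun φ h => by
        have h1 : ‖inclₗ φ‖ = 0 := by
          linarith [norm_nonneg (inclₗ φ), norm_nonneg (fracLap φ)]
        exact Subtype.ext (norm_eq_zero.mp h1) }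

theorem norm_def {n : ℕ} {q : ℝ≥0∞} [Fact (1 ≤ q)] [Fact (q ≠ ⊤)] {α : Order}
    (φ : BesselSp n q α) : ‖φ‖ = ‖inclₗ φ‖ + ‖fracLap φ‖ := rfl

instance {n : ℕ} {q : ℝ≥0∞} [Fact (1 ≤ q)] [Fact (q ≠ ⊤)] {α : Order} :
    NormedSpace ℝ (BesselSp n q α) where
  norm_smul_le c φ := by
    rw [norm_def, norm_def, map_smul, map_smul, norm_smul, norm_smul, mul_add]

/-- The inclusion `𝓑_{α,q} → L^q`. -/
def incl {n : ℕ} {q : ℝ≥0∞} [Fact (1 ≤ q)] [Fact (q ≠ ⊤)] {α : Order} :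
    BesselSp n q α →L[ℝ] LSp n q :=
  LinearMap.mkContinuous inclₗ 1 (fun φ => by
    rw [one_mul, norm_def]
    linarith [norm_nonneg (fracLap φ)])

theorem heatS_mem {n : ℕ} {q : ℝ≥0∞} [Fact (1 ≤ q)] [Fact (q ≠ ⊤)] {α : Order} (t : ℝ) :
    ∀ φ ∈ besselSubmodule n q α, (heatS n q t).toLinearMap φ ∈ besselSubmodule n q α := by
  rintro φ ⟨⟨f, hf⟩, g, hg⟩
  refine ⟨⟨heatS n q t f, ?_⟩, heatS n q t g, hg.clm α.2.1 _ fun r f => heatS_comm t r f⟩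
  rw [hf]
  exact heatS_convLp t _ f

/-- The restriction of `S_t` to `𝓑_{α,q}`, as a linear map. -/
def heatBₗ {n : ℕ} {q : ℝ≥0∞} [Fact (1 ≤ q)] [Fact (q ≠ ⊤)] {α : Order} (t : ℝ) :
    BesselSp n q α →ₗ[ℝ] BesselSp n q α :=
  LinearMap.restrict (heatS n q t).toLinearMap (heatS_mem t)

/-- The restriction of `S_t` to `𝓑_{α,q}`. -/
def heatB {n : ℕ} {q : ℝ≥0∞} [Fact (1 ≤ q)] [Fact (q ≠ ⊤)] {α : Order} (t : ℝ) :
    BesselSp n q α →L[ℝ] BesselSp n q α :=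
  LinearMap.mkContinuous (heatBₗ t) 1 (fun φ => by
    rw [one_mul, norm_def, norm_def]
    have h : fracLap (heatBₗ t φ) = heatS n q t (fracLap φ) :=
      IsFracLap.unique (isFracLap (heatBₗ t φ))
        ((isFracLap φ).clm α.2.1 (heatS n q t) fun r f => heatS_comm t r f)
    rw [h]
    exact add_le_add (norm_heatS_le t _) (norm_heatS_le t _))

theorem incl_heatB {n : ℕ} {q : ℝ≥0∞} [Fact (1 ≤ q)] [Fact (q ≠ ⊤)] {α : Order} (t : ℝ)
    (φ : BesselSp n q α) : incl (heatB t φ) = heatS n q t (incl φ) := rfl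

end BesselSp

/-! ### Increments and Hölder spaces -/

/-- `z ∈ 𝒞_1^μ([0,T]; V)`. -/
def HolderC1 {V : Type*} [NormedAddCommGroup V] (T μ : ℝ) (z : ℝ → V) : Prop :=
  ContinuousOn z (Icc 0 T) ∧
    ∃ C : ℝ, ∀ s t : ℝ, 0 ≤ s → s < t → t ≤ T → ‖z t - z s‖ ≤ C * (t - s) ^ μ

/-- `y ∈ 𝒞_2^μ([0,T]; V)`: the map `(t, s) ↦ y_{ts}` is continuous on the simplex
`0 ≤ s ≤ t ≤ T`, and `‖y_{ts}‖ ≤ C |t - s|^μ`. -/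
def HolderC2 {V : Type*} [NormedAddCommGroup V] (T μ : ℝ) (y : ℝ → ℝ → V) : Prop :=
  ContinuousOn (fun z : ℝ × ℝ => y z.1 z.2) {z | 0 ≤ z.2 ∧ z.2 ≤ z.1 ∧ z.1 ≤ T} ∧
    ∃ C : ℝ, ∀ s t : ℝ, 0 ≤ s → s < t → t ≤ T → ‖y t s‖ ≤ C * (t - s) ^ μ

/-- `(δz)_{ts} = z_t - z_s`. -/
def delta1 {V : Type*} [AddCommGroup V] (z : ℝ → V) (t s : ℝ) : V := z t - z s

/-- `(δy)_{tus} = y_{ts} - y_{tu} - y_{us}`. -/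
def delta2 {V : Type*} [AddCommGroup V] (y : ℝ → ℝ → V) (t u s : ℝ) : V :=
  y t s - y t u - y u s

/-- `a_{ts} = S_{t-s} - Id` on `L^q`. -/
def aOp {n : ℕ} {q : ℝ≥0∞} [Fact (1 ≤ q)] [Fact (q ≠ ⊤)] (t s : ℝ) : LSp n q →L[ℝ] LSp n q :=
  heatS n q (t - s) - ContinuousLinearMap.id ℝ _

/-- `a_{ts} = S_{t-s} - Id` on `𝓑_{α,q}`. -/
def aOpB {n : ℕ} {q : ℝ≥0∞} [Fact (1 ≤ q)] [Fact (q ≠ ⊤)] {α : Order} (t s : ℝ) :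
    BesselSp n q α →L[ℝ] BesselSp n q α :=
  BesselSp.heatB (t - s) - ContinuousLinearMap.id ℝ _

/-- The twisted coboundary `(δ̂y)_{tus} = (δy)_{tus} - a_{tu} y_{us}`. -/
def hatDelta {n : ℕ} {q : ℝ≥0∞} [Fact (1 ≤ q)] [Fact (q ≠ ⊤)] (y : ℝ → ℝ → LSp n q)
    (t u s : ℝ) : LSp n q :=
  delta2 y t u s - aOp t u (y u s)

/-! ### The integration by parts formulas on test functions -/

/-- `φ ∈ C_c^∞(ℝⁿ)`. -/
structure IsTest {n : ℕ} (φ : Space n → ℝ) : Prop where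
  smooth : ContDiff ℝ (⊤ : ℕ∞) φ
  compact : HasCompactSupport φ

/-- The class of a test function in `L^q`. -/
def IsTest.toLp {n : ℕ} {φ : Space n → ℝ} (h : IsTest φ) (q : ℝ≥0∞) : LSp n q :=
  (h.smooth.continuous.memLp_of_hasCompactSupport h.compact : MemLp φ q volume).toLp φ

/-- `A S_r φ = (∂_r g_r) * φ`, for `r > 0`. -/
def genHeat {n : ℕ} (r : ℝ) (φ : Space n → ℝ) (ξ : Space n) : ℝ :=
  ∫ y, deriv (fun τ => gaussKernel n τ y) r * φ (ξ - y)

/-- `(δz)_{ts} φ + ∫_s^t A S_{tu} φ (δz)_{us} du`. -/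
def ippX {n : ℕ} (z : ℝ → ℝ) (t s : ℝ) (φ : Space n → ℝ) (ξ : Space n) : ℝ :=
  delta1 z t s * φ ξ + ∫ u in s..t, genHeat (t - u) φ ξ * delta1 z u s

/-- `∫_s^t A S_{tu} φ (δz)_{us} du`. -/
def ippAX {n : ℕ} (z : ℝ → ℝ) (t s : ℝ) (φ : Space n → ℝ) (ξ : Space n) : ℝ :=
  ∫ u in s..t, genHeat (t - u) φ ξ * delta1 z u s

/-- `∫_s^t X^x_{tu} ((A S_{us} φ) · ψ) du`. -/
def ippXA {n : ℕ} (z : ℝ → ℝ) (t s : ℝ) (φ ψ : Space n → ℝ) (ξ : Space n) : ℝ :=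
  ∫ u in s..t, ippX z t u (fun ζ => genHeat (u - s) φ ζ * ψ ζ) ξ

/-- `z²_{ts} φ + ∫_s^t A S_{tu} φ z²_{us} du`. -/
def ippXX {n : ℕ} (z2 : ℝ → ℝ → ℝ) (t s : ℝ) (φ : Space n → ℝ) (ξ : Space n) : ℝ :=
  z2 t s * φ ξ + ∫ u in s..t, genHeat (t - u) φ ξ * z2 u s

/-! ### Exponents -/

instance factOneLe (p : ℕ) [h : Fact (2 ≤ p)] : Fact (1 ≤ (p : ℝ≥0∞)) :=
  ⟨by exact_mod_cast (by have := h.out; omega : 1 ≤ p)⟩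

instance factNeTop (p : ℕ) : Fact ((p : ℝ≥0∞) ≠ ⊤) := ⟨ENNReal.natCast_ne_top p⟩

instance factOneLeHalf (p : ℕ) [h : Fact (2 ≤ p)] : Fact (1 ≤ (p : ℝ≥0∞) / 2) :=
  ⟨by
    rw [ENNReal.le_div_iff_mul_le (by simp) (by simp), one_mul]
    exact_mod_cast h.out⟩

instance holderHalf (p : ℕ) : ENNReal.HolderTriple (p : ℝ≥0∞) (p : ℝ≥0∞) ((p : ℝ≥0∞) / 2) :=
  ⟨by
    rw [ENNReal.inv_div (by simp) (by simp), ENNReal.div_eq_inv_mul, mul_comm, two_mul]⟩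

/-- The pointwise product `𝓑_p × 𝓑_p → 𝓑_{p/2}`. -/
def mulHalf {n p : ℕ} [Fact (2 ≤ p)] (φ ψ : LSp n p) : LSp n ((p : ℝ≥0∞) / 2) := φ • ψ

/-! ### The heat equation rough path -/

/-- The operators `X^{x,i}_{ts}`, `X^{ax,i}_{ts}`, `X^{xa,i}_{ts}`, `X^{xx,ij}_{ts}`. The operator
`X^{x,i}_{ts}` acts both on `𝓑_p` and on `𝓑_{p/2}`, and the bilinear operator `X^{xa,i}_{ts}` acts
on `𝓑_{α,p} × 𝓑_p` for several `α`; `HeatOps.Coherent` says that the versions agree. -/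
structure HeatOps (n p N : ℕ) [Fact (2 ≤ p)] where
  Xx : Fin N → ℝ → ℝ → (LSp n p →L[ℝ] LSp n p)
  XxHalf : Fin N → ℝ → ℝ → (LSp n ((p : ℝ≥0∞) / 2) →L[ℝ] LSp n p)
  Xax : Fin N → ℝ → ℝ → (LSp n p →L[ℝ] LSp n p)
  Xxa : Fin N → (α : Order) → ℝ → ℝ → (BesselSp n p α →L[ℝ] LSp n p →L[ℝ] LSp n p)
  Xxx : Fin N → Fin N → ℝ → ℝ → (LSp n p →L[ℝ] LSp n p)

namespace HeatOps

open BesselSp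

/-- The different versions of one operator agree wherever two of them are defined. -/
structure Coherent {n p N : ℕ} [Fact (2 ≤ p)] (X : HeatOps n p N) (T : ℝ) : Prop where
  half : ∀ (i : Fin N) (s t : ℝ), 0 ≤ s → s ≤ t → t ≤ T →
    ∀ (φ : LSp n p) (φ' : LSp n ((p : ℝ≥0∞) / 2)), (φ : Space n → ℝ) =ᵐ[volume] φ' →
      X.XxHalf i t s φ' = X.Xx i t s φ
  xa : ∀ (i : Fin N) (α β : Order), (n : ℝ) < 2 * α * p → (n : ℝ) < 2 * β * p →
    ∀ s t : ℝ, 0 ≤ s → s ≤ t → t ≤ T →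
    ∀ (φ : BesselSp n p α) (φ' : BesselSp n p β) (ψ : LSp n p), incl φ = incl φ' →
      X.Xxa i α t s φ ψ = X.Xxa i β t s φ' ψ

/-- On `C_c^∞(ℝⁿ)`, the operators are given by the integration by parts formulas built on the path
`x` and its Lévy area `x2`. -/
structure ExtendsIPP {n p N : ℕ} [Fact (2 ≤ p)] (X : HeatOps n p N) (T : ℝ)
    (x : Fin N → ℝ → ℝ) (x2 : Fin N → Fin N → ℝ → ℝ → ℝ) : Prop where
  opX : ∀ (i : Fin N) (s t : ℝ), 0 ≤ s → s ≤ t → t ≤ T → ∀ (φ : Space n → ℝ) (hφ : IsTest φ),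
    X.Xx i t s (hφ.toLp p) =ᵐ[volume] ippX (x i) t s φ
  opXHalf : ∀ (i : Fin N) (s t : ℝ), 0 ≤ s → s ≤ t → t ≤ T → ∀ (φ : Space n → ℝ) (hφ : IsTest φ),
    X.XxHalf i t s (hφ.toLp _) =ᵐ[volume] ippX (x i) t s φ
  opAX : ∀ (i : Fin N) (s t : ℝ), 0 ≤ s → s ≤ t → t ≤ T → ∀ (φ : Space n → ℝ) (hφ : IsTest φ),
    X.Xax i t s (hφ.toLp p) =ᵐ[volume] ippAX (x i) t s φ
  opXA : ∀ (i : Fin N) (α : Order), (n : ℝ) < 2 * α * p → ∀ s t : ℝ, 0 ≤ s → s ≤ t → t ≤ T →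
    ∀ (φ ψ : Space n → ℝ) (hφ : IsTest φ) (hψ : IsTest ψ),
      ∃ φ' : BesselSp n p α, incl φ' = hφ.toLp p ∧
        X.Xxa i α t s φ' (hψ.toLp p) =ᵐ[volume] ippXA (x i) t s φ ψ
  opXX : ∀ (i j : Fin N) (s t : ℝ), 0 ≤ s → s ≤ t → t ≤ T → ∀ (φ : Space n → ℝ) (hφ : IsTest φ),
    X.Xxx i j t s (hφ.toLp p) =ᵐ[volume] ippXX (x2 i j) t s φ

/-- The algebraic conditions. -/
structure Algebraic {n p N : ℕ} [Fact (2 ≤ p)] (X : HeatOps n p N) (T : ℝ)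
    (x : Fin N → ℝ → ℝ) : Prop where
  opX : ∀ (i : Fin N) (s u t : ℝ), 0 ≤ s → s ≤ u → u ≤ t → t ≤ T → ∀ φ : LSp n p,
    hatDelta (fun t s => X.Xx i t s φ) t u s = 0
  opXHalf : ∀ (i : Fin N) (s u t : ℝ), 0 ≤ s → s ≤ u → u ≤ t → t ≤ T →
    ∀ φ : LSp n ((p : ℝ≥0∞) / 2), hatDelta (fun t s => X.XxHalf i t s φ) t u s = 0
  opAX : ∀ (i : Fin N) (s t : ℝ), 0 ≤ s → s ≤ t → t ≤ T → ∀ φ : LSp n p,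
    X.Xx i t s φ = X.Xax i t s φ + delta1 (x i) t s • φ
  opXA : ∀ (i : Fin N) (α : Order), (n : ℝ) < 2 * α * p →
    ∀ s u t : ℝ, 0 ≤ s → s ≤ u → u ≤ t → t ≤ T → ∀ (φ : BesselSp n p α) (ψ : LSp n p),
      hatDelta (fun t s => X.Xxa i α t s φ ψ) t u s =
        X.Xxa i α t u (aOpB u s φ) ψ + X.XxHalf i t u (mulHalf (aOp u s (incl φ)) ψ)
  opXX : ∀ (i j : Fin N) (s u t : ℝ), 0 ≤ s → s ≤ u → u ≤ t → t ≤ T → ∀ φ : LSp n p,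
    hatDelta (fun t s => X.Xxx i j t s φ) t u s = delta1 (x j) u s • X.Xx i t u φ

/-- `Y` is the restriction to `𝓑_{α,p}`, with values in `𝓑_{α,p}`, of the two-parameter family
of operators `Z` on `𝓑_p`. -/
def RestrictsTo {n p : ℕ} [Fact (2 ≤ p)] {α : Order} (T : ℝ)
    (Z : ℝ → ℝ → (LSp n p →L[ℝ] LSp n p))
    (Y : ℝ → ℝ → (BesselSp n p α →L[ℝ] BesselSp n p α)) : Prop :=
  ∀ s t : ℝ, 0 ≤ s → s ≤ t → t ≤ T → ∀ φ, incl (Y t s φ) = Z t s (incl φ)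

/-- The analytical conditions. -/
structure Analytic {n p N : ℕ} [Fact (2 ≤ p)] (X : HeatOps n p N) (T γ : ℝ) : Prop where
  opX : ∀ i : Fin N, HolderC2 T γ (X.Xx i)
  opXB : ∀ (i : Fin N) (α : Order), (n : ℝ) < 2 * α * p →
    ∃ Y : ℝ → ℝ → (BesselSp n p α →L[ℝ] BesselSp n p α),
      RestrictsTo T (X.Xx i) Y ∧ HolderC2 T γ Y
  opXHalf : ∀ i : Fin N, HolderC2 T (γ - n / (2 * p)) (X.XxHalf i)
  opAX : ∀ (i : Fin N) (α : Order), (n : ℝ) < 2 * α * p →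
    HolderC2 T (γ + α)
      (fun t s => ((X.Xax i t s).comp incl : BesselSp n p α →L[ℝ] LSp n p))
  opXA : ∀ (i : Fin N) (α : Order), (n : ℝ) < 2 * α * p →
    HolderC2 T (γ + α - n / (2 * p)) (X.Xxa i α)
  opXAB : ∀ (i : Fin N) (α : Order), (n : ℝ) < 2 * α * p →
    ∃ Y : ℝ → ℝ → (BesselSp n p α →L[ℝ] BesselSp n p α →L[ℝ] BesselSp n p α),
      (∀ s t : ℝ, 0 ≤ s → s ≤ t → t ≤ T → ∀ φ ψ,
        incl (Y t s φ ψ) = X.Xxa i α t s φ (incl ψ)) ∧ HolderC2 T γ Y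
  opXX : ∀ i j : Fin N, HolderC2 T (2 * γ) (X.Xxx i j)
  opXXB : ∀ (i j : Fin N) (α : Order), (n : ℝ) < 2 * α * p →
    ∃ Y : ℝ → ℝ → (BesselSp n p α →L[ℝ] BesselSp n p α),
      RestrictsTo T (X.Xxx i j) Y ∧ HolderC2 T (2 * γ) Y
  opXXBp : ∀ (i j : Fin N) (α : Order), (n : ℝ) < 2 * α * p →
    HolderC2 T (2 * γ)
      (fun t s => ((X.Xxx i j t s).comp incl : BesselSp n p α →L[ℝ] LSp n p))

end HeatOps

end HeatRough

end

noncomputable section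

namespace HeatRough

/-! ### Estimates on the Gaussian kernel -/

/-! The norm of A S_r on L^p is controlled only by 1/r, so the integral of A S_{t-u} φ (δx)_{us}
need not converge absolutely for general φ. Integrating by parts cures this: X^x_{ts} should equal
(δx)_{ts} S_{t-s} - ∫_0^{t-s} ((δx)_{ts} - (δx)_{t-r,s}) A S_r dr, where the increment of x pays r^γ
against 1/r. This is `heatOp`, and it converges in operator norm. It is built for any driver y with
|y_{ts} - y_{us}| ≤ C (t-u)^γ (t-s)^{μ-γ} (`IsDriver`) and any family with ‖S_r‖ ≤ C r^{-κ} obeying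
the semigroup law (`IsHeatFamily`). The drivers are δx, with μ = γ, and the Lévy area, with μ = 2γ,
where Chen's relation gives the increment bound. The families are S on L^p, with κ = 0, and S from
L^{p/2} to L^p, with κ = n/(2p). Convergence needs κ < γ, which is the hypothesis γ > n/(2p), and
yields the order μ - κ (`norm_heatOp_le`, `continuousOn_heatOp`).

The algebra of X^x and X^{xx} is one identity, `heatOp_chen`: if y_{vs} - y_{us} = y'_{vu}, then the
operator of y over [s,t], minus S_{t-u} times that over [s,u], is the operator of y' over [u,t].
Both operators commute with convolutions, hence with (-Δ)^α, so they restrict to 𝓑_{α,p} without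
loss.

The gain for X^{ax} comes from ‖A S_r φ‖ ≲ r^{α-1} and ‖S_r φ - φ‖ ≲ r^α on 𝓑_{α,p}. Both follow
from the modulus of continuity ‖τ_y φ - φ‖ ≲ |y|^{2α} (`exists_nikBound_incl`). To get it from the
norm ‖φ‖ + ‖(-Δ)^α φ‖ one writes φ as a Bessel potential of (-Δ)^α φ plus a bounded operator of φ
(`IsFracLap.eq_besselJ`), by a Beta integral.

X^{xa} is the integral over r of X^x_{t,s+r}((A S_r φ)·ψ), convergent in operator norm because
r^{α-1} is integrable; splitting it at u gives its twisted Chen relation (`xaOp_chen`). For values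
in 𝓑_{α,p}, the product (A S_r φ)·ψ has regularity b slightly below α, and X^x raises b to any a < γ
+ b. With a slightly above α, the value W of X^{xa} satisfies ‖S_{2ρ} W - W‖ ≲ ρ^a, which together
with its L^p size places it in 𝓑_{α,p} with the right power of t - s (`exists_xaOp_bounds`,
`exists_holderC2_bilinear_lift`).

On Lipschitz functions of compact support A S_r φ is O(r^{-1/2}), so the integration by parts can be
undone. Bochner integrals in L^q are then identified with pointwise ones (`coeFn_integral`), which
gives the defining formulas on test functions. -/

/-- The time derivative of the Gaussian kernel, for `t > 0`. -/
def gaussDot (n : ℕ) (t : ℝ) (ξ : Space n) : ℝ :=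
  gaussKernel n t ξ * (‖ξ‖ ^ 2 / (2 * t ^ 2) - n / (2 * t))

theorem hasDerivAt_gaussKernel (n : ℕ) {t : ℝ} (ht : 0 < t) (ξ : Space n) :
    HasDerivAt (fun τ => gaussKernel n τ ξ) (gaussDot n t ξ) t := by
  have hpt : 0 < 2 * Real.pi * t := by positivity
  have h1 : HasDerivAt (fun τ : ℝ => 2 * Real.pi * τ) (2 * Real.pi) t := by
    simpa using (hasDerivAt_id t).const_mul (2 * Real.pi)
  have h2 := h1.rpow_const (p := -(n : ℝ) / 2) (Or.inl hpt.ne')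
  have h3 : HasDerivAt (fun τ : ℝ => -‖ξ‖ ^ 2 / (2 * τ)) (‖ξ‖ ^ 2 / (2 * t ^ 2)) t := by
    have := ((hasDerivAt_id t).const_mul (2 : ℝ)).inv (by simp; positivity)
    have := this.const_mul (-‖ξ‖ ^ 2)
    refine this.congr_deriv ?_
    simp only [id, mul_one]
    field_simp
  refine (h2.mul h3.exp).congr_deriv ?_
  rw [gaussDot, gaussKernel, Real.rpow_sub hpt, Real.rpow_one]
  field_simp
  ring

theorem deriv_gaussKernel (n : ℕ) {t : ℝ} (ht : 0 < t) (ξ : Space n) :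
    deriv (fun τ => gaussKernel n τ ξ) t = gaussDot n t ξ :=
  (hasDerivAt_gaussKernel n ht ξ).deriv

theorem measurable_gaussKernel (n : ℕ) :
    Measurable fun z : ℝ × Space n => gaussKernel n z.1 z.2 := by
  unfold gaussKernel; fun_prop

theorem measurable_gaussDot (n : ℕ) :
    Measurable fun z : ℝ × Space n => gaussDot n z.1 z.2 := by
  have := measurable_gaussKernel n
  unfold gaussDot; fun_prop

theorem continuous_gaussKernel (n : ℕ) (t : ℝ) : Continuous (gaussKernel n t) := by
  unfold gaussKernel; fun_prop

theorem continuous_gaussDot (n : ℕ) (t : ℝ) : Continuous (gaussDot n t) := by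
  have := continuous_gaussKernel n t
  unfold gaussDot; fun_prop

/-- Widening the variance by a factor c leaves an exponential factor that can absorb polynomials in
|ξ|²/t. Kernel bounds thus stay multiples of Gaussians, whose mass is one. -/
theorem gaussKernel_eq_exp_mul (n : ℕ) {t c : ℝ} (ht : 0 < t) (hc : 0 < c) (ξ : Space n) :
    gaussKernel n t ξ =
      c ^ ((n : ℝ) / 2) * Real.exp (-(1 - 1 / c) * (‖ξ‖ ^ 2 / t) / 2) * gaussKernel n (c * t) ξ := by
  have h1 : (2 * Real.pi * (c * t)) ^ (-(n : ℝ) / 2) =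
      c ^ (-(n : ℝ) / 2) * (2 * Real.pi * t) ^ (-(n : ℝ) / 2) := by
    rw [← Real.mul_rpow hc.le (by positivity)]; ring_nf
  have h2 : c ^ ((n : ℝ) / 2) * c ^ (-(n : ℝ) / 2) = 1 := by
    rw [← Real.rpow_add hc]; ring_nf; simp
  have h3 : Real.exp (-‖ξ‖ ^ 2 / (2 * t)) = Real.exp (-(1 - 1 / c) * (‖ξ‖ ^ 2 / t) / 2) *
      Real.exp (-‖ξ‖ ^ 2 / (2 * (c * t))) := by
    rw [← Real.exp_add]; congr 1; field_simp; ring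
  rw [gaussKernel, gaussKernel, h1, h3]
  linear_combination (-(2 * Real.pi * t) ^ (-(n : ℝ) / 2) *
    Real.exp (-(1 - 1 / c) * (‖ξ‖ ^ 2 / t) / 2) *
      Real.exp (-‖ξ‖ ^ 2 / (2 * (c * t)))) * h2

theorem gaussKernel_le_of_le (n : ℕ) {t t' : ℝ} (ht : 0 < t) (h : t ≤ t') (ξ : Space n) :
    gaussKernel n t ξ ≤ (t' / t) ^ ((n : ℝ) / 2) * gaussKernel n t' ξ := by
  have hc : 0 < t' / t := div_pos (ht.trans_le h) ht
  have h1 := gaussKernel_eq_exp_mul n ht hc ξ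
  rw [div_mul_cancel₀ _ ht.ne'] at h1
  rw [h1]
  refine mul_le_mul_of_nonneg_right ?_ (gaussKernel_nonneg n (ht.trans_le h) ξ)
  refine mul_le_of_le_one_right (by positivity) (Real.exp_le_one_iff.2 ?_)
  have h2 : 1 / (t' / t) ≤ 1 := by rw [div_le_one hc, le_div_iff₀ ht]; linarith
  have h3 : 0 ≤ ‖ξ‖ ^ 2 / t := by positivity
  nlinarith

theorem one_add_mul_exp_le {u c : ℝ} (hc : 1 ≤ c) :
    (1 + u) * Real.exp (-u / c) ≤ c := by
  have h1 := Real.add_one_le_exp (u / c)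
  have h2 : 1 + u ≤ c * Real.exp (u / c) := by
    have : u / c * c = u := div_mul_cancel₀ _ (by positivity)
    nlinarith
  calc (1 + u) * Real.exp (-u / c) ≤ c * Real.exp (u / c) * Real.exp (-u / c) := by gcongr
    _ = c := by rw [mul_assoc, ← Real.exp_add, neg_div, add_neg_cancel, Real.exp_zero, mul_one]

/-- Doubling the variance leaves exp(-u/4) with u = |ξ|²/t, and (1 + u) exp(-u/4) ≤ 4. -/
theorem one_add_mul_gaussKernel_le (n : ℕ) {t : ℝ} (ht : 0 < t) (ξ : Space n) :
    (1 + ‖ξ‖ ^ 2 / t) * gaussKernel n t ξ ≤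
      4 * 2 ^ ((n : ℝ) / 2) * gaussKernel n (2 * t) ξ := by
  rw [gaussKernel_eq_exp_mul n ht two_pos ξ]
  have h := one_add_mul_exp_le (u := ‖ξ‖ ^ 2 / t) (c := 4) (by norm_num)
  have h2 : -(1 - 1 / 2 : ℝ) * (‖ξ‖ ^ 2 / t) / 2 = -(‖ξ‖ ^ 2 / t) / 4 := by ring
  rw [h2]
  have h3 := gaussKernel_nonneg n (t := 2 * t) (by positivity) ξ
  calc _ = ((1 + ‖ξ‖ ^ 2 / t) * Real.exp (-(‖ξ‖ ^ 2 / t) / 4)) *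
        (2 ^ ((n : ℝ) / 2) * gaussKernel n (2 * t) ξ) := by ring
    _ ≤ 4 * (2 ^ ((n : ℝ) / 2) * gaussKernel n (2 * t) ξ) := by gcongr
    _ = _ := by ring

theorem rpow_le_one_add {u b : ℝ} (hu : 0 ≤ u) (hb0 : 0 ≤ b) (hb : b ≤ 1) : u ^ b ≤ 1 + u := by
  rcases le_total u 1 with h | h
  · exact (Real.rpow_le_one hu h hb0).trans (by linarith)
  · calc u ^ b ≤ u ^ (1 : ℝ) := Real.rpow_le_rpow_of_exponent_le h hb
      _ ≤ 1 + u := by rw [Real.rpow_one]; linarith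

theorem norm_rpow_two_mul (n : ℕ) (b : ℝ) (ξ : Space n) : ‖ξ‖ ^ (2 * b) = (‖ξ‖ ^ 2) ^ b := by
  rw [← Real.rpow_natCast_mul (norm_nonneg _)]; norm_num

theorem gaussKernel_mul_norm_rpow_le (n : ℕ) {t b : ℝ} (ht : 0 < t) (hb0 : 0 ≤ b) (hb : b ≤ 1)
    (ξ : Space n) : gaussKernel n t ξ * ‖ξ‖ ^ (2 * b) ≤
      4 * 2 ^ ((n : ℝ) / 2) * t ^ b * gaussKernel n (2 * t) ξ := by
  have h1 : ‖ξ‖ ^ (2 * b) = t ^ b * (‖ξ‖ ^ 2 / t) ^ b := by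
    rw [norm_rpow_two_mul, ← Real.mul_rpow ht.le (by positivity), mul_div_cancel₀ _ ht.ne']
  have h2 := rpow_le_one_add (u := ‖ξ‖ ^ 2 / t) (by positivity) hb0 hb
  have h3 := one_add_mul_gaussKernel_le n ht ξ
  have h4 := gaussKernel_nonneg n ht ξ
  rw [h1]
  calc _ = t ^ b * ((‖ξ‖ ^ 2 / t) ^ b * gaussKernel n t ξ) := by ring
    _ ≤ t ^ b * ((1 + ‖ξ‖ ^ 2 / t) * gaussKernel n t ξ) := by gcongr
    _ ≤ t ^ b * (4 * 2 ^ ((n : ℝ) / 2) * gaussKernel n (2 * t) ξ) := by gcongr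
    _ = _ := by ring

/-- A constant bounding the time derivative of the Gaussian kernel. -/
def dotC (n : ℕ) : ℝ := (n + 1) * 4 * 2 ^ ((n : ℝ) / 2)

theorem dotC_pos (n : ℕ) : 0 < dotC n := by unfold dotC; positivity

theorem four_le_dotC (n : ℕ) : 4 * 2 ^ ((n : ℝ) / 2) ≤ dotC n := by
  unfold dotC
  have : (0 : ℝ) ≤ n := Nat.cast_nonneg n
  have h : (0 : ℝ) < 2 ^ ((n : ℝ) / 2) := by positivity
  nlinarith [mul_nonneg this h.le]

/-- The logarithmic time derivative of the kernel is (u - n)/(2t) with u = |ξ|²/t. Its growth in u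
is absorbed by doubling the variance, so only the factor 1/t is lost. This is the source of ‖A S_t‖
≲ 1/t. -/
theorem abs_gaussDot_le (n : ℕ) {t : ℝ} (ht : 0 < t) (ξ : Space n) :
    |gaussDot n t ξ| ≤ dotC n / t * gaussKernel n (2 * t) ξ := by
  have h3 := one_add_mul_gaussKernel_le n ht ξ
  have h4 := gaussKernel_nonneg n ht ξ
  have hn : (0 : ℝ) ≤ n := Nat.cast_nonneg n
  set u := ‖ξ‖ ^ 2 / t with hu
  have hu0 : 0 ≤ u := by positivity
  have h5 : ‖ξ‖ ^ 2 / (2 * t ^ 2) - n / (2 * t) = (u - n) / (2 * t) := by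
    rw [hu]; field_simp
  rw [gaussDot, abs_mul, abs_of_nonneg h4, h5, abs_div, abs_of_pos (by positivity : 0 < 2 * t)]
  have h6 : |u - n| ≤ (n + 1) * (1 + u) := by
    rw [abs_le]; constructor <;> nlinarith [mul_nonneg hn hu0]
  calc gaussKernel n t ξ * (|u - n| / (2 * t))
      ≤ gaussKernel n t ξ * ((n + 1) * (1 + u) / (1 * t)) := by gcongr; norm_num
    _ = (n + 1) / t * ((1 + u) * gaussKernel n t ξ) := by ring
    _ ≤ (n + 1) / t * (4 * 2 ^ ((n : ℝ) / 2) * gaussKernel n (2 * t) ξ) := by gcongr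
    _ = _ := by rw [dotC]; ring

theorem integrable_gaussDot (n : ℕ) {t : ℝ} (ht : 0 < t) : Integrable (gaussDot n t) volume := by
  refine ((integrable_gaussKernel n (t := 2 * t) (by positivity)).const_mul (dotC n / t)).mono'
    (continuous_gaussDot n t).aestronglyMeasurable ?_
  filter_upwards with ξ
  exact abs_gaussDot_le n ht ξ

theorem integral_abs_gaussDot_le (n : ℕ) {t : ℝ} (ht : 0 < t) :
    ∫ ξ, ‖gaussDot n t ξ‖ ≤ dotC n / t := by
  have h := integral_mono (integrable_gaussDot n ht).norm
    ((integrable_gaussKernel n (t := 2 * t) (by positivity)).const_mul (dotC n / t))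
    (fun ξ => abs_gaussDot_le n ht ξ)
  rwa [integral_const_mul, integral_gaussKernel n (by positivity), mul_one] at h

theorem integrable_gaussKernel_mul_rpow (n : ℕ) {t b : ℝ} (ht : 0 < t) (hb0 : 0 ≤ b)
    (hb : b ≤ 1) : Integrable (fun ξ => gaussKernel n t ξ * ‖ξ‖ ^ (2 * b)) volume := by
  refine ((integrable_gaussKernel n (t := 2 * t) (by positivity)).const_mul
    (4 * 2 ^ ((n : ℝ) / 2) * t ^ b)).mono' ?_ ?_
  · refine ((continuous_gaussKernel n t).mul ?_).aestronglyMeasurable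
    exact continuous_norm.rpow_const fun _ => Or.inr (by positivity)
  · filter_upwards with ξ
    rw [Real.norm_of_nonneg (mul_nonneg (gaussKernel_nonneg n ht ξ) (by positivity))]
    exact gaussKernel_mul_norm_rpow_le n ht hb0 hb ξ

theorem integral_gaussKernel_mul_rpow_le (n : ℕ) {t b : ℝ} (ht : 0 < t) (hb0 : 0 ≤ b)
    (hb : b ≤ 1) : ∫ ξ, gaussKernel n t ξ * ‖ξ‖ ^ (2 * b) ≤ dotC n * t ^ b := by
  have h := integral_mono (integrable_gaussKernel_mul_rpow n ht hb0 hb)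
    ((integrable_gaussKernel n (t := 2 * t) (by positivity)).const_mul
      (4 * 2 ^ ((n : ℝ) / 2) * t ^ b))
    (fun ξ => gaussKernel_mul_norm_rpow_le n ht hb0 hb ξ)
  rw [integral_const_mul, integral_gaussKernel n (by positivity), mul_one] at h
  exact h.trans (mul_le_mul_of_nonneg_right (four_le_dotC n) (by positivity))

theorem integrable_gaussDot_mul_rpow (n : ℕ) {t b : ℝ} (ht : 0 < t) (hb0 : 0 ≤ b)
    (hb : b ≤ 1) : Integrable (fun ξ => ‖gaussDot n t ξ‖ * ‖ξ‖ ^ (2 * b)) volume := by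
  refine ((integrable_gaussKernel_mul_rpow n (t := 2 * t) (by positivity) hb0 hb).const_mul
    (dotC n / t)).mono' ?_ ?_
  · refine ((continuous_gaussDot n t).norm.mul ?_).aestronglyMeasurable
    exact continuous_norm.rpow_const fun _ => Or.inr (by positivity)
  · filter_upwards with ξ
    rw [norm_mul, norm_norm, Real.norm_of_nonneg (by positivity : 0 ≤ ‖ξ‖ ^ (2 * b)), ← mul_assoc]
    exact mul_le_mul_of_nonneg_right (abs_gaussDot_le n ht ξ) (by positivity)

/-- A weight |ξ|^{2b} counts as t^b under the Gaussian, which softens the singularity 1/t of the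
generator to t^{b-1}. -/
theorem integral_gaussDot_mul_rpow_le (n : ℕ) {t b : ℝ} (ht : 0 < t) (hb0 : 0 ≤ b)
    (hb : b ≤ 1) :
    ∫ ξ, ‖gaussDot n t ξ‖ * ‖ξ‖ ^ (2 * b) ≤ 2 * dotC n ^ 2 * t ^ (b - 1) := by
  have h2 := integral_gaussKernel_mul_rpow_le n (t := 2 * t) (by positivity) hb0 hb
  have h := integral_mono (integrable_gaussDot_mul_rpow n ht hb0 hb)
    ((integrable_gaussKernel_mul_rpow n (t := 2 * t) (by positivity) hb0 hb).const_mul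
      (dotC n / t))
    (fun ξ => by
      simp only [← mul_assoc]
      exact mul_le_mul_of_nonneg_right (abs_gaussDot_le n ht ξ) (by positivity))
  have hC := dotC_pos n
  have h3 : (2 * t) ^ b ≤ 2 * t ^ b := by
    rw [Real.mul_rpow zero_le_two ht.le]
    gcongr
    calc (2 : ℝ) ^ b ≤ 2 ^ (1 : ℝ) := Real.rpow_le_rpow_of_exponent_le one_le_two hb
      _ = 2 := Real.rpow_one 2
  rw [integral_const_mul] at h
  calc _ ≤ _ := h
    _ ≤ dotC n / t * (dotC n * (2 * t ^ b)) := by gcongr; exact h2.trans (by gcongr)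
    _ = _ := by rw [Real.rpow_sub ht, Real.rpow_one]; ring

/-! ### Increments of the Gaussian kernel in space. -/

theorem abs_exp_neg_sub_exp_neg_le {a b m : ℝ} (ha : m ≤ a) (hb : m ≤ b) :
    |Real.exp (-a) - Real.exp (-b)| ≤ |a - b| * Real.exp (-m) := by
  wlog h : a ≤ b generalizing a b
  · rw [abs_sub_comm, abs_sub_comm a b]; exact this hb ha (by linarith)
  have h1 : Real.exp (-b) = Real.exp (-a) * Real.exp (a - b) := by rw [← Real.exp_add]; ring_nf
  have h2 := Real.add_one_le_exp (a - b)
  have h3 : Real.exp (a - b) ≤ 1 := Real.exp_le_one_iff.2 (by linarith)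
  have h4 : Real.exp (-a) ≤ Real.exp (-m) := Real.exp_le_exp.2 (by linarith)
  have h5 := Real.exp_pos (-a)
  rw [h1, abs_of_nonneg (by nlinarith), abs_of_nonpos (by linarith)]
  calc _ = Real.exp (-a) * (1 - Real.exp (a - b)) := by ring
    _ ≤ Real.exp (-m) * (b - a) :=
        mul_le_mul h4 (by linarith) (by linarith) (Real.exp_pos _).le
    _ = _ := by ring

/-- With v = |ξ|²/t and |y| ≤ √t, both exponents are at least v/4 - 1/2. The mean value inequality
for exp therefore bounds the increment by the difference of exponents, at most (|y|/√t)(1 + v),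
times e^{-v/4}. Half of that decay absorbs 1 + v, and the other half is the Gaussian at time 4t. -/
theorem abs_gaussKernel_sub_le (n : ℕ) {t : ℝ} (ht : 0 < t) (y ξ : Space n)
    (hy : ‖y‖ ^ 2 ≤ t) : |gaussKernel n t (ξ - y) - gaussKernel n t ξ| ≤
      16 * 4 ^ ((n : ℝ) / 2) * (‖y‖ / √t) * gaussKernel n (4 * t) ξ := by
  set v := ‖ξ‖ ^ 2 / t with hv
  have hv0 : 0 ≤ v := by positivity
  have hst : 0 < √t := Real.sqrt_pos.2 ht
  have hsq : √t * √t = t := Real.mul_self_sqrt ht.le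
  have n0 := norm_nonneg y
  have n1 := norm_nonneg ξ
  have n2 := norm_nonneg (ξ - y)
  have hyt : ‖y‖ ≤ √t := Real.le_sqrt_of_sq_le hy
  have tri : ‖ξ‖ ≤ ‖ξ - y‖ + ‖y‖ := by simpa using norm_add_le (ξ - y) y
  have tri2 : ‖ξ - y‖ ≤ ‖ξ‖ + ‖y‖ := norm_sub_le ξ y
  have hA : v / 4 - 1 / 2 ≤ ‖ξ - y‖ ^ 2 / (2 * t) := by
    have h0 : ‖ξ‖ ^ 2 ≤ 2 * ‖ξ - y‖ ^ 2 + 2 * ‖y‖ ^ 2 := by nlinarith [sq_nonneg (‖ξ - y‖ - ‖y‖)]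
    rw [hv, le_div_iff₀ (by positivity)]
    have : (‖ξ‖ ^ 2 / t / 4 - 1 / 2) * (2 * t) = ‖ξ‖ ^ 2 / 2 - t := by field_simp; ring
    rw [this]; linarith
  have hB : v / 4 - 1 / 2 ≤ ‖ξ‖ ^ 2 / (2 * t) := by
    have : ‖ξ‖ ^ 2 / (2 * t) = v / 2 := by rw [hv]; field_simp
    rw [this]; linarith
  have hAB := abs_exp_neg_sub_exp_neg_le hA hB
  have hd : |‖ξ - y‖ ^ 2 / (2 * t) - ‖ξ‖ ^ 2 / (2 * t)| ≤ (‖y‖ / √t) * (1 + v) := by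
    rw [← sub_div, abs_div, abs_of_pos (by positivity : 0 < 2 * t), div_le_iff₀ (by positivity)]
    have e1 : |‖ξ - y‖ ^ 2 - ‖ξ‖ ^ 2| ≤ ‖y‖ * (2 * ‖ξ‖ + ‖y‖) := by
      rw [abs_le]; constructor <;> nlinarith
    have e2 : ‖y‖ / √t * (1 + v) * (2 * t) = ‖y‖ * (2 * √t + 2 * (‖ξ‖ ^ 2 / √t)) := by
      rw [hv]
      have e : ‖y‖ / √t * (1 + ‖ξ‖ ^ 2 / t) * (2 * t) = 2 * ‖y‖ * (t / √t + ‖ξ‖ ^ 2 / √t) := by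
        field_simp
      rw [e, Real.div_sqrt]
      ring
    rw [e2]
    refine e1.trans (mul_le_mul_of_nonneg_left ?_ n0)
    have e3 : 2 * ‖ξ‖ ≤ √t + ‖ξ‖ ^ 2 / √t := by
      rw [← sub_nonneg]
      have : √t + ‖ξ‖ ^ 2 / √t - 2 * ‖ξ‖ = (√t - ‖ξ‖) ^ 2 / √t := by field_simp; ring
      rw [this]; positivity
    have e4 : 0 ≤ ‖ξ‖ ^ 2 / √t := by positivity
    linarith
  -- The shift by 1/2 costs e^{1/2} ≤ 2, since e < 4.
  have hexp : Real.exp (-(v / 4 - 1 / 2)) ≤ 2 * Real.exp (-v / 4) := by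
    have : Real.exp (-(v / 4 - 1 / 2)) = Real.exp (1 / 2) * Real.exp (-v / 4) := by
      rw [← Real.exp_add]; ring_nf
    rw [this]
    gcongr
    have h := Real.exp_one_lt_d9
    have h1 : Real.exp (1 / 2) ^ 2 = Real.exp 1 := by rw [← Real.exp_nat_mul]; norm_num
    nlinarith [Real.exp_pos (1 / 2 : ℝ)]
  have h1v := one_add_mul_exp_le (u := v) (c := 8) (by norm_num)
  have hsplit : Real.exp (-v / 4) = Real.exp (-v / 8) * Real.exp (-v / 8) := by
    rw [← Real.exp_add]; ring_nf
  have h4 : gaussKernel n (4 * t) ξ * 4 ^ ((n : ℝ) / 2) =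
      (2 * Real.pi * t) ^ (-(n : ℝ) / 2) * Real.exp (-v / 8) := by
    have e1 : (2 * Real.pi * (4 * t)) ^ (-(n : ℝ) / 2) =
        4 ^ (-(n : ℝ) / 2) * (2 * Real.pi * t) ^ (-(n : ℝ) / 2) := by
      rw [← Real.mul_rpow (by norm_num) (by positivity)]; ring_nf
    have e2 : (4 : ℝ) ^ ((n : ℝ) / 2) * 4 ^ (-(n : ℝ) / 2) = 1 := by
      rw [← Real.rpow_add (by norm_num)]; ring_nf; simp
    have e3 : -‖ξ‖ ^ 2 / (2 * (4 * t)) = -v / 8 := by rw [hv]; field_simp; ring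
    rw [gaussKernel, e1, e3]
    linear_combination ((2 * Real.pi * t) ^ (-(n : ℝ) / 2) * Real.exp (-v / 8)) * e2
  set P := (2 * Real.pi * t) ^ (-(n : ℝ) / 2) with hP
  have hP0 : 0 ≤ P := by positivity
  have hk : gaussKernel n t (ξ - y) - gaussKernel n t ξ =
      P * (Real.exp (-(‖ξ - y‖ ^ 2 / (2 * t))) - Real.exp (-(‖ξ‖ ^ 2 / (2 * t)))) := by
    rw [gaussKernel, gaussKernel, ← hP]; simp only [neg_div]; ring
  rw [hk, abs_mul, abs_of_nonneg hP0]
  calc _ ≤ P * ((‖y‖ / √t) * (1 + v) * (2 * (Real.exp (-v / 8) * Real.exp (-v / 8)))) := by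
        rw [← hsplit]
        gcongr
        exact hAB.trans (mul_le_mul hd hexp (Real.exp_pos _).le (by positivity))
    _ = 2 * P * (‖y‖ / √t) * ((1 + v) * Real.exp (-v / 8)) * Real.exp (-v / 8) := by ring
    _ ≤ 2 * P * (‖y‖ / √t) * 8 * Real.exp (-v / 8) := by gcongr
    _ = 16 * (‖y‖ / √t) * (P * Real.exp (-v / 8)) := by ring
    _ = _ := by rw [← h4]; ring

/-- A constant bounding the modulus of continuity of the Gaussian kernel in `L¹`. -/
def shiftC (n : ℕ) : ℝ := 16 * 4 ^ ((n : ℝ) / 2)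

theorem two_le_shiftC (n : ℕ) : 2 ≤ shiftC n := by
  have : (1 : ℝ) ≤ 4 ^ ((n : ℝ) / 2) := Real.one_le_rpow (by norm_num) (by positivity)
  unfold shiftC; linarith

/-- For |y| ≤ √t the pointwise bound is integrated. For larger y the total mass 2 suffices, because
`shiftC` is at least 2 and |y|/√t at least 1. -/
theorem integral_abs_gaussKernel_sub_le (n : ℕ) {t : ℝ} (ht : 0 < t) (y : Space n) :
    ∫ ξ, ‖gaussKernel n t (ξ - y) - gaussKernel n t ξ‖ ≤ shiftC n * (‖y‖ / √t) := by
  have hi := integrable_gaussKernel n ht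
  have hi' : Integrable (fun ξ => gaussKernel n t (ξ - y)) volume := hi.comp_sub_right y
  have hst : 0 < √t := Real.sqrt_pos.2 ht
  by_cases hy : ‖y‖ ^ 2 ≤ t
  · have h := integral_mono (hi'.sub hi).norm
      ((integrable_gaussKernel n (t := 4 * t) (by positivity)).const_mul
        (16 * 4 ^ ((n : ℝ) / 2) * (‖y‖ / √t)))
      (fun ξ => abs_gaussKernel_sub_le n ht y ξ hy)
    rwa [integral_const_mul, integral_gaussKernel n (by positivity), mul_one] at h
  · have h1 : 1 ≤ ‖y‖ / √t := by
      rw [one_le_div hst]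
      exact Real.sqrt_le_iff.2 ⟨norm_nonneg _, by linarith⟩
    have h := integral_mono (hi'.sub hi).norm (hi'.norm.add hi.norm)
      (fun ξ => norm_sub_le (gaussKernel n t (ξ - y)) (gaussKernel n t ξ))
    have e : ∀ ξ, ‖gaussKernel n t ξ‖ = gaussKernel n t ξ := fun ξ =>
      Real.norm_of_nonneg (gaussKernel_nonneg n ht ξ)
    have h2 : ∫ ξ, (‖gaussKernel n t (ξ - y)‖ + ‖gaussKernel n t ξ‖) = 2 := by
      simp only [e]
      rw [integral_add hi' hi, integral_sub_right_eq_self (fun ξ => gaussKernel n t ξ) y,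
        integral_gaussKernel n ht]
      norm_num
    have h3 : ∫ ξ, ‖gaussKernel n t (ξ - y) - gaussKernel n t ξ‖ ≤ 2 := by
      rw [← h2]; exact h
    nlinarith [two_le_shiftC n]

/-- Completing the square in y: the product is a Gaussian in z of variance r + s times a Gaussian in
y of variance rs/(r+s) centred at rz/(r+s). Integrating out y gives the semigroup law without
Fourier analysis. -/
theorem gaussKernel_mul_gaussKernel (n : ℕ) {r s : ℝ} (hr : 0 < r) (hs : 0 < s) (y z : Space n) :
    gaussKernel n r y * gaussKernel n s (z - y) =
      gaussKernel n (r + s) z * gaussKernel n (r * s / (r + s)) (y - (r / (r + s)) • z) := by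
  have h1 : (2 * Real.pi * r) ^ (-(n : ℝ) / 2) * (2 * Real.pi * s) ^ (-(n : ℝ) / 2) =
      (2 * Real.pi * (r + s)) ^ (-(n : ℝ) / 2) *
        (2 * Real.pi * (r * s / (r + s))) ^ (-(n : ℝ) / 2) := by
    rw [← Real.mul_rpow (by positivity) (by positivity),
      ← Real.mul_rpow (by positivity) (by positivity)]
    congr 1
    field_simp
  have h2 : -‖y‖ ^ 2 / (2 * r) + -‖z - y‖ ^ 2 / (2 * s) =
      -‖z‖ ^ 2 / (2 * (r + s)) +
        -‖y - (r / (r + s)) • z‖ ^ 2 / (2 * (r * s / (r + s))) := by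
    rw [norm_sub_sq_real, norm_sub_sq_real, real_inner_smul_right, norm_smul,
      Real.norm_of_nonneg (by positivity : 0 ≤ r / (r + s)), real_inner_comm z y]
    field_simp
    ring
  simp only [gaussKernel]
  calc _ = ((2 * Real.pi * r) ^ (-(n : ℝ) / 2) * (2 * Real.pi * s) ^ (-(n : ℝ) / 2)) *
        Real.exp (-‖y‖ ^ 2 / (2 * r) + -‖z - y‖ ^ 2 / (2 * s)) := by rw [Real.exp_add]; ring
    _ = _ := by rw [h1, h2, Real.exp_add]; ring

theorem integral_gaussKernel_conv (n : ℕ) {r s : ℝ} (hr : 0 < r) (hs : 0 < s) (z : Space n) :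
    ∫ y, gaussKernel n r y * gaussKernel n s (z - y) = gaussKernel n (r + s) z := by
  simp only [gaussKernel_mul_gaussKernel n hr hs]
  rw [integral_const_mul, integral_sub_right_eq_self (gaussKernel n (r * s / (r + s))),
    integral_gaussKernel n (by positivity),
    mul_one]

/-- Differentiation of `t ↦ ∫ g_t(y) F(y) dy`, for bounded continuous `F`. -/
theorem hasDerivAt_integral_gaussKernel (n : ℕ) {E : Type*} [NormedAddCommGroup E]
    [NormedSpace ℝ E] {F : Space n → E} (hF : Continuous F) {M : ℝ} (hM : ∀ y, ‖F y‖ ≤ M) {t : ℝ}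
    (ht : 0 < t) :
    HasDerivAt (fun r => ∫ y, gaussKernel n r y • F y) (∫ y, gaussDot n t y • F y) t := by
  have hM0 : 0 ≤ M := (norm_nonneg _).trans (hM 0)
  -- On the window (t/2, 2t) a single Gaussian dominates: 2r ≤ 4t, and the ratio 4t/(2r) stays below
  -- 4.
  refine (hasDerivAt_integral_of_dominated_loc_of_deriv_le (𝕜 := ℝ) (E := E)
    (F := fun r y => gaussKernel n r y • F y) (F' := fun r y => gaussDot n r y • F y)
    (bound := fun y => dotC n / (t / 2) * ((4 : ℝ) ^ ((n : ℝ) / 2) * gaussKernel n (4 * t) y) * M)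
    (Ioo_mem_nhds (by linarith : t / 2 < t) (by linarith : t < 2 * t)) ?_ ?_ ?_ ?_ ?_ ?_).2
  · filter_upwards with r
    exact ((continuous_gaussKernel n r).smul hF).aestronglyMeasurable
  · refine ((integrable_gaussKernel n ht).norm.mul_const M).mono'
      ((continuous_gaussKernel n t).smul hF).aestronglyMeasurable ?_
    filter_upwards with y
    rw [norm_smul]
    exact mul_le_mul_of_nonneg_left (hM y) (norm_nonneg _)
  · exact ((continuous_gaussDot n t).smul hF).aestronglyMeasurable
  · filter_upwards with y r hr
    have hr0 : 0 < r := by linarith [hr.1]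
    rw [norm_smul]
    refine mul_le_mul ?_ (hM y) (norm_nonneg _) ?_
    · refine (abs_gaussDot_le n hr0 y).trans ?_
      have hg := gaussKernel_nonneg n (t := 4 * t) (by positivity) y
      have h1 := gaussKernel_le_of_le n (t := 2 * r) (t' := 4 * t) (by positivity)
        (by linarith [hr.2]) y
      have h2 : (4 * t / (2 * r)) ^ ((n : ℝ) / 2) ≤ 4 ^ ((n : ℝ) / 2) := by
        refine Real.rpow_le_rpow (by positivity) ?_ (by positivity)
        rw [div_le_iff₀ (by positivity)]; linarith [hr.1]
      have h3 : dotC n / r ≤ dotC n / (t / 2) := by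
        have := dotC_pos n
        gcongr; exact hr.1.le
      have := dotC_pos n
      refine mul_le_mul h3 (h1.trans (by gcongr)) (gaussKernel_nonneg n (by positivity) y)
        (by positivity)
    · have := dotC_pos n
      have hg := gaussKernel_nonneg n (t := 4 * t) (by positivity) y
      positivity
  · exact (((integrable_gaussKernel n (by positivity)).const_mul _).const_mul _).mul_const _
  · filter_upwards with y r hr
    exact (hasDerivAt_gaussKernel n (by linarith [hr.1]) y).smul_const (F y)

/-- The mass of g_t is constantly one. This cancellation allows τ_y f to be replaced by τ_y f - f in
A S_t f. -/
theorem integral_gaussDot (n : ℕ) {t : ℝ} (ht : 0 < t) : ∫ y, gaussDot n t y = 0 := by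
  have h := hasDerivAt_integral_gaussKernel n (F := fun _ => (1 : ℝ)) continuous_const (M := 1)
    (by simp) ht
  simp only [smul_eq_mul, mul_one] at h
  have h2 : HasDerivAt (fun r => ∫ y, gaussKernel n r y) 0 t := by
    refine (hasDerivAt_const t (1 : ℝ)).congr_of_eventuallyEq ?_
    filter_upwards [lt_mem_nhds ht] with r hr
    exact integral_gaussKernel n hr
  exact h.unique h2

/-! ### The heat semigroup and its generator -/

section Semigroup

variable {n : ℕ} {q : ℝ≥0∞} [Fact (1 ≤ q)] [Fact (q ≠ ⊤)]

theorem opNorm_convLp_le {k : Space n → ℝ} (hk : Integrable k volume) :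
    ‖convLp q k‖ ≤ ∫ y, ‖k y‖ :=
  ContinuousLinearMap.opNorm_le_bound _ (integral_nonneg fun _ => norm_nonneg _)
    fun f => norm_convLp_le hk f

theorem transl_transl {n : ℕ} {q : ℝ≥0∞} [Fact (1 ≤ q)] (y z : Space n) (f : LSp n q) :
    transl q y (transl q z f) = transl q (y + z) f := by
  apply Lp.ext
  have h3 := (measurePreserving_sub_right volume y).quasiMeasurePreserving.ae_eq_comp
    (coeFn_transl z f)
  filter_upwards [coeFn_transl y (transl q z f), coeFn_transl (y + z) f, h3] with ξ e1 e2 e3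
  simp only [Function.comp_apply] at e3
  rw [e1, e2, e3, sub_sub]

/-- Fubini and the substitution w = y + z: translates compose additively, so the kernels convolve.
-/
theorem convLp_convLp {k l : Space n → ℝ} (hk : Integrable k volume) (hl : Integrable l volume)
    (f : LSp n q) :
    convLp q k (convLp q l f) = ∫ w, (∫ y, k y * l (w - y)) • transl q w f := by
  have h1 : ∀ y, k y • transl q y (convLp q l f) =
      ∫ w, (k y * l (w - y)) • transl q w f := by
    intro y
    rw [convLp_apply hl, ← ContinuousLinearMap.integral_comp_comm _ (integrable_smul_transl hl f),
      ← integral_smul]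
    rw [← integral_sub_right_eq_self (fun z => k y • (transl q y) (l z • (transl q z) f)) y]
    congr 1 with w
    rw [map_smul, transl_transl, smul_smul, add_sub_cancel]
  have h2 : Integrable (fun z : Space n × Space n => (k z.2 * l (z.1 - z.2)) • transl q z.1 f)
      (volume.prod volume) := by
    have h3 := Integrable.convolution_integrand (ContinuousLinearMap.mul ℝ ℝ) hk hl
    refine (h3.norm.mul_const ‖f‖).mono' (h3.aestronglyMeasurable.smul
      ((continuous_transl f).comp continuous_fst).aestronglyMeasurable) ?_
    filter_upwards with z
    rw [norm_smul, norm_transl]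
    rfl
  rw [convLp_apply hk]
  simp only [h1]
  rw [integral_integral_swap (f := fun y w => (k y * l (w - y)) • transl q w f) h2.swap]
  simp only [integral_smul_const]

theorem heatS_of_pos {t : ℝ} (ht : 0 < t) : heatS n q t = convLp q (gaussKernel n t) := by
  simp [heatS, ht]

theorem heatS_apply {t : ℝ} (ht : 0 < t) (f : LSp n q) :
    heatS n q t f = ∫ y, gaussKernel n t y • transl q y f := by
  rw [heatS_of_pos ht, convLp_apply (integrable_gaussKernel n ht)]

theorem heatS_zero : heatS n q 0 = ContinuousLinearMap.id ℝ _ := by simp [heatS]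

theorem heatS_heatS {a b : ℝ} (ha : 0 ≤ a) (hb : 0 ≤ b) (f : LSp n q) :
    heatS n q a (heatS n q b f) = heatS n q (a + b) f := by
  rcases ha.eq_or_lt with rfl | ha
  · simp [heatS_zero]
  rcases hb.eq_or_lt with rfl | hb
  · simp [heatS_zero]
  rw [heatS_of_pos ha, heatS_of_pos hb, heatS_apply (by positivity),
    convLp_convLp (integrable_gaussKernel n ha) (integrable_gaussKernel n hb)]
  simp only [integral_gaussKernel_conv n ha hb]

theorem opNorm_heatS_le (t : ℝ) : ‖heatS n q t‖ ≤ 1 :=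
  ContinuousLinearMap.opNorm_le_bound _ zero_le_one fun f => by
    rw [one_mul]; exact norm_heatS_le t f

variable (n q) in
/-- The operator `A S_t` on `L^q`, for `t > 0`. -/
def heatG (t : ℝ) : LSp n q →L[ℝ] LSp n q := convLp q (gaussDot n t)

theorem heatG_apply {t : ℝ} (ht : 0 < t) (f : LSp n q) :
    heatG n q t f = ∫ y, gaussDot n t y • transl q y f :=
  convLp_apply (integrable_gaussDot n ht) f

theorem opNorm_heatG_le {t : ℝ} (ht : 0 < t) : ‖heatG n q t‖ ≤ dotC n / t :=
  (opNorm_convLp_le (integrable_gaussDot n ht)).trans (integral_abs_gaussDot_le n ht)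

theorem norm_heatG_le {t : ℝ} (ht : 0 < t) (f : LSp n q) :
    ‖heatG n q t f‖ ≤ dotC n / t * ‖f‖ :=
  (heatG n q t).le_of_opNorm_le (opNorm_heatG_le ht) f

theorem hasDerivAt_heatS {t : ℝ} (ht : 0 < t) (f : LSp n q) :
    HasDerivAt (fun r => heatS n q r f) (heatG n q t f) t := by
  rw [heatG_apply ht]
  refine (hasDerivAt_integral_gaussKernel n (continuous_transl f) (M := ‖f‖)
    (fun y => (norm_transl y f).le) ht).congr_of_eventuallyEq ?_
  filter_upwards [lt_mem_nhds ht] with r hr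
  exact heatS_apply hr f

/-- The semigroup law differentiated in its second time; the convolution of g_a with the derivative
kernel never has to be computed. -/
theorem heatS_heatG {a b : ℝ} (ha : 0 ≤ a) (hb : 0 < b) (f : LSp n q) :
    heatS n q a (heatG n q b f) = heatG n q (a + b) f := by
  have h1 := (heatS n q a).hasFDerivAt.comp_hasDerivAt b (hasDerivAt_heatS hb f)
  have h2 : HasDerivAt (fun r => heatS n q (a + r) f) (heatG n q (a + b) f) b := by
    simpa using (hasDerivAt_heatS (t := a + b) (by positivity) f).comp_const_add a b
  refine h1.unique (h2.congr_of_eventuallyEq ?_)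
  filter_upwards [lt_mem_nhds hb] with r hr
  exact heatS_heatS ha hr.le f

theorem heatG_heatS {a b : ℝ} (ha : 0 < a) (hb : 0 ≤ b) (f : LSp n q) :
    heatG n q a (heatS n q b f) = heatG n q (a + b) f := by
  rw [heatG, ← heatS_convLp, ← heatG, heatS_heatG hb ha, add_comm]

theorem heatS_sub_self {t : ℝ} (ht : 0 < t) (f : LSp n q) :
    heatS n q t f - f = ∫ y, gaussKernel n t y • (transl q y f - f) := by
  have hi := integrable_gaussKernel n ht
  simp only [smul_sub]
  rw [integral_sub (integrable_smul_transl hi f) (hi.smul_const f), integral_smul_const,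
    integral_gaussKernel n ht, one_smul, heatS_apply ht]

theorem heatG_eq_integral_sub {t : ℝ} (ht : 0 < t) (f : LSp n q) :
    heatG n q t f = ∫ y, gaussDot n t y • (transl q y f - f) := by
  have hi := integrable_gaussDot n ht
  simp only [smul_sub]
  rw [integral_sub (integrable_smul_transl hi f) (hi.smul_const f), integral_smul_const,
    integral_gaussDot n ht, zero_smul, sub_zero, heatG_apply ht]

/-! ### Moduli of continuity in L^q and the small-time behaviour of the semigroup. -/

/-- The `L^q` modulus of continuity of `f` is at most `M |y|^{2b}`. -/
def NikBound (b M : ℝ) (f : LSp n q) : Prop :=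
  ∀ y : Space n, ‖transl q y f - f‖ ≤ M * ‖y‖ ^ (2 * b)

/-- Mass one writes S_t f - f as the g_t-average of τ_y f - f, and the moment of order 2b of g_t is
O(t^b). -/
theorem NikBound.norm_heatS_sub_le {b M : ℝ} {f : LSp n q} (h : NikBound b M f) (hb0 : 0 ≤ b)
    (hb : b ≤ 1) (hM : 0 ≤ M) {t : ℝ} (ht : 0 < t) :
    ‖heatS n q t f - f‖ ≤ dotC n * M * t ^ b := by
  rw [heatS_sub_self ht]
  refine (norm_integral_le_of_norm_le
    ((integrable_gaussKernel_mul_rpow n ht hb0 hb).const_mul M) ?_).trans ?_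
  · filter_upwards with y
    rw [norm_smul, Real.norm_of_nonneg (gaussKernel_nonneg n ht y)]
    calc _ ≤ gaussKernel n t y * (M * ‖y‖ ^ (2 * b)) :=
          mul_le_mul_of_nonneg_left (h y) (gaussKernel_nonneg n ht y)
      _ = _ := by ring
  · rw [integral_const_mul]
    calc _ ≤ M * (dotC n * t ^ b) :=
          mul_le_mul_of_nonneg_left (integral_gaussKernel_mul_rpow_le n ht hb0 hb) hM
      _ = _ := by ring

/-- Same averaging, with the mean-zero kernel of A S_t: the modulus of f recovers t^b out of the
singularity 1/t. -/
theorem NikBound.norm_heatG_le {b M : ℝ} {f : LSp n q} (h : NikBound b M f) (hb0 : 0 ≤ b)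
    (hb : b ≤ 1) (hM : 0 ≤ M) {t : ℝ} (ht : 0 < t) :
    ‖heatG n q t f‖ ≤ 2 * dotC n ^ 2 * M * t ^ (b - 1) := by
  rw [heatG_eq_integral_sub ht]
  refine (norm_integral_le_of_norm_le
    ((integrable_gaussDot_mul_rpow n ht hb0 hb).const_mul M) ?_).trans ?_
  · filter_upwards with y
    rw [norm_smul]
    calc _ ≤ ‖gaussDot n t y‖ * (M * ‖y‖ ^ (2 * b)) :=
          mul_le_mul_of_nonneg_left (h y) (norm_nonneg _)
      _ = _ := by ring
  · rw [integral_const_mul]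
    calc _ ≤ M * (2 * dotC n ^ 2 * t ^ (b - 1)) :=
          mul_le_mul_of_nonneg_left (integral_gaussDot_mul_rpow_le n ht hb0 hb) hM
      _ = _ := by ring

theorem transl_zero {n : ℕ} {q : ℝ≥0∞} [Fact (1 ≤ q)] (f : LSp n q) : transl q 0 f = f := by
  apply Lp.ext
  filter_upwards [coeFn_transl 0 f] with ξ h
  rw [h, sub_zero]

theorem tendsto_heatS (f : LSp n q) :
    Tendsto (fun r => heatS n q r f) (𝓝[>] 0) (𝓝 f) := by
  rw [Metric.tendsto_nhds]
  intro ε hε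
  have hc := (continuous_transl f).tendsto 0
  rw [transl_zero, Metric.tendsto_nhds] at hc
  obtain ⟨δ, hδ, hd⟩ := Metric.eventually_nhds_iff.1 (hc (ε / 2) (by positivity))
  -- A general f has no power modulus. Uniform smallness near the origin plus a quadratic majorant
  -- away from it is enough, since the second moment of g_r is O(r).
  have hb : ∀ y : Space n, ‖transl q y f - f‖ ≤
      ε / 2 + 2 * ‖f‖ / δ ^ 2 * ‖y‖ ^ (2 * (1 : ℝ)) := by
    intro y
    rw [mul_one, Real.rpow_ofNat]
    by_cases hy : ‖y‖ < δ
    · have := hd (y := y) (by simpa using hy)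
      rw [dist_eq_norm] at this
      have h0 : 0 ≤ 2 * ‖f‖ / δ ^ 2 * ‖y‖ ^ 2 := by positivity
      linarith
    · have h1 : ‖transl q y f - f‖ ≤ 2 * ‖f‖ := by
        refine (norm_sub_le _ _).trans ?_
        rw [norm_transl]; linarith
      have h2 : 2 * ‖f‖ ≤ 2 * ‖f‖ / δ ^ 2 * ‖y‖ ^ 2 := by
        rw [div_mul_eq_mul_div, le_div_iff₀ (by positivity)]
        have : δ ^ 2 ≤ ‖y‖ ^ 2 := by gcongr; linarith
        nlinarith [norm_nonneg f]
      linarith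
  have hlim : Tendsto (fun r : ℝ => ε / 2 + 2 * ‖f‖ / δ ^ 2 * (dotC n * r)) (𝓝[>] 0)
      (𝓝 (ε / 2)) := by
    have : Tendsto (fun r : ℝ => ε / 2 + 2 * ‖f‖ / δ ^ 2 * (dotC n * r)) (𝓝 0)
        (𝓝 (ε / 2 + 2 * ‖f‖ / δ ^ 2 * (dotC n * 0))) := by
      apply Continuous.tendsto; fun_prop
    simp only [mul_zero, add_zero] at this
    exact this.mono_left nhdsWithin_le_nhds
  filter_upwards [hlim.eventually (gt_mem_nhds (by linarith : ε / 2 < ε)),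
    self_mem_nhdsWithin] with r hr hr0
  have hr0 : 0 < r := hr0
  rw [dist_eq_norm, heatS_sub_self hr0]
  refine (norm_integral_le_of_norm_le (((integrable_gaussKernel n hr0).mul_const (ε / 2)).add
    ((integrable_gaussKernel_mul_rpow n hr0 zero_le_one le_rfl).const_mul
      (2 * ‖f‖ / δ ^ 2))) ?_).trans_lt (lt_of_le_of_lt ?_ hr)
  · filter_upwards with y
    rw [norm_smul, Real.norm_of_nonneg (gaussKernel_nonneg n hr0 y)]
    calc _ ≤ gaussKernel n r y * (ε / 2 + 2 * ‖f‖ / δ ^ 2 * ‖y‖ ^ (2 * (1 : ℝ))) :=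
          mul_le_mul_of_nonneg_left (hb y) (gaussKernel_nonneg n hr0 y)
      _ = _ := by simp only [Pi.add_apply]; ring
  · simp only [Pi.add_apply]
    rw [integral_add ((integrable_gaussKernel n hr0).mul_const (ε / 2))
      ((integrable_gaussKernel_mul_rpow n hr0 zero_le_one le_rfl).const_mul _),
      integral_mul_const, integral_const_mul, integral_gaussKernel n hr0, one_mul]
    have := integral_gaussKernel_mul_rpow_le n hr0 zero_le_one le_rfl
    rw [Real.rpow_one] at this
    gcongr

/-- The translation is moved onto the kernel, whose L¹ increments are of order |y|/√t. -/
theorem norm_transl_heatS_sub_le {t : ℝ} (ht : 0 < t) (y : Space n) (f : LSp n q) :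
    ‖transl q y (heatS n q t f) - heatS n q t f‖ ≤ shiftC n * (‖y‖ / √t) * ‖f‖ := by
  have hi := integrable_gaussKernel n ht
  have hi' : Integrable (fun ξ => gaussKernel n t (ξ - y)) volume := hi.comp_sub_right y
  have hs : Integrable (fun ξ => gaussKernel n t (ξ - y) - gaussKernel n t ξ) volume := hi'.sub hi
  have h1 : transl q y (heatS n q t f) - heatS n q t f =
      convLp q (fun ξ => gaussKernel n t (ξ - y) - gaussKernel n t ξ) f := by
    rw [convLp_apply hs, heatS_apply ht,
      ← ContinuousLinearMap.integral_comp_comm _ (integrable_smul_transl hi f)]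
    simp only [sub_smul]
    rw [integral_sub (integrable_smul_transl hi' f) (integrable_smul_transl hi f)]
    congr 1
    rw [← integral_sub_right_eq_self (fun z => (transl q y) (gaussKernel n t z • (transl q z) f)) y]
    congr 1 with w
    rw [map_smul, transl_transl, add_sub_cancel]
  rw [h1]
  exact (norm_convLp_le hs f).trans
    (mul_le_mul_of_nonneg_right (integral_abs_gaussKernel_sub_le n ht y) (norm_nonneg f))

end Semigroup

/-! ### Pointwise formulas -/

theorem integrableOn_Lp {n : ℕ} {q : ℝ≥0∞} [Fact (1 ≤ q)] (f : LSp n q) {E : Set (Space n)}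
    (hE : volume E < ⊤) : IntegrableOn f E volume :=
  integrableOn_Lp_of_measure_ne_top f Fact.out hE.ne

/-- Hölder's inequality on a set of finite measure. It makes integration over such a set a
continuous functional on L^q, which can be passed through Bochner integrals. -/
theorem exists_setIntegral_norm_le {n : ℕ} (q : ℝ≥0∞) [Fact (1 ≤ q)] {E : Set (Space n)}
    (hE : volume E < ⊤) : ∃ C : ℝ, ∀ f : LSp n q, ∫ ξ in E, ‖f ξ‖ ≤ C * ‖f‖ := by
  refine ⟨(volume E ^ (1 / (1 : ℝ≥0∞).toReal - 1 / q.toReal)).toReal, fun f => ?_⟩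
  have h1 := eLpNorm_le_eLpNorm_mul_rpow_measure_univ (μ := volume.restrict E)
    (Fact.out : 1 ≤ q) (Lp.aestronglyMeasurable f).restrict
  rw [Measure.restrict_apply_univ] at h1
  have h2 : eLpNorm f q (volume.restrict E) ≤ eLpNorm f q volume := eLpNorm_restrict_le _ _ _ _
  have h3 : volume E ^ (1 / (1 : ℝ≥0∞).toReal - 1 / q.toReal) ≠ ⊤ := by
    refine ENNReal.rpow_ne_top_of_nonneg ?_ hE.ne
    rw [ENNReal.toReal_one, div_one, sub_nonneg]
    rcases eq_or_ne q ⊤ with rfl | hq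
    · simp
    · have : 1 ≤ q.toReal := by
        rw [← ENNReal.toReal_one]; exact ENNReal.toReal_mono hq Fact.out
      rw [div_le_one (by linarith)]; exact this
  rw [integral_norm_eq_lintegral_enorm (Lp.aestronglyMeasurable f).restrict,
    ← eLpNorm_one_eq_lintegral_enorm, Lp.norm_def, mul_comm, ← ENNReal.toReal_mul]
  exact ENNReal.toReal_mono (ENNReal.mul_ne_top (Lp.eLpNorm_ne_top f) h3)
    (h1.trans (by gcongr))

/-- Integration over a set of finite measure, as a functional on `L^q`. -/
theorem exists_setIntegralCLM {n : ℕ} (q : ℝ≥0∞) [Fact (1 ≤ q)] {E : Set (Space n)}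
    (hE : volume E < ⊤) : ∃ L : LSp n q →L[ℝ] ℝ, ∀ f, L f = ∫ ξ in E, f ξ := by
  obtain ⟨C, hC⟩ := exists_setIntegral_norm_le (n := n) q hE
  refine ⟨LinearMap.mkContinuous
    { toFun := fun f => ∫ ξ in E, f ξ
      map_add' := fun f g => by
        rw [← integral_add (integrableOn_Lp f hE) (integrableOn_Lp g hE)]
        exact integral_congr_ae (ae_restrict_of_ae (Lp.coeFn_add f g))
      map_smul' := fun c f => by
        rw [RingHom.id_apply, ← integral_smul]
        exact integral_congr_ae (ae_restrict_of_ae (Lp.coeFn_smul c f)) } C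
    (fun f => (norm_integral_le_integral_norm _).trans (hC f)), fun f => rfl⟩

/-- A Bochner integral in `L^q` is given by the pointwise integral. -/
theorem coeFn_integral {n : ℕ} {q : ℝ≥0∞} [Fact (1 ≤ q)] {Y : Type*} [MeasurableSpace Y]
    {ν : Measure Y} [SFinite ν] {F : Y → LSp n q} (hF : Integrable F ν) {K : Y → Space n → ℝ}
    (hK : AEStronglyMeasurable (Function.uncurry K) (ν.prod volume))
    (hFK : ∀ᵐ y ∂ν, F y =ᵐ[volume] K y) :
    ((∫ y, F y ∂ν : LSp n q) : Space n → ℝ) =ᵐ[volume] fun ξ => ∫ y, K y ξ ∂ν := by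
  -- On a set of finite measure the L^q norm controls the L¹ norm, so Bochner integrability of F
  -- gives joint integrability of K there, as Fubini requires.
  have key : ∀ E : Set (Space n), volume E < ⊤ →
      Integrable (Function.uncurry K) (ν.prod (volume.restrict E)) := by
    intro E hE
    have hK' : AEStronglyMeasurable (Function.uncurry K) (ν.prod (volume.restrict E)) :=
      hK.mono_ac (Measure.AbsolutelyContinuous.rfl.prod
        Measure.restrict_le_self.absolutelyContinuous)
    rw [integrable_prod_iff hK']
    constructor
    · filter_upwards [hFK] with y hy
      exact (integrableOn_Lp (F y) hE).congr (ae_restrict_of_ae hy)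
    · obtain ⟨C, hC⟩ := exists_setIntegral_norm_le (n := n) q hE
      refine (hF.norm.const_mul C).mono' hK'.norm.integral_prod_right' ?_
      filter_upwards [hFK] with y hy
      rw [Real.norm_of_nonneg (integral_nonneg fun _ => norm_nonneg _)]
      refine le_trans (le_of_eq ?_) (hC (F y))
      refine integral_congr_ae (ae_restrict_of_ae ?_)
      filter_upwards [hy] with ξ hξ
      rw [hξ]; rfl
  -- Two locally integrable functions agree almost everywhere once their integrals over all sets of
  -- finite measure agree.
  refine ae_eq_of_forall_setIntegral_eq_of_sigmaFinite (fun E _ hE => integrableOn_Lp _ hE)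
    (fun E _ hE => (key E hE).integral_prod_right) fun E _ hE => ?_
  obtain ⟨L, hL⟩ := exists_setIntegralCLM (n := n) q hE
  rw [← hL, ← L.integral_comp_comm hF, ← integral_integral_swap (key E hE)]
  refine integral_congr_ae ?_
  filter_upwards [hFK] with y hy
  rw [hL]
  exact integral_congr_ae (ae_restrict_of_ae hy)

section Pointwise

variable {n : ℕ} {q : ℝ≥0∞} [Fact (1 ≤ q)] [Fact (q ≠ ⊤)]

theorem ae_comp_sub_left {f g : Space n → ℝ} (h : f =ᵐ[volume] g) (ξ : Space n) :
    (fun y => f (ξ - y)) =ᵐ[volume] fun y => g (ξ - y) :=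
  (Measure.measurePreserving_sub_left volume ξ).quasiMeasurePreserving.ae_eq_comp h

theorem coeFn_convLp {k : Space n → ℝ} (hk : Integrable k volume) {f : LSp n q}
    {φ : Space n → ℝ} (hφ : f =ᵐ[volume] φ) :
    convLp q k f =ᵐ[volume] fun ξ => ∫ y, k y * φ (ξ - y) := by
  rw [convLp_apply hk]
  have h := coeFn_integral (K := fun y ξ => k y * f (ξ - y)) (integrable_smul_transl hk f) ?_ ?_
  · filter_upwards [h] with ξ hξ
    rw [hξ]
    refine integral_congr_ae ?_
    filter_upwards [ae_comp_sub_left hφ ξ] with y hy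
    rw [hy]
  · refine hk.aestronglyMeasurable.comp_fst.mul ?_
    exact ((Lp.stronglyMeasurable f).comp_measurable
      (measurable_snd.sub measurable_fst)).aestronglyMeasurable
  · filter_upwards with y
    filter_upwards [Lp.coeFn_smul (k y) (transl q y f), coeFn_transl y f] with ξ h1 h2
    rw [h1, Pi.smul_apply, h2, smul_eq_mul]

/-- The pointwise formula for a convolution does not mention the exponent, so the operators on
different L^q spaces are versions of one another. -/
theorem convLp_congr {q' : ℝ≥0∞} [Fact (1 ≤ q')] [Fact (q' ≠ ⊤)] {k : Space n → ℝ}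
    {f : LSp n q} {f' : LSp n q'} (h : f =ᵐ[volume] f') :
    convLp q k f =ᵐ[volume] convLp q' k f' := by
  by_cases hk : Integrable k volume
  · exact (coeFn_convLp hk h).trans (coeFn_convLp hk (ae_eq_refl _)).symm
  · rw [convLp, convLp, dif_neg hk, dif_neg hk]
    exact (Lp.coeFn_zero _ _ _).trans (Lp.coeFn_zero _ _ _).symm

theorem heatS_congr {q' : ℝ≥0∞} [Fact (1 ≤ q')] [Fact (q' ≠ ⊤)] {t : ℝ}
    {f : LSp n q} {f' : LSp n q'} (h : f =ᵐ[volume] f') :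
    heatS n q t f =ᵐ[volume] heatS n q' t f' := by
  by_cases ht : 0 < t
  · rw [heatS_of_pos ht, heatS_of_pos ht]; exact convLp_congr h
  · rw [heatS, heatS, if_neg ht, if_neg ht]; exact h

theorem gaussKernel_le (n : ℕ) {t : ℝ} (ht : 0 < t) (ξ : Space n) :
    gaussKernel n t ξ ≤ t ^ (-(n : ℝ) / 2) := by
  rw [gaussKernel, Real.mul_rpow (by positivity) ht.le]
  have h1 : (2 * Real.pi) ^ (-(n : ℝ) / 2) ≤ 1 := by
    refine Real.rpow_le_one_of_one_le_of_nonpos (by linarith [Real.pi_gt_three]) ?_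
    have : (0 : ℝ) ≤ n := Nat.cast_nonneg n
    linarith
  have h2 : Real.exp (-‖ξ‖ ^ 2 / (2 * t)) ≤ 1 := by
    rw [Real.exp_le_one_iff, neg_div]
    exact neg_nonpos.2 (by positivity)
  have h0 : 0 ≤ t ^ (-(n : ℝ) / 2) := by positivity
  calc _ ≤ 1 * t ^ (-(n : ℝ) / 2) * 1 := by gcongr
    _ = _ := by ring

/-- Against the probability measure g_t(y) dy, the L¹ norm is at most the L^q norm, and the density
is at most t^{-n/2}; the q-th root gives the exponent -n/(2q). The bound holds at every ξ. -/
theorem abs_integral_gaussKernel_mul_le {t : ℝ} (ht : 0 < t) (f : LSp n q) (ξ : Space n) :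
    |∫ y, gaussKernel n t y * f (ξ - y)| ≤ t ^ (-(n : ℝ) / (2 * q.toReal)) * ‖f‖ := by
  have hq0 : q ≠ 0 := (zero_lt_one.trans_le (Fact.out : 1 ≤ q)).ne'
  have hqt : q ≠ ⊤ := Fact.out
  have hm : Measurable fun y => ENNReal.ofReal (gaussKernel n t y) :=
    (continuous_gaussKernel n t).measurable.ennreal_ofReal
  set ν : Measure (Space n) := volume.withDensity fun y => ENNReal.ofReal (gaussKernel n t y)
    with hν
  set F : Space n → ℝ := fun y => f (ξ - y) with hF
  have hprob : IsProbabilityMeasure ν := by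
    constructor
    rw [hν, withDensity_apply _ MeasurableSet.univ, setLIntegral_univ,
      ← ofReal_integral_eq_lintegral_ofReal (integrable_gaussKernel n ht)
        (ae_of_all _ fun y => gaussKernel_nonneg n ht y), integral_gaussKernel n ht,
      ENNReal.ofReal_one]
  have hFm : StronglyMeasurable F :=
    (Lp.stronglyMeasurable f).comp_measurable (measurable_const.sub measurable_id)
  have hle : ν ≤ ENNReal.ofReal (t ^ (-(n : ℝ) / 2)) • volume := by
    rw [hν, ← withDensity_const]
    exact withDensity_mono (ae_of_all _ fun y => ENNReal.ofReal_le_ofReal (gaussKernel_le n ht y))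
  have hFq : eLpNorm F q volume = eLpNorm f q volume :=
    eLpNorm_comp_measurePreserving (Lp.aestronglyMeasurable f)
      (Measure.measurePreserving_sub_left volume ξ)
  have h1 : ∫ y, gaussKernel n t y * f (ξ - y) = ∫ y, F y ∂ν := by
    rw [hν, integral_withDensity_eq_integral_toReal_smul hm
      (ae_of_all _ fun _ => ENNReal.ofReal_lt_top)]
    refine integral_congr_ae (ae_of_all _ fun y => ?_)
    simp only [ENNReal.toReal_ofReal (gaussKernel_nonneg n ht y), smul_eq_mul, hF]
  have h2 : ‖∫ y, F y ∂ν‖ₑ ≤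
      ENNReal.ofReal (t ^ (-(n : ℝ) / 2)) ^ (1 / q).toReal * eLpNorm f q volume := by
    calc ‖∫ y, F y ∂ν‖ₑ ≤ ∫⁻ y, ‖F y‖ₑ ∂ν := enorm_integral_le_lintegral_enorm _
      _ = eLpNorm F 1 ν := eLpNorm_one_eq_lintegral_enorm.symm
      _ ≤ eLpNorm F q ν :=
        eLpNorm_le_eLpNorm_of_exponent_le Fact.out hFm.aestronglyMeasurable
      _ ≤ eLpNorm F q (ENNReal.ofReal (t ^ (-(n : ℝ) / 2)) • volume) := eLpNorm_mono_measure _ hle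
      _ = _ := by rw [eLpNorm_smul_measure_of_ne_top hqt, hFq, smul_eq_mul]
  have h3 := ENNReal.toReal_mono (ENNReal.mul_ne_top
    (ENNReal.rpow_ne_top_of_nonneg ENNReal.toReal_nonneg ENNReal.ofReal_ne_top)
    (Lp.eLpNorm_ne_top f)) h2
  rw [toReal_enorm, ENNReal.toReal_mul, ← ENNReal.toReal_rpow,
    ENNReal.toReal_ofReal (by positivity), ← Lp.norm_def, ← Real.rpow_mul ht.le] at h3
  rw [h1, ← Real.norm_eq_abs]
  refine h3.trans (le_of_eq ?_)
  rw [one_div, ENNReal.toReal_inv]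
  congr 2
  rw [div_mul_eq_mul_div, div_eq_div_iff (by norm_num)
    (mul_ne_zero two_ne_zero (ENNReal.toReal_ne_zero.2 ⟨hq0, hqt⟩))]
  have := ENNReal.toReal_ne_zero.2 ⟨hq0, hqt⟩
  field_simp

theorem ae_abs_heatS_le {t : ℝ} (ht : 0 < t) (f : LSp n q) :
    ∀ᵐ ξ, |heatS n q t f ξ| ≤ t ^ (-(n : ℝ) / (2 * q.toReal)) * ‖f‖ := by
  rw [heatS_of_pos ht]
  filter_upwards [coeFn_convLp (integrable_gaussKernel n ht) (ae_eq_refl f)] with ξ hξ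
  rw [hξ]
  exact abs_integral_gaussKernel_mul_le ht f ξ

end Pointwise

/-! ### The heat semigroup from `L^{p/2}` to `L^p` -/

instance factHalfNeTop (p : ℕ) : Fact ((p : ℝ≥0∞) / 2 ≠ ⊤) :=
  ⟨ENNReal.div_ne_top (ENNReal.natCast_ne_top p) two_ne_zero⟩

/-- Interpolation between the sup norm and L^{p/2}: |f| ≤ M^{1/2} |f|^{1/2}. -/
theorem eLpNorm_le_of_ae_abs_le {n p : ℕ} {f : Space n → ℝ} {M : ℝ}
    (hM : ∀ᵐ ξ, |f ξ| ≤ M) :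
    eLpNorm f p volume ≤
      ENNReal.ofReal (M ^ (1 / 2 : ℝ)) * eLpNorm f ((p : ℝ≥0∞) / 2) volume ^ (1 / 2 : ℝ) := by
  have h1 : eLpNorm f p volume ≤
      ENNReal.ofReal (M ^ (1 / 2 : ℝ)) * eLpNorm (fun ξ => ‖f ξ‖ ^ (1 / 2 : ℝ)) p volume := by
    refine eLpNorm_le_mul_eLpNorm_of_ae_le_mul ?_ _
    filter_upwards [hM] with ξ hξ
    rw [Real.norm_of_nonneg (by positivity : 0 ≤ ‖f ξ‖ ^ (1 / 2 : ℝ))]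
    have h2 : ‖f ξ‖ = ‖f ξ‖ ^ (1 / 2 : ℝ) * ‖f ξ‖ ^ (1 / 2 : ℝ) := by
      rw [← Real.rpow_add_of_nonneg (norm_nonneg _) (by norm_num) (by norm_num)]; norm_num
    calc ‖f ξ‖ = ‖f ξ‖ ^ (1 / 2 : ℝ) * ‖f ξ‖ ^ (1 / 2 : ℝ) := h2
      _ ≤ M ^ (1 / 2 : ℝ) * ‖f ξ‖ ^ (1 / 2 : ℝ) := by
        gcongr; exact hξ
  rw [eLpNorm_norm_rpow f (by norm_num)] at h1
  have h3 : (p : ℝ≥0∞) * ENNReal.ofReal (1 / 2) = (p : ℝ≥0∞) / 2 := by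
    rw [one_div, ENNReal.ofReal_inv_of_pos two_pos, div_eq_mul_inv]
    norm_num
  rwa [h3] at h1

/-- The sup bound t^{-n/p} for data in L^{p/2} is interpolated with the contraction on L^{p/2}. The
square root gives t^{-n/(2p)}, the singularity κ of the family from L^{p/2} to L^p. -/
theorem heatS_half_eLpNorm_le {n p : ℕ} [hp : Fact (2 ≤ p)] {t : ℝ} (ht : 0 < t)
    (f : LSp n ((p : ℝ≥0∞) / 2)) :
    eLpNorm (heatS n ((p : ℝ≥0∞) / 2) t f) p volume ≤
      ENNReal.ofReal (t ^ (-((n : ℝ) / (2 * p))) * ‖f‖) := by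
  have hpr : ((p : ℝ≥0∞) / 2).toReal = (p : ℝ) / 2 := by simp
  have hp0 : (p : ℝ) ≠ 0 := by have := hp.out; positivity
  have h1 := ae_abs_heatS_le ht f
  rw [hpr] at h1
  refine (eLpNorm_le_of_ae_abs_le h1).trans ?_
  have h2 : eLpNorm (heatS n ((p : ℝ≥0∞) / 2) t f) ((p : ℝ≥0∞) / 2) volume ≤
      ENNReal.ofReal ‖f‖ := by
    rw [← Lp.enorm_def, ← ofReal_norm]
    exact ENNReal.ofReal_le_ofReal (norm_heatS_le t f)
  calc _ ≤ ENNReal.ofReal ((t ^ (-(n : ℝ) / (2 * ((p : ℝ) / 2))) * ‖f‖) ^ (1 / 2 : ℝ)) *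
        ENNReal.ofReal ‖f‖ ^ (1 / 2 : ℝ) := by gcongr
    _ = _ := by
      rw [ENNReal.ofReal_rpow_of_nonneg (norm_nonneg _) (by norm_num),
        ← ENNReal.ofReal_mul (by positivity), Real.mul_rpow (by positivity) (norm_nonneg _),
        ← Real.rpow_mul ht.le, mul_assoc, ← Real.rpow_add_of_nonneg (norm_nonneg _) (by norm_num)
          (by norm_num)]
      norm_num
      congr 3
      field_simp

theorem heatS_half_memLp {n p : ℕ} [Fact (2 ≤ p)] {t : ℝ} (ht : 0 < t)
    (f : LSp n ((p : ℝ≥0∞) / 2)) :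
    MemLp (heatS n ((p : ℝ≥0∞) / 2) t f) p volume :=
  ⟨Lp.aestronglyMeasurable _, (heatS_half_eLpNorm_le ht f).trans_lt ENNReal.ofReal_lt_top⟩

/-- The heat semigroup as an operator from `L^{p/2}` to `L^p`, for `t > 0`. -/
def heatH (n p : ℕ) [Fact (2 ≤ p)] (t : ℝ) : LSp n ((p : ℝ≥0∞) / 2) →L[ℝ] LSp n p :=
  open Classical in
  if ht : 0 < t then
    LinearMap.mkContinuous
      { toFun := fun f => (heatS_half_memLp ht f).toLp
        map_add' := fun f g => by
          rw [← MemLp.toLp_add]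
          refine MemLp.toLp_congr _ _ ?_
          rw [map_add]
          exact Lp.coeFn_add _ _
        map_smul' := fun c f => by
          rw [RingHom.id_apply, ← MemLp.toLp_const_smul]
          refine MemLp.toLp_congr _ _ ?_
          rw [map_smul]
          exact Lp.coeFn_smul _ _ } (t ^ (-((n : ℝ) / (2 * p)))) (fun f => by
        change ‖(heatS_half_memLp ht f).toLp‖ ≤ _
        rw [Lp.norm_toLp]
        exact ENNReal.toReal_le_of_le_ofReal (by positivity) (heatS_half_eLpNorm_le ht f))
  else 0

theorem coeFn_heatH {n p : ℕ} [Fact (2 ≤ p)] {t : ℝ} (ht : 0 < t)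
    (f : LSp n ((p : ℝ≥0∞) / 2)) :
    heatH n p t f =ᵐ[volume] heatS n ((p : ℝ≥0∞) / 2) t f := by
  rw [heatH, dif_pos ht]
  exact (heatS_half_memLp ht f).coeFn_toLp

theorem opNorm_heatH_le {n p : ℕ} [Fact (2 ≤ p)] {t : ℝ} (ht : 0 < t) :
    ‖heatH n p t‖ ≤ t ^ (-((n : ℝ) / (2 * p))) := by
  rw [heatH, dif_pos ht]
  exact LinearMap.mkContinuous_norm_le _ (by positivity) _

theorem heatS_comp_heatH {n p : ℕ} [Fact (2 ≤ p)] {a b : ℝ} (ha : 0 ≤ a) (hb : 0 < b) :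
    (heatS n p a).comp (heatH n p b) = heatH n p (a + b) := by
  ext1 f
  apply Lp.ext
  refine (heatS_congr (coeFn_heatH hb f)).trans ?_
  rw [heatS_heatS ha hb.le]
  exact (coeFn_heatH (by positivity) f).symm

theorem heatH_eq_heatS {n p : ℕ} [Fact (2 ≤ p)] {t : ℝ} (ht : 0 < t) {φ : LSp n p}
    {φ' : LSp n ((p : ℝ≥0∞) / 2)} (h : φ =ᵐ[volume] φ') : heatH n p t φ' = heatS n p t φ :=
  Lp.ext ((coeFn_heatH ht φ').trans (heatS_congr h).symm)

/-! ### Integrals with power singularities -/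

theorem intervalIntegrable_of_rpow_bound {V : Type*} [NormedAddCommGroup V] {F : ℝ → V}
    {h θ K : ℝ} (hθ : 0 < θ) (hh : 0 ≤ h)
    (hm : AEStronglyMeasurable F (volume.restrict (Ioc 0 h)))
    (hF : ∀ r, 0 < r → r < h → ‖F r‖ ≤ K * r ^ (θ - 1)) : IntervalIntegrable F volume 0 h := by
  have h1 : IntervalIntegrable (fun r : ℝ => K * r ^ (θ - 1)) volume 0 h :=
    (intervalIntegral.intervalIntegrable_rpow' (by linarith)).const_mul K
  rw [intervalIntegrable_iff_integrableOn_Ioc_of_le hh] at h1 ⊢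
  refine Integrable.mono' h1 hm ?_
  rw [← restrict_Ioo_eq_restrict_Ioc]
  filter_upwards [ae_restrict_mem measurableSet_Ioo] with r hr
  exact hF r hr.1 hr.2

theorem norm_integral_le_of_rpow_bound {V : Type*} [NormedAddCommGroup V] [NormedSpace ℝ V]
    {F : ℝ → V} {h θ K : ℝ} (hθ : 0 < θ) (hh : 0 ≤ h)
    (hF : ∀ r, 0 < r → r < h → ‖F r‖ ≤ K * r ^ (θ - 1)) :
    ‖∫ r in (0 : ℝ)..h, F r‖ ≤ K * (h ^ θ / θ) := by
  have h1 : IntervalIntegrable (fun r : ℝ => K * r ^ (θ - 1)) volume 0 h :=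
    (intervalIntegral.intervalIntegrable_rpow' (by linarith)).const_mul K
  have h2 : ∫ r in (0 : ℝ)..h, K * r ^ (θ - 1) = K * (h ^ θ / θ) := by
    rw [intervalIntegral.integral_const_mul, integral_rpow (Or.inl (by linarith)),
      sub_add_cancel, Real.zero_rpow hθ.ne', sub_zero]
  rw [← h2]
  rw [intervalIntegral.integral_of_le hh, intervalIntegral.integral_of_le hh]
  rw [intervalIntegrable_iff_integrableOn_Ioc_of_le hh] at h1
  refine norm_integral_le_of_norm_le h1 ?_
  rw [← restrict_Ioo_eq_restrict_Ioc]
  filter_upwards [ae_restrict_mem measurableSet_Ioo] with r hr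
  exact hF r hr.1 hr.2

/-- The simplex `0 ≤ s ≤ t ≤ T`, as a set of pairs `(t, s)`. -/
def simplex (T : ℝ) : Set (ℝ × ℝ) := {z | 0 ≤ z.2 ∧ z.2 ≤ z.1 ∧ z.1 ≤ T}

/-- Dominated convergence after extending the integrands by zero to the fixed interval (0,T]. For r
different from t₀ - s₀ the cut-off is locally constant near (t₀,s₀), and the excluded r form a null
set. -/
theorem continuousOn_simplex_integral {V : Type*} [NormedAddCommGroup V] [NormedSpace ℝ V]
    {T : ℝ} {Z : ℝ → ℝ → ℝ → V} {b : ℝ → ℝ} (hb : IntegrableOn b (Ioc 0 T))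
    (hm : ∀ z ∈ simplex T, AEStronglyMeasurable (Z z.1 z.2) (volume.restrict (Ioc 0 (z.1 - z.2))))
    (hZ : ∀ z ∈ simplex T, ∀ r, 0 < r → r < z.1 - z.2 → ‖Z z.1 z.2 r‖ ≤ b r)
    (hc : ∀ r, 0 < r → ContinuousOn (fun z : ℝ × ℝ => Z z.1 z.2 r)
      (simplex T ∩ {z | r < z.1 - z.2})) :
    ContinuousOn (fun z : ℝ × ℝ => ∫ r in (0 : ℝ)..(z.1 - z.2), Z z.1 z.2 r) (simplex T) := by
  have key : ∀ z ∈ simplex T, ∫ r in (0 : ℝ)..(z.1 - z.2), Z z.1 z.2 r =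
      ∫ r in Ioc 0 T, (Ioo 0 (z.1 - z.2)).indicator (Z z.1 z.2) r := by
    rintro z ⟨h1, h2, h3⟩
    rw [intervalIntegral.integral_of_le (by linarith), integral_Ioc_eq_integral_Ioo,
      setIntegral_indicator measurableSet_Ioo]
    congr 2
    ext r
    simp only [mem_Ioo, mem_inter_iff, mem_Ioc]
    constructor
    · rintro ⟨a, b⟩; exact ⟨⟨a, by linarith⟩, a, b⟩
    · rintro ⟨_, a, b⟩; exact ⟨a, b⟩
  refine ContinuousOn.congr ?_ key
  intro z₀ hz₀
  refine continuousWithinAt_of_dominated (bound := fun r => ‖b r‖) ?_ ?_ hb.norm ?_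
  · filter_upwards [self_mem_nhdsWithin] with z hz
    have h : AEStronglyMeasurable ((Ioo 0 (z.1 - z.2)).indicator (Z z.1 z.2)) volume := by
      rw [aestronglyMeasurable_indicator_iff measurableSet_Ioo]
      exact (hm z hz).mono_measure (Measure.restrict_mono Ioo_subset_Ioc_self le_rfl)
    exact h.restrict
  · filter_upwards [self_mem_nhdsWithin] with z hz
    filter_upwards with r
    by_cases hr : r ∈ Ioo 0 (z.1 - z.2)
    · rw [indicator_of_mem hr]
      exact (hZ z hz r hr.1 hr.2).trans (le_abs_self _)
    · rw [indicator_of_notMem hr, norm_zero]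
      exact norm_nonneg _
  · have hne : ∀ᵐ r ∂(volume.restrict (Ioc 0 T)), r ≠ z₀.1 - z₀.2 :=
      ae_restrict_of_ae (Measure.ae_ne volume _)
    filter_upwards [hne, ae_restrict_mem measurableSet_Ioc] with r hr hrT
    have hcd : Continuous fun z : ℝ × ℝ => z.1 - z.2 := by fun_prop
    rcases lt_or_gt_of_ne hr with h | h
    · have hev : ∀ᶠ z in 𝓝 z₀, r < z.1 - z.2 := hcd.continuousAt.eventually (lt_mem_nhds h)
      have h1 := hc r hrT.1 z₀ ⟨hz₀, h⟩
      have h2 : ContinuousWithinAt (fun z : ℝ × ℝ => Z z.1 z.2 r) (simplex T) z₀ := by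
        refine h1.mono_of_mem_nhdsWithin ?_
        exact inter_mem self_mem_nhdsWithin (mem_nhdsWithin_of_mem_nhds hev)
      refine h2.congr_of_eventuallyEq ?_ ?_
      · filter_upwards [mem_nhdsWithin_of_mem_nhds hev] with z hz
        exact indicator_of_mem (show r ∈ Ioo 0 (z.1 - z.2) from ⟨hrT.1, hz⟩) _
      · exact indicator_of_mem (show r ∈ Ioo 0 (z₀.1 - z₀.2) from ⟨hrT.1, h⟩) _
    · have hev : ∀ᶠ z in 𝓝 z₀, z.1 - z.2 < r := hcd.continuousAt.eventually (gt_mem_nhds h)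
      refine (continuousWithinAt_const (b := (0 : V))).congr_of_eventuallyEq ?_ ?_
      · filter_upwards [mem_nhdsWithin_of_mem_nhds hev] with z hz
        exact indicator_of_notMem (fun h' => by linarith [h'.2, show z.1 - z.2 < r from hz]) _
      · exact indicator_of_notMem (fun h' => by linarith [h'.2]) _

/-! ### Families of operators smoothed by the heat semigroup -/

section Family

variable {n : ℕ} {q : ℝ≥0∞} [Fact (1 ≤ q)] [Fact (q ≠ ⊤)]
  {E : Type*} [NormedAddCommGroup E] [NormedSpace ℝ E]

/-- `S` is a version of the heat semigroup, from `E` to `L^q`, with a singularity of order `κ` at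
`0`. -/
structure IsHeatFamily (S : ℝ → E →L[ℝ] LSp n q) (κ C : ℝ) : Prop where
  nonneg : 0 ≤ C
  order_nonneg : 0 ≤ κ
  norm_le : ∀ r, 0 < r → ‖S r‖ ≤ C * r ^ (-κ)
  comp : ∀ a b, 0 ≤ a → 0 < b → (heatS n q a).comp (S b) = S (a + b)

theorem isHeatFamily_heatS : IsHeatFamily (heatS n q) 0 1 where
  nonneg := zero_le_one
  order_nonneg := le_rfl
  norm_le r _ := by simpa using opNorm_heatS_le r
  comp a b ha hb := by ext1 f; exact heatS_heatS ha hb.le f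

theorem isHeatFamily_heatH {n p : ℕ} [Fact (2 ≤ p)] :
    IsHeatFamily (heatH n p) ((n : ℝ) / (2 * p)) 1 where
  nonneg := zero_le_one
  order_nonneg := by positivity
  norm_le r hr := by rw [one_mul]; exact opNorm_heatH_le hr
  comp a b ha hb := heatS_comp_heatH ha hb

/-- The derivative of the family `S`. -/
def gen (S : ℝ → E →L[ℝ] LSp n q) (r : ℝ) : E →L[ℝ] LSp n q :=
  (heatG n q (r / 2)).comp (S (r / 2))

namespace IsHeatFamily

variable {S : ℝ → E →L[ℝ] LSp n q} {κ C : ℝ}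

theorem comp_apply (hS : IsHeatFamily S κ C) {a b : ℝ} (ha : 0 ≤ a) (hb : 0 < b) (f : E) :
    heatS n q a (S b f) = S (a + b) f := by
  rw [← hS.comp a b ha hb]; rfl

/-- `gen` halves the time, but every splitting gives the same operator: by the semigroup law all of
them reduce to S at the common small time min a b. -/
theorem heatG_apply (hS : IsHeatFamily S κ C) {a b : ℝ} (ha : 0 < a) (hb : 0 < b) (f : E) :
    heatG n q a (S b f) = gen S (a + b) f := by
  have key : ∀ a b c : ℝ, 0 < a → 0 < c → c ≤ b →
      heatG n q a (S b f) = heatG n q (a + b - c) (S c f) := by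
    intro a b c ha hc hcb
    have := hS.comp_apply (sub_nonneg.2 hcb) hc f
    rw [sub_add_cancel] at this
    rw [← this, heatG_heatS ha (sub_nonneg.2 hcb), add_sub_assoc]
  have hc : 0 < min a b := lt_min ha hb
  have h1 := min_le_left a b
  have h2 := min_le_right a b
  rw [key a b (min a b) ha hc h2, gen, ContinuousLinearMap.comp_apply,
    key ((a + b) / 2) ((a + b) / 2) (min a b) (by positivity) hc (by linarith), add_halves]

theorem heatS_gen (hS : IsHeatFamily S κ C) {a b : ℝ} (ha : 0 ≤ a) (hb : 0 < b) (f : E) :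
    heatS n q a (gen S b f) = gen S (a + b) f := by
  rw [gen, ContinuousLinearMap.comp_apply, heatS_heatG ha (by positivity),
    hS.heatG_apply (by positivity) (by positivity)]
  congr 2; ring

theorem hasDerivAt (hS : IsHeatFamily S κ C) {r : ℝ} (hr : 0 < r) (f : E) :
    HasDerivAt (fun r => S r f) (gen S r f) r := by
  have h1 := (hasDerivAt_heatS (t := r - r / 2) (by linarith) (S (r / 2) f)).comp_sub_const r (r / 2)
  rw [hS.heatG_apply (by linarith) (by linarith), sub_add_cancel] at h1
  refine h1.congr_of_eventuallyEq ?_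
  filter_upwards [lt_mem_nhds (by linarith : r / 2 < r)] with v hv
  rw [hS.comp_apply (by linarith) (by linarith), sub_add_cancel]

theorem norm_gen_le (hS : IsHeatFamily S κ C) {r : ℝ} (hr : 0 < r) :
    ‖gen S r‖ ≤ 2 * dotC n * C * 2 ^ κ * r ^ (-κ - 1) := by
  have h1 := (heatG n q (r / 2)).opNorm_comp_le (S (r / 2))
  have h2 := opNorm_heatG_le (n := n) (q := q) (t := r / 2) (by positivity)
  have h3 := hS.norm_le (r / 2) (by positivity)
  have hd := dotC_pos n
  have hC := hS.nonneg
  calc _ ≤ _ := h1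
    _ ≤ dotC n / (r / 2) * (C * (r / 2) ^ (-κ)) := mul_le_mul h2 h3 (norm_nonneg _) (by positivity)
    _ = _ := by
      rw [Real.div_rpow hr.le zero_le_two, Real.rpow_neg zero_le_two, Real.rpow_sub hr,
        Real.rpow_one]
      field_simp

/-- Away from time zero the derivative is bounded in operator norm. The mean value inequality,
applied vector by vector with a constant proportional to ‖f‖, then gives a local Lipschitz bound in
operator norm. -/
theorem continuousOn (hS : IsHeatFamily S κ C) : ContinuousOn S (Ioi 0) := by
  intro r hr
  have hr : 0 < r := hr
  set m := r / 2 with hm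
  have hm0 : 0 < m := by positivity
  set K := 2 * dotC n * C * 2 ^ κ * m ^ (-κ - 1) with hK
  have hC := hS.nonneg
  have hd := dotC_pos n
  have hK0 : 0 ≤ K := by positivity
  have hbd : ∀ v ∈ Ici m, ‖gen S v‖ ≤ K := by
    intro v hv
    have hv0 : 0 < v := hm0.trans_le hv
    refine (hS.norm_gen_le hv0).trans ?_
    have : v ^ (-κ - 1) ≤ m ^ (-κ - 1) :=
      Real.rpow_le_rpow_of_nonpos hm0 hv (by linarith [hS.order_nonneg])
    exact mul_le_mul_of_nonneg_left this (by positivity)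
  have hLip : ∀ a ∈ Ici m, ∀ b ∈ Ici m, ‖S b - S a‖ ≤ K * ‖b - a‖ := by
    intro a ha b hb
    refine ContinuousLinearMap.opNorm_le_bound _ (by positivity) fun f => ?_
    have := (convex_Ici m).norm_image_sub_le_of_norm_hasDerivWithin_le
      (f := fun r => S r f) (f' := fun r => gen S r f) (C := K * ‖f‖)
      (fun x hx => (hS.hasDerivAt (hm0.trans_le hx) f).hasDerivWithinAt)
      (fun x hx => (gen S x).le_of_opNorm_le (hbd x hx) f) ha hb
    rw [sub_apply]
    calc _ ≤ _ := this
      _ = _ := by ring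
  refine ContinuousAt.continuousWithinAt ?_
  have hrm : r ∈ Ici m := by simp only [mem_Ici]; linarith
  refine tendsto_iff_norm_sub_tendsto_zero.2 (squeeze_zero' (by filter_upwards with v; positivity)
    (g := fun v => K * ‖v - r‖) ?_ ?_)
  · filter_upwards [lt_mem_nhds (by linarith : m < r)] with v hv
    exact hLip r hrm v (le_of_lt hv)
  · have : Continuous fun v : ℝ => K * ‖v - r‖ := by fun_prop
    simpa using this.tendsto r

theorem continuousOn_gen (hS : IsHeatFamily S κ C) : ContinuousOn (gen S) (Ioi 0) := by
  intro r hr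
  have hr : 0 < r := hr
  refine ContinuousAt.continuousWithinAt ?_
  have h1 : ContinuousAt (fun v => (heatG n q (r / 2)).comp (S (v - r / 2))) r := by
    have h2 : ContinuousAt S (r - r / 2) :=
      hS.continuousOn.continuousAt (Ioi_mem_nhds (by linarith))
    have h3 : ContinuousAt (fun v => S (v - r / 2)) r :=
      ContinuousAt.comp (f := fun v => v - r / 2) h2 (by fun_prop)
    exact continuousAt_const.clm_comp h3
  refine h1.congr ?_
  filter_upwards [lt_mem_nhds (by linarith : r / 2 < r)] with v hv
  ext1 f
  rw [ContinuousLinearMap.comp_apply, hS.heatG_apply (by positivity) (by linarith),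
    add_sub_cancel]

theorem intervalIntegrable_gen (hS : IsHeatFamily S κ C) {a b : ℝ} (ha : 0 < a) (hab : a ≤ b) :
    IntervalIntegrable (gen S) volume a b := by
  refine (hS.continuousOn_gen.mono fun r hr => ?_).intervalIntegrable
  rw [uIcc_of_le hab] at hr
  exact ha.trans_le hr.1

theorem integral_gen (hS : IsHeatFamily S κ C) {a b : ℝ} (ha : 0 < a) (hab : a ≤ b) :
    ∫ r in a..b, gen S r = S b - S a := by
  ext1 f
  have hi := hS.intervalIntegrable_gen ha hab
  rw [ContinuousLinearMap.intervalIntegral_apply hi, sub_apply]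
  refine intervalIntegral.integral_eq_sub_of_hasDerivAt (f := fun r => S r f) (fun r hr => ?_) ?_
  · rw [uIcc_of_le hab] at hr
    exact hS.hasDerivAt (ha.trans_le hr.1) f
  · refine ((hS.continuousOn_gen.mono fun r hr => ?_).clm_apply
      continuousOn_const).intervalIntegrable
    rw [uIcc_of_le hab] at hr
    exact ha.trans_le hr.1

theorem aestronglyMeasurable_gen (hS : IsHeatFamily S κ C) (h : ℝ) :
    AEStronglyMeasurable (gen S) (volume.restrict (Ioc 0 h)) :=
  (hS.continuousOn_gen.mono fun _ hr => hr.1).aestronglyMeasurable measurableSet_Ioc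

end IsHeatFamily

theorem gen_heatS {r : ℝ} (hr : 0 < r) : gen (heatS n q) r = heatG n q r := by
  ext1 f
  rw [gen, ContinuousLinearMap.comp_apply, heatG_heatS (by positivity) (by positivity),
    add_halves]

theorem continuousOn_heatG : ContinuousOn (heatG n q) (Ioi 0) :=
  (isHeatFamily_heatS.continuousOn_gen).congr fun _ hr => (gen_heatS hr).symm

/-! ### Operators driven by a function of two times -/

/-- `y` is a continuous function of two times of size `|t - s|^μ`, with increments of order `γ` in
the first variable. -/
structure IsDriver (T γ μ C : ℝ) (y : ℝ → ℝ → ℝ) : Prop where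
  nonneg : 0 ≤ C
  order_pos : 0 < γ
  order_le : γ ≤ μ
  cont : Continuous fun z : ℝ × ℝ => y z.1 z.2
  bound : ∀ s t, 0 ≤ s → s ≤ t → t ≤ T → |y t s| ≤ C * (t - s) ^ μ
  incr : ∀ s u t, 0 ≤ s → s ≤ u → u ≤ t → t ≤ T →
    |y t s - y u s| ≤ C * (t - u) ^ γ * (t - s) ^ (μ - γ)

theorem IsDriver.self {T γ μ C : ℝ} {y : ℝ → ℝ → ℝ} (hy : IsDriver T γ μ C y) {s : ℝ} (hs : 0 ≤ s)
    (hsT : s ≤ T) : y s s = 0 := by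
  have h := hy.bound s s hs le_rfl hsT
  have hμ : 0 < μ := hy.order_pos.trans_le hy.order_le
  rw [sub_self, Real.zero_rpow hμ.ne', mul_zero] at h
  exact abs_nonpos_iff.1 h

/-- The operator `y_{ts} S_{t-s} - ∫_0^{t-s} (y_{ts} - y_{t-r,s}) A S_r dr`, which after an
integration by parts is `y_{ts} + ∫_s^t A S_{t-u} y_{us} du`. -/
def heatOp (S : ℝ → E →L[ℝ] LSp n q) (y : ℝ → ℝ → ℝ) (t s : ℝ) : E →L[ℝ] LSp n q :=
  y t s • S (t - s) - ∫ r in (0 : ℝ)..(t - s), (y t s - y (t - r) s) • gen S r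

section HeatOp

variable {S : ℝ → E →L[ℝ] LSp n q} {κ CS T γ μ C : ℝ} {y : ℝ → ℝ → ℝ}

/-- The increment of the driver contributes r^γ and the generator r^{-κ-1}; the product is
integrable at zero when κ < γ. -/
theorem norm_smul_gen_le (hS : IsHeatFamily S κ CS) (hy : IsDriver T γ μ C y) {s t r : ℝ}
    (hs : 0 ≤ s) (ht : t ≤ T) (hr : 0 < r) (hrt : r < t - s) :
    ‖(y t s - y (t - r) s) • gen S r‖ ≤
      C * (t - s) ^ (μ - γ) * (2 * dotC n * CS * 2 ^ κ) * r ^ (γ - κ - 1) := by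
  have h1 := hy.incr s (t - r) t hs (by linarith) (by linarith) ht
  have h2 := hS.norm_gen_le hr
  have hC := hy.nonneg
  have hd : 0 ≤ t - s := by linarith
  rw [sub_sub_cancel] at h1
  rw [norm_smul, Real.norm_eq_abs]
  calc _ ≤ _ := mul_le_mul h1 h2 (norm_nonneg _) (by positivity)
    _ = C * (t - s) ^ (μ - γ) * (2 * dotC n * CS * 2 ^ κ) * (r ^ γ * r ^ (-κ - 1)) := by ring
    _ = _ := by rw [← Real.rpow_add hr]; ring_nf

theorem aestronglyMeasurable_smul_gen (hS : IsHeatFamily S κ CS) (hy : IsDriver T γ μ C y)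
    (s t h : ℝ) : AEStronglyMeasurable (fun r => (y t s - y (t - r) s) • gen S r)
      (volume.restrict (Ioc 0 h)) := by
  have : Continuous fun r : ℝ => y (t - r) s :=
    hy.cont.comp (f := fun r : ℝ => (t - r, s)) (by fun_prop)
  exact (continuous_const.sub this).aestronglyMeasurable.smul (hS.aestronglyMeasurable_gen h)

theorem intervalIntegrable_smul_gen (hS : IsHeatFamily S κ CS) (hy : IsDriver T γ μ C y)
    (hκ : κ < γ) {s t : ℝ} (hs : 0 ≤ s) (hst : s ≤ t) (ht : t ≤ T) :
    IntervalIntegrable (fun r => (y t s - y (t - r) s) • gen S r) volume 0 (t - s) :=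
  intervalIntegrable_of_rpow_bound (θ := γ - κ) (by linarith) (by linarith)
    (aestronglyMeasurable_smul_gen hS hy s t _)
    fun _ hr hrt => norm_smul_gen_le hS hy hs ht hr hrt

theorem heatOp_apply (hS : IsHeatFamily S κ CS) (hy : IsDriver T γ μ C y)
    (hκ : κ < γ) {s t : ℝ} (hs : 0 ≤ s) (hst : s ≤ t) (ht : t ≤ T) (f : E) :
    heatOp S y t s f = y t s • S (t - s) f -
      ∫ r in (0 : ℝ)..(t - s), (y t s - y (t - r) s) • gen S r f := by
  rw [heatOp, sub_apply, ContinuousLinearMap.intervalIntegral_apply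
    (intervalIntegrable_smul_gen hS hy hκ hs hst ht)]
  rfl

theorem heatOp_self (hy : IsDriver T γ μ C y) {s : ℝ} (hs : 0 ≤ s) (hsT : s ≤ T) :
    heatOp S y s s = 0 := by
  simp [heatOp, hy.self hs hsT]

theorem norm_heatOp_le (hS : IsHeatFamily S κ CS) (hy : IsDriver T γ μ C y) (hκ : κ < γ) :
    ∃ K, 0 ≤ K ∧ ∀ s t, 0 ≤ s → s ≤ t → t ≤ T → ‖heatOp S y t s‖ ≤ K * (t - s) ^ (μ - κ) := by
  have hC := hy.nonneg
  have hCS := hS.nonneg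
  have hd := dotC_pos n
  have hγκ : 0 < γ - κ := by linarith
  refine ⟨C * CS + C * (2 * dotC n * CS * 2 ^ κ) / (γ - κ), by positivity,
    fun s t hs hst ht => ?_⟩
  rcases hst.eq_or_lt with rfl | hst
  · rw [heatOp_self hy hs ht, norm_zero]; positivity
  have hts : 0 < t - s := by linarith
  have h1 : ‖y t s • S (t - s)‖ ≤ C * CS * (t - s) ^ (μ - κ) := by
    rw [norm_smul, Real.norm_eq_abs]
    calc _ ≤ (C * (t - s) ^ μ) * (CS * (t - s) ^ (-κ)) :=
          mul_le_mul (hy.bound s t hs hst.le ht) (hS.norm_le _ hts) (norm_nonneg _) (by positivity)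
      _ = C * CS * ((t - s) ^ μ * (t - s) ^ (-κ)) := by ring
      _ = _ := by rw [← Real.rpow_add hts]; ring_nf
  have h2 := norm_integral_le_of_rpow_bound (θ := γ - κ) hγκ hts.le
    fun r hr hrt => norm_smul_gen_le hS hy hs ht hr hrt
  refine (norm_sub_le _ _).trans ((add_le_add h1 h2).trans (le_of_eq ?_))
  have : (t - s) ^ (μ - κ) = (t - s) ^ (μ - γ) * (t - s) ^ (γ - κ) := by
    rw [← Real.rpow_add hts]; ring_nf
  rw [this]; ring

theorem continuousOn_heatOp (hS : IsHeatFamily S κ CS) (hy : IsDriver T γ μ C y) (hκ : κ < γ) :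
    ContinuousOn (fun z : ℝ × ℝ => heatOp S y z.1 z.2) (simplex T) := by
  have hC := hy.nonneg
  have hCS := hS.nonneg
  have hd := dotC_pos n
  refine ContinuousOn.sub ?_ ?_
  · intro z₀ hz₀
    obtain ⟨h0, h1, h2⟩ := hz₀
    rcases h1.eq_or_lt with h1 | h1
    -- S is singular at time zero, so continuity on the diagonal comes from the size (t-s)^{μ-κ} of
    -- the whole product.
    · have hμκ : 0 < μ - κ := by linarith [hy.order_le]
      have hz : y z₀.1 z₀.2 • S (z₀.1 - z₀.2) = 0 := by
        rw [← h1, hy.self h0 (h1 ▸ h2), zero_smul]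
      rw [ContinuousWithinAt, hz, tendsto_zero_iff_norm_tendsto_zero]
      refine squeeze_zero' (g := fun z : ℝ × ℝ => C * CS * (z.1 - z.2) ^ (μ - κ))
        (by filter_upwards with v; positivity) ?_ ?_
      · filter_upwards [self_mem_nhdsWithin] with z hz
        obtain ⟨k0, k1, k2⟩ := hz
        rcases k1.eq_or_lt with k1 | k1
        · have : 0 ≤ z.1 - z.2 := by linarith
          rw [← k1, hy.self k0 (k1 ▸ k2), zero_smul, norm_zero, sub_self]
          positivity
        have hts : 0 < z.1 - z.2 := by linarith
        rw [norm_smul, Real.norm_eq_abs]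
        calc _ ≤ (C * (z.1 - z.2) ^ μ) * (CS * (z.1 - z.2) ^ (-κ)) :=
              mul_le_mul (hy.bound _ _ k0 k1.le k2) (hS.norm_le _ hts) (norm_nonneg _)
                (by positivity)
          _ = C * CS * ((z.1 - z.2) ^ μ * (z.1 - z.2) ^ (-κ)) := by ring
          _ = _ := by rw [← Real.rpow_add hts]; ring_nf
      · have hc : Continuous fun z : ℝ × ℝ => C * CS * (z.1 - z.2) ^ (μ - κ) := by
          refine continuous_const.mul (Continuous.rpow_const (by fun_prop) fun _ => Or.inr hμκ.le)
        have := hc.tendsto z₀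
        rw [← h1, sub_self, Real.zero_rpow hμκ.ne', mul_zero] at this
        exact this.mono_left nhdsWithin_le_nhds
    · refine ContinuousAt.continuousWithinAt ?_
      refine hy.cont.continuousAt.smul ?_
      exact ContinuousAt.comp (f := fun z : ℝ × ℝ => z.1 - z.2)
        (hS.continuousOn.continuousAt (Ioi_mem_nhds (by linarith))) (by fun_prop)
  · refine continuousOn_simplex_integral
      (Z := fun t s r => (y t s - y (t - r) s) • gen S r)
      (b := fun r => C * T ^ (μ - γ) * (2 * dotC n * CS * 2 ^ κ) * r ^ (γ - κ - 1)) ?_ ?_ ?_ ?_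
    · rcases le_or_gt T 0 with hT | hT
      · rw [Ioc_eq_empty (by linarith)]; exact integrableOn_empty
      · rw [← intervalIntegrable_iff_integrableOn_Ioc_of_le hT.le]
        exact (intervalIntegral.intervalIntegrable_rpow' (by linarith)).const_mul _
    · intro z hz
      exact aestronglyMeasurable_smul_gen hS hy _ _ _
    · rintro z ⟨h0, h1, h2⟩ r hr hrt
      refine (norm_smul_gen_le hS hy h0 h2 hr hrt).trans ?_
      have h3 : 0 ≤ z.1 - z.2 := by linarith
      have : (z.1 - z.2) ^ (μ - γ) ≤ T ^ (μ - γ) :=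
        Real.rpow_le_rpow h3 (by linarith) (by linarith [hy.order_le])
      gcongr
    · intro r _
      have h1 : Continuous fun z : ℝ × ℝ => y z.1 z.2 - y (z.1 - r) z.2 :=
        hy.cont.sub (hy.cont.comp (f := fun z : ℝ × ℝ => (z.1 - r, z.2)) (by fun_prop))
      exact (h1.smul continuous_const).continuousOn

theorem holderC2_heatOp (hS : IsHeatFamily S κ CS) (hy : IsDriver T γ μ C y) (hκ : κ < γ) :
    HolderC2 T (μ - κ) (heatOp S y) := by
  obtain ⟨K, _, hK⟩ := norm_heatOp_le hS hy hκ
  exact ⟨continuousOn_heatOp hS hy hκ, K, fun s t hs hst ht => hK s t hs hst.le ht⟩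

theorem heatOp_congr {y' : ℝ → ℝ → ℝ} {s t : ℝ} (hst : s ≤ t)
    (h : ∀ v, s ≤ v → v ≤ t → y v s = y' v s) : heatOp S y t s = heatOp S y' t s := by
  rw [heatOp, heatOp, h t hst le_rfl]
  congr 1
  refine intervalIntegral.integral_congr fun r hr => ?_
  rw [uIcc_of_le (by linarith)] at hr
  simp only [h (t - r) (by linarith [hr.2]) (by linarith [hr.1])]

theorem heatOp_add_mul {μ' C' : ℝ} {y' : ℝ → ℝ → ℝ} (hS : IsHeatFamily S κ CS)
    (hy : IsDriver T γ μ C y) (hy' : IsDriver T γ μ' C' y') (hκ : κ < γ) (c : ℝ) {s t : ℝ}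
    (hs : 0 ≤ s) (hst : s ≤ t) (ht : t ≤ T) :
    heatOp S (fun v w => y v w + c * y' v w) t s = heatOp S y t s + c • heatOp S y' t s := by
  have h1 := intervalIntegrable_smul_gen hS hy hκ hs hst ht
  have h2 := intervalIntegrable_smul_gen hS hy' hκ hs hst ht
  have h3 : ∀ r, (y t s + c * y' t s - (y (t - r) s + c * y' (t - r) s)) • gen S r =
      (y t s - y (t - r) s) • gen S r + c • ((y' t s - y' (t - r) s) • gen S r) := by
    intro r; module
  have h4 : ∫ r in (0 : ℝ)..(t - s),
      (y t s - y (t - r) s) • gen S r + c • ((y' t s - y' (t - r) s) • gen S r) = _ :=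
    intervalIntegral.integral_add h1 (h2.smul c)
  have h5 : ∫ r in (0 : ℝ)..(t - s), c • ((y' t s - y' (t - r) s) • gen S r) = _ :=
    intervalIntegral.integral_smul c _
  simp only [heatOp, h3]
  rw [h4]
  change _ - (_ + ∫ r in (0 : ℝ)..(t - s), c • ((y' t s - y' (t - r) s) • gen S r)) = _
  rw [h5]
  module

theorem intervalIntegrable_smul_gen_apply (hS : IsHeatFamily S κ CS) (hy : IsDriver T γ μ C y)
    (hκ : κ < γ) {s t : ℝ} (hs : 0 ≤ s) (hst : s ≤ t) (ht : t ≤ T) (f : E) :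
    IntervalIntegrable (fun r => (y t s - y (t - r) s) • gen S r f) volume 0 (t - s) := by
  have := (intervalIntegrable_smul_gen hS hy hκ hs hst ht)
  rw [intervalIntegrable_iff] at this ⊢
  exact this.apply_continuousLinearMap f

/-- The semigroup adds t - u to every time in the integral, moving its range from [0,u-s] to
[t-u,t-s], where it can be compared with the operator over [s,t]. -/
theorem heatS_heatOp (hS : IsHeatFamily S κ CS) (hy : IsDriver T γ μ C y)
    (hκ : κ < γ) {s u t : ℝ} (hs : 0 ≤ s) (hsu : s < u) (hut : u ≤ t) (ht : t ≤ T) (f : E) :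
    heatS n q (t - u) (heatOp S y u s f) = y u s • S (t - s) f -
      ∫ r in (t - u)..(t - s), (y u s - y (t - r) s) • gen S r f := by
  have hfu := intervalIntegrable_smul_gen_apply hS hy hκ hs hsu.le (hut.trans ht) f
  have ha0 : 0 ≤ t - u := by linarith
  have e1 : t - u + (u - s) = t - s := by ring
  rw [heatOp_apply hS hy hκ hs hsu.le (hut.trans ht), map_sub, map_smul,
    hS.comp_apply ha0 (by linarith), ← (heatS n q (t - u)).intervalIntegral_comp_comm hfu, e1]
  congr 1
  have h1 := intervalIntegral.integral_comp_add_left (a := 0) (b := u - s)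
    (fun r => (y u s - y (t - r) s) • gen S r f) (t - u)
  rw [add_zero, e1] at h1
  rw [← h1]
  refine intervalIntegral.integral_congr_ae (ae_of_all _ fun r hr => ?_)
  rw [uIoc_of_le (by linarith)] at hr
  have e2 : t - (t - u + r) = u - r := by ring
  rw [map_smul, hS.heatS_gen ha0 hr.1, e2]

/-- On [t-u,t-s] the two integrands differ by the constant y_{ts} - y_{us} times the derivative of
S, which integrates exactly and cancels the boundary terms; what remains over [0,t-u] is the
operator of y'. With y' = δx this is δ̂X^x = 0. With y' = x² plus a multiple of δx it is the
relation for X^{xx}. -/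
theorem heatOp_chen {y' : ℝ → ℝ → ℝ} (hS : IsHeatFamily S κ CS) (hy : IsDriver T γ μ C y)
    (hκ : κ < γ) {s u t : ℝ} (hs : 0 ≤ s) (hsu : s ≤ u) (hut : u ≤ t) (ht : t ≤ T)
    (h : ∀ v, u ≤ v → v ≤ t → y v s - y u s = y' v u) (f : E) :
    heatOp S y t s f - heatS n q (t - u) (heatOp S y u s f) = heatOp S y' t u f := by
  rcases hsu.eq_or_lt with rfl | hsu
  · have h0 := hy.self hs (hut.trans ht)
    rw [heatOp_self hy hs (hut.trans ht), zero_apply, map_zero, sub_zero,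
      heatOp_congr (y' := y') hut fun v h1 h2 => by rw [← h v h1 h2, h0, sub_zero]]
  rcases hut.eq_or_lt with rfl | hut
  · have h0 := h u le_rfl le_rfl
    rw [sub_self] at h0
    simp [heatOp, ← h0, heatS_zero]
  have hst : s < t := hsu.trans hut
  have ha0 : 0 < t - u := by linarith
  have hab : t - u < t - s := by linarith
  have hfi := intervalIntegrable_smul_gen_apply hS hy hκ hs hst.le ht f
  have hsub1 : uIcc 0 (t - u) ⊆ uIcc 0 (t - s) := by
    rw [uIcc_of_le ha0.le, uIcc_of_le (by linarith)]; exact Icc_subset_Icc_right hab.le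
  have hsub2 : uIcc (t - u) (t - s) ⊆ uIcc 0 (t - s) := by
    rw [uIcc_of_le hab.le, uIcc_of_le (by linarith)]; exact Icc_subset_Icc_left ha0.le
  have hi1 := hfi.mono_set hsub1
  have hi2 := hfi.mono_set hsub2
  have hgen : IntervalIntegrable (fun r => gen S r f) volume (t - u) (t - s) := by
    have := hS.intervalIntegrable_gen ha0 hab.le
    rw [intervalIntegrable_iff] at this ⊢
    exact this.apply_continuousLinearMap f
  have hI : ∫ r in (t - u)..(t - s), gen S r f = S (t - s) f - S (t - u) f := by
    rw [← ContinuousLinearMap.intervalIntegral_apply (hS.intervalIntegrable_gen ha0 hab.le),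
      hS.integral_gen ha0 hab.le, sub_apply]
  have e3 : ∀ r, (y u s - y (t - r) s) • gen S r f =
      (y t s - y (t - r) s) • gen S r f - (y t s - y u s) • gen S r f := fun r => by module
  have hsplit : ∫ r in (t - u)..(t - s), (y u s - y (t - r) s) • gen S r f =
      (∫ r in (t - u)..(t - s), (y t s - y (t - r) s) • gen S r f) -
        (y t s - y u s) • (S (t - s) f - S (t - u) f) := by
    have hg : IntervalIntegrable (fun r => (y t s - y u s) • gen S r f) volume (t - u) (t - s) :=
      hgen.smul (y t s - y u s)
    rw [← hI, ← intervalIntegral.integral_smul, ← intervalIntegral.integral_sub hi2 hg]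
    exact intervalIntegral.integral_congr fun r _ => e3 r
  have hy't : y' t u = y t s - y u s := (h t hut.le le_rfl).symm
  have hEq : EqOn (fun r => (y t s - y (t - r) s) • gen S r)
      (fun r => (y' t u - y' (t - r) u) • gen S r) (uIcc 0 (t - u)) := by
    intro r hr
    rw [uIcc_of_le ha0.le] at hr
    change (y t s - y (t - r) s) • gen S r = (y' t u - y' (t - r) u) • gen S r
    rw [hy't, ← h (t - r) (by linarith [hr.2]) (by linarith [hr.1]), sub_sub_sub_cancel_right]
  have hi4 := ((intervalIntegrable_smul_gen hS hy hκ hs hst.le ht).mono_set hsub1)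
  have hR : heatOp S y' t u f = (y t s - y u s) • S (t - u) f -
      ∫ r in (0 : ℝ)..(t - u), (y t s - y (t - r) s) • gen S r f := by
    rw [heatOp, ← intervalIntegral.integral_congr hEq, sub_apply,
      ContinuousLinearMap.intervalIntegral_apply hi4, hy't]
    rfl
  rw [heatS_heatOp hS hy hκ hs hsu hut.le ht, heatOp_apply hS hy hκ hs hst.le ht, hR, hsplit,
    ← intervalIntegral.integral_add_adjacent_intervals hi1 hi2]
  module

end HeatOp

end Family

/-! ### Integrals over the half-line -/

/-- Regularity is used below the cut ρ and plain size above it. The cut is left free, to be matched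
to a time step or a translation length. -/
theorem integrableOn_Ioi_of_rpow_bounds {V : Type*} [NormedAddCommGroup V] [NormedSpace ℝ V]
    {F : ℝ → V} {A B a b ρ : ℝ} (ha : 0 < a) (hb : 0 < b) (hρ : 0 < ρ)
    (hm : AEStronglyMeasurable F (volume.restrict (Ioi 0)))
    (h1 : ∀ r, 0 < r → r ≤ ρ → ‖F r‖ ≤ A * r ^ (a - 1))
    (h2 : ∀ r, ρ < r → ‖F r‖ ≤ B * r ^ (-b - 1)) :
    IntegrableOn F (Ioi 0) ∧ ∫ r in Ioi 0, ‖F r‖ ≤ A * (ρ ^ a / a) + B * (ρ ^ (-b) / b) := by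
  have hU : Ioc 0 ρ ∪ Ioi ρ = Ioi (0 : ℝ) := Ioc_union_Ioi_eq_Ioi hρ.le
  have i1 : IntegrableOn (fun r : ℝ => A * r ^ (a - 1)) (Ioc 0 ρ) := by
    rw [← intervalIntegrable_iff_integrableOn_Ioc_of_le hρ.le]
    exact (intervalIntegral.intervalIntegrable_rpow' (by linarith)).const_mul A
  have i2 : IntegrableOn (fun r : ℝ => B * r ^ (-b - 1)) (Ioi ρ) :=
    (integrableOn_Ioi_rpow_of_lt (by linarith) hρ).const_mul B
  have e1 : ∫ r in Ioc 0 ρ, A * r ^ (a - 1) = A * (ρ ^ a / a) := by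
    rw [← intervalIntegral.integral_of_le hρ.le, intervalIntegral.integral_const_mul,
      integral_rpow (Or.inl (by linarith)), sub_add_cancel, Real.zero_rpow ha.ne', sub_zero]
  have e2 : ∫ r in Ioi ρ, B * r ^ (-b - 1) = B * (ρ ^ (-b) / b) := by
    rw [integral_const_mul, integral_Ioi_rpow_of_lt (by linarith) hρ, sub_add_cancel, div_neg,
      neg_div, neg_neg]
  have b1 : ∀ᵐ r ∂volume.restrict (Ioc 0 ρ), ‖F r‖ ≤ A * r ^ (a - 1) := by
    filter_upwards [ae_restrict_mem measurableSet_Ioc] with r hr using h1 r hr.1 hr.2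
  have b2 : ∀ᵐ r ∂volume.restrict (Ioi ρ), ‖F r‖ ≤ B * r ^ (-b - 1) := by
    filter_upwards [ae_restrict_mem measurableSet_Ioi] with r hr using h2 r hr
  have j1 : IntegrableOn F (Ioc 0 ρ) := Integrable.mono' i1
    (hm.mono_measure (Measure.restrict_mono Ioc_subset_Ioi_self le_rfl)) b1
  have j2 : IntegrableOn F (Ioi ρ) := Integrable.mono' i2
    (hm.mono_measure (Measure.restrict_mono (Ioi_subset_Ioi hρ.le) le_rfl)) b2
  refine ⟨hU ▸ j1.union j2, ?_⟩
  rw [← hU, setIntegral_union (Ioc_disjoint_Ioi le_rfl) measurableSet_Ioi j1.norm j2.norm,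
    ← e1, ← e2]
  exact add_le_add (integral_mono_ae j1.norm i1 b1) (integral_mono_ae j2.norm i2 b2)

theorem tendsto_integral_Ioi {V : Type*} [NormedAddCommGroup V] [NormedSpace ℝ V]
    {F : ℝ → V} (hF : IntegrableOn F (Ioi 0)) :
    Tendsto (fun ε => ∫ r in Ioi ε, F r) (𝓝[>] 0) (𝓝 (∫ r in Ioi 0, F r)) := by
  have h := (aecover_Ioi_of_Ioi (μ := volume) (A := (0 : ℝ)) (l := 𝓝[>] 0) (a := id)
    nhdsWithin_le_nhds).integral_tendsto_of_countably_generated hF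
  refine h.congr' ?_
  filter_upwards [self_mem_nhdsWithin] with ε hε
  have hε : 0 < ε := hε
  rw [Measure.restrict_restrict measurableSet_Ioi]
  simp only [id_eq]
  rw [inter_eq_left.2 (Ioi_subset_Ioi hε.le)]

/-- The Beta integral B(1-α, α). It does not depend on w, which is why fractional integration
inverts fractional differentiation. -/
theorem integral_rpow_mul_sub_rpow {α : ℝ} (hα0 : 0 < α) (hα1 : α < 1) {w : ℝ} (hw : 0 < w) :
    ∫ v in (0 : ℝ)..w, v ^ (-α) * (w - v) ^ (α - 1) = Real.Gamma α * Real.Gamma (1 - α) := by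
  have h := Complex.betaIntegral_scaled ((1 - α : ℝ) : ℂ) (α : ℂ) hw
  have e1 : (((1 - α : ℝ) : ℂ) + (α : ℂ) - 1) = 0 := by push_cast; ring
  rw [e1, Complex.cpow_zero, one_mul, Complex.betaIntegral_eq_Gamma_mul_div _ _ (by simpa using hα1)
    (by simpa using hα0)] at h
  have e2 : (((1 - α : ℝ) : ℂ) + (α : ℂ)) = 1 := by push_cast; ring
  rw [e2, Complex.Gamma_one, div_one, Complex.Gamma_ofReal, Complex.Gamma_ofReal] at h
  rw [mul_comm]
  apply Complex.ofReal_injective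
  rw [Complex.ofReal_mul, ← h, ← intervalIntegral.integral_ofReal]
  refine intervalIntegral.integral_congr fun v hv => ?_
  rw [uIcc_of_le hw.le] at hv
  rw [Complex.ofReal_mul, Complex.ofReal_cpow hv.1, Complex.ofReal_cpow (by linarith [hv.2])]
  push_cast
  ring_nf

/-! ### The Bessel potential -/

section Bessel

variable {n : ℕ} {q : ℝ≥0∞} [Fact (1 ≤ q)] [Fact (q ≠ ⊤)]

theorem continuousOn_heatS_two_mul :
    ContinuousOn (fun r : ℝ => heatS n q (2 * r)) (Ioi 0) :=
  isHeatFamily_heatS.continuousOn.comp (by fun_prop) fun r hr => by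
    have : (0 : ℝ) < r := hr
    simp only [mem_Ioi]; positivity

theorem aestronglyMeasurable_heatS_two_mul (f : LSp n q) :
    AEStronglyMeasurable (fun r : ℝ => heatS n q (2 * r) f) (volume.restrict (Ioi 0)) :=
  (continuousOn_heatS_two_mul.clm_apply continuousOn_const).aestronglyMeasurable measurableSet_Ioi

theorem aestronglyMeasurable_rpow (a : ℝ) :
    AEStronglyMeasurable (fun r : ℝ => r ^ a) (volume.restrict (Ioi 0)) :=
  (measurable_id.pow_const a).aestronglyMeasurable

theorem integrableOn_bessel_weight {α : ℝ} (hα : 0 < α) :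
    IntegrableOn (fun r : ℝ => r ^ (α - 1) * Real.exp (-r)) (Ioi 0) := by
  simpa only [mul_comm] using Real.GammaIntegral_convergent hα

theorem integral_bessel_weight {α : ℝ} (hα : 0 < α) :
    ∫ r in Ioi (0 : ℝ), r ^ (α - 1) * Real.exp (-r) = Real.Gamma α := by
  rw [Real.Gamma_eq_integral hα]; simp only [mul_comm]

theorem integrable_bessel_prod (n : ℕ) {α : ℝ} (hα : 0 < α) :
    Integrable (fun z : ℝ × Space n =>
      z.1 ^ (α - 1) * Real.exp (-z.1) * gaussKernel n (2 * z.1) z.2)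
      ((volume.restrict (Ioi 0)).prod volume) := by
  have hm : Measurable fun z : ℝ × Space n =>
      z.1 ^ (α - 1) * Real.exp (-z.1) * gaussKernel n (2 * z.1) z.2 := by
    unfold gaussKernel; fun_prop
  rw [integrable_prod_iff hm.aestronglyMeasurable]
  constructor
  · filter_upwards [ae_restrict_mem measurableSet_Ioi] with r hr
    have hr : (0 : ℝ) < r := hr
    exact (integrable_gaussKernel n (by positivity)).const_mul _
  · refine (integrableOn_bessel_weight hα).congr ?_
    filter_upwards [ae_restrict_mem measurableSet_Ioi] with r hr
    have hr : (0 : ℝ) < r := hr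
    have h1 : ∀ y, ‖r ^ (α - 1) * Real.exp (-r) * gaussKernel n (2 * r) y‖ =
        r ^ (α - 1) * Real.exp (-r) * gaussKernel n (2 * r) y := fun y =>
      Real.norm_of_nonneg (mul_nonneg (by positivity) (gaussKernel_nonneg n (by positivity) y))
    simp only [h1]
    rw [integral_const_mul, integral_gaussKernel n (by positivity), mul_one]

variable (n q) in
/-- The operator `(Id - Δ)^{-α}` on `L^q`. -/
def besselJ (α : ℝ) : LSp n q →L[ℝ] LSp n q := convLp q (besselKernel n α)

theorem integrable_besselKernel (n : ℕ) {α : ℝ} (hα : 0 < α) :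
    Integrable (besselKernel n α) volume :=
  (integrable_bessel_prod n hα).integral_prod_right.const_mul _

theorem integrableOn_weight_smul {V : Type*} [NormedAddCommGroup V] [NormedSpace ℝ V] {w : ℝ → ℝ}
    (hw : IntegrableOn w (Ioi 0)) {F : ℝ → V} {M : ℝ}
    (hF : AEStronglyMeasurable F (volume.restrict (Ioi 0))) (hM : ∀ r, 0 < r → ‖F r‖ ≤ M) :
    IntegrableOn (fun r => w r • F r) (Ioi 0) := by
  refine (hw.norm.mul_const M).mono' (hw.aestronglyMeasurable.smul hF) ?_
  filter_upwards [ae_restrict_mem measurableSet_Ioi] with r hr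
  rw [norm_smul]
  exact mul_le_mul_of_nonneg_left (hM r hr) (norm_nonneg _)

theorem besselJ_apply {α : ℝ} (hα : 0 < α) (f : LSp n q) :
    besselJ n q α f = (Real.Gamma α)⁻¹ •
      ∫ r in Ioi (0 : ℝ), (r ^ (α - 1) * Real.exp (-r)) • heatS n q (2 * r) f := by
  have hp := integrable_bessel_prod n hα
  have h2 : Integrable (fun z : ℝ × Space n =>
      (z.1 ^ (α - 1) * Real.exp (-z.1) * gaussKernel n (2 * z.1) z.2) • transl q z.2 f)
      ((volume.restrict (Ioi 0)).prod volume) := by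
    refine (hp.norm.mul_const ‖f‖).mono' (hp.aestronglyMeasurable.smul
      ((continuous_transl f).comp continuous_snd).aestronglyMeasurable) ?_
    filter_upwards with z
    rw [norm_smul, norm_transl]
  rw [besselJ, convLp_apply (integrable_besselKernel n hα)]
  simp only [besselKernel, mul_smul (Real.Gamma α)⁻¹, ← integral_smul_const]
  rw [integral_smul, ← integral_integral_swap (f := fun r y =>
    (r ^ (α - 1) * Real.exp (-r) * gaussKernel n (2 * r) y) • transl q y f) h2]
  congr 1
  refine setIntegral_congr_fun measurableSet_Ioi fun r hr => ?_
  have hr : (0 : ℝ) < r := hr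
  simp only [mul_smul]
  rw [integral_smul, integral_smul, heatS_apply (by positivity)]

theorem norm_clm_besselJ_le {α : ℝ} (hα : 0 < α) {V : Type*} [NormedAddCommGroup V]
    [NormedSpace ℝ V] [CompleteSpace V] (L : LSp n q →L[ℝ] V) (f : LSp n q) :
    ‖L (besselJ n q α f)‖ ≤ (Real.Gamma α)⁻¹ *
      ∫ r in Ioi (0 : ℝ), ‖(r ^ (α - 1) * Real.exp (-r)) • L (heatS n q (2 * r) f)‖ := by
  have hi := integrableOn_weight_smul (integrableOn_bessel_weight hα)
    (aestronglyMeasurable_heatS_two_mul f) fun r _ => norm_heatS_le (2 * r) f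
  rw [besselJ_apply hα, map_smul, ← L.integral_comp_comm hi, norm_smul,
    Real.norm_of_nonneg (inv_nonneg.2 (Real.Gamma_pos_of_pos hα).le)]
  refine mul_le_mul_of_nonneg_left ?_ (inv_nonneg.2 (Real.Gamma_pos_of_pos hα).le)
  simp only [map_smul]
  exact norm_integral_le_integral_norm _

/-! ### Inverting the Bessel potential -/

/-- The normalizing constant of `(-Δ)^α`. -/
def fracC (α : ℝ) : ℝ := α / Real.Gamma (1 - α)

theorem fracC_pos {α : ℝ} (hα0 : 0 < α) (hα1 : α < 1) : 0 < fracC α :=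
  div_pos hα0 (Real.Gamma_pos_of_pos (by linarith))

/-- The weight is the difference between the Balakrishnan formulas of Id - Δ and -Δ. At zero 1 -
e^{-r} ≤ r tames the singularity, and at infinity r^{-α-1} decays. -/
theorem integrableOn_compensator {α : ℝ} (hα0 : 0 < α) (hα1 : α < 1) :
    IntegrableOn (fun r : ℝ => r ^ (-α - 1) * (1 - Real.exp (-r))) (Ioi 0) := by
  refine (integrableOn_Ioi_of_rpow_bounds (A := 1) (B := 1) (a := 1 - α) (b := α) (ρ := 1)
    (by linarith) hα0 one_pos ?_ ?_ ?_).1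
  · exact (aestronglyMeasurable_rpow _).mul (by fun_prop : Continuous fun r : ℝ =>
      1 - Real.exp (-r)).aestronglyMeasurable
  · intro r hr _
    have h1 : 0 ≤ 1 - Real.exp (-r) := sub_nonneg.2 (Real.exp_le_one_iff.2 (by linarith))
    have h2 : 1 - Real.exp (-r) ≤ r := by linarith [Real.add_one_le_exp (-r)]
    rw [Real.norm_of_nonneg (by positivity), one_mul]
    calc _ ≤ r ^ (-α - 1) * r := by gcongr
      _ = r ^ (1 - α - 1) := by
        rw [← Real.rpow_add_one hr.ne']; ring_nf
  · intro r hr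
    have hr0 : 0 < r := by linarith
    have h1 : 0 ≤ 1 - Real.exp (-r) := sub_nonneg.2 (Real.exp_le_one_iff.2 (by linarith))
    have h2 : 1 - Real.exp (-r) ≤ 1 := by linarith [Real.exp_pos (-r)]
    rw [Real.norm_of_nonneg (by positivity), one_mul]
    exact mul_le_of_le_one_right (by positivity) h2

/-- The bounded operator `(Id - Δ)^α - (-Δ)^α`. -/
def compOp (α : ℝ) (f : LSp n q) : LSp n q :=
  fracC α • ∫ r in Ioi (0 : ℝ), (r ^ (-α - 1) * (1 - Real.exp (-r))) • heatS n q (2 * r) f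

theorem integrableOn_compOp {α : ℝ} (hα0 : 0 < α) (hα1 : α < 1) (f : LSp n q) :
    IntegrableOn (fun r : ℝ => (r ^ (-α - 1) * (1 - Real.exp (-r))) • heatS n q (2 * r) f)
      (Ioi 0) :=
  integrableOn_weight_smul (integrableOn_compensator hα0 hα1)
    (aestronglyMeasurable_heatS_two_mul f) fun r _ => norm_heatS_le (2 * r) f

theorem norm_compOp_le {α : ℝ} (hα0 : 0 < α) (hα1 : α < 1) :
    ∃ C, 0 ≤ C ∧ ∀ f : LSp n q, ‖compOp α f‖ ≤ C * ‖f‖ := by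
  have hc := fracC_pos hα0 hα1
  refine ⟨fracC α * ∫ r in Ioi (0 : ℝ), ‖r ^ (-α - 1) * (1 - Real.exp (-r))‖,
    mul_nonneg hc.le (integral_nonneg fun _ => norm_nonneg _), fun f => ?_⟩
  rw [compOp, norm_smul, Real.norm_of_nonneg hc.le, mul_assoc]
  refine mul_le_mul_of_nonneg_left ?_ hc.le
  rw [← integral_mul_const]
  refine norm_integral_le_of_norm_le ((integrableOn_compensator hα0 hα1).norm.mul_const _) ?_
  filter_upwards with r
  rw [norm_smul]
  exact mul_le_mul_of_nonneg_left (norm_heatS_le _ _) (norm_nonneg _)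

theorem compOp_heatS {α : ℝ} (hα0 : 0 < α) (hα1 : α < 1) (t : ℝ) (f : LSp n q) :
    compOp α (heatS n q t f) = heatS n q t (compOp α f) := by
  rw [compOp, compOp, map_smul,
    ← (heatS n q t).integral_comp_comm (integrableOn_compOp hα0 hα1 f)]
  simp only [map_smul, heatS_comm t]

/-- Minus the derivative of `v ↦ e^{-v} e^{vΔ} S_ρ φ`. -/
def decay (ρ : ℝ) (φ : LSp n q) (v : ℝ) : LSp n q :=
  Real.exp (-v) • (heatS n q (2 * v + ρ) φ - (2 : ℝ) • heatG n q (2 * v + ρ) φ)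

theorem hasDerivAt_decay {ρ : ℝ} (hρ : 0 < ρ) (φ : LSp n q) {v : ℝ} (hv : 0 ≤ v) :
    HasDerivAt (fun v => Real.exp (-v) • heatS n q (2 * v + ρ) φ) (-decay ρ φ v) v := by
  have h1 : HasDerivAt (fun v : ℝ => 2 * v + ρ) 2 v := by
    simpa using ((hasDerivAt_id v).const_mul 2).add_const ρ
  have h2 := (hasDerivAt_heatS (t := 2 * v + ρ) (by positivity) φ).scomp v h1
  have h3 : HasDerivAt (fun v : ℝ => Real.exp (-v)) (-Real.exp (-v)) v := by
    simpa using (hasDerivAt_neg v).exp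
  refine (h3.smul h2).congr_deriv ?_
  simp only [decay, Function.comp_apply]
  module

theorem continuousOn_decay {ρ : ℝ} (hρ : 0 < ρ) (φ : LSp n q) :
    ContinuousOn (decay ρ φ) (Ici 0) := by
  have hmap : MapsTo (fun v : ℝ => 2 * v + ρ) (Ici 0) (Ioi 0) := fun v hv => by
    have : (0 : ℝ) ≤ v := hv
    simp only [mem_Ioi]; positivity
  have h1 : ContinuousOn (fun v : ℝ => heatS n q (2 * v + ρ)) (Ici 0) :=
    isHeatFamily_heatS.continuousOn.comp (by fun_prop) hmap
  have h2 : ContinuousOn (fun v : ℝ => heatG n q (2 * v + ρ)) (Ici 0) :=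
    continuousOn_heatG.comp (by fun_prop) hmap
  refine (by fun_prop : Continuous fun v : ℝ => Real.exp (-v)).continuousOn.smul ?_
  exact (h1.clm_apply continuousOn_const).sub
    ((continuousOn_const (c := (2 : ℝ))).smul (h2.clm_apply continuousOn_const))

theorem norm_decay_le {ρ : ℝ} (hρ : 0 < ρ) (φ : LSp n q) {v : ℝ} (hv : 0 ≤ v) :
    ‖decay ρ φ v‖ ≤ (1 + 2 * (dotC n / ρ)) * ‖φ‖ * Real.exp (-v) := by
  have hd := dotC_pos n
  have h1 := norm_heatS_le (2 * v + ρ) φ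
  have h2 := norm_heatG_le (t := 2 * v + ρ) (by positivity) φ
  have h3 : dotC n / (2 * v + ρ) ≤ dotC n / ρ := by gcongr; linarith
  rw [decay, norm_smul, Real.norm_of_nonneg (Real.exp_pos _).le, mul_comm]
  gcongr
  refine (norm_sub_le _ _).trans ?_
  rw [norm_smul, Real.norm_of_nonneg zero_le_two]
  calc _ ≤ ‖φ‖ + 2 * (dotC n / ρ * ‖φ‖) := by gcongr; exact h2.trans (by gcongr)
    _ = _ := by ring

theorem integrableOn_decay {ρ : ℝ} (hρ : 0 < ρ) (φ : LSp n q) :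
    IntegrableOn (decay ρ φ) (Ioi 0) := by
  have h : IntegrableOn (fun v : ℝ => Real.exp (-v)) (Ioi 0) := integrableOn_exp_neg_Ioi 0
  refine (h.const_mul ((1 + 2 * (dotC n / ρ)) * ‖φ‖)).mono'
    (((continuousOn_decay hρ φ).mono Ioi_subset_Ici_self).aestronglyMeasurable measurableSet_Ioi) ?_
  filter_upwards [ae_restrict_mem measurableSet_Ioi] with v hv
  exact norm_decay_le hρ φ (le_of_lt hv)

theorem integral_decay {ρ : ℝ} (hρ : 0 < ρ) (φ : LSp n q) {r : ℝ} (hr : 0 ≤ r) :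
    ∫ v in (0 : ℝ)..r, decay ρ φ v =
      heatS n q ρ φ - Real.exp (-r) • heatS n q (2 * r) (heatS n q ρ φ) := by
  have h := intervalIntegral.integral_eq_sub_of_hasDerivAt (a := 0) (b := r)
    (f := fun v => -(Real.exp (-v) • heatS n q (2 * v + ρ) φ)) (f' := decay ρ φ) (fun v hv => by
      rw [uIcc_of_le hr] at hv
      have h := (hasDerivAt_decay hρ φ hv.1).neg
      rw [neg_neg] at h
      exact h)
    (((continuousOn_decay hρ φ).mono (by
      rw [uIcc_of_le hr]; exact Icc_subset_Ici_self)).intervalIntegrable)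
  rw [h, heatS_heatS (by positivity) hρ.le]
  simp only [neg_zero, Real.exp_zero, one_smul, mul_zero, zero_add]
  abel

theorem integral_Ioi_decay {ρ : ℝ} (hρ : 0 < ρ) (φ : LSp n q) :
    ∫ v in Ioi (0 : ℝ), decay ρ φ v = heatS n q ρ φ := by
  have h := integral_Ioi_of_hasDerivAt_of_tendsto' (a := 0) (m := 0)
    (f := fun v => -(Real.exp (-v) • heatS n q (2 * v + ρ) φ)) (f' := decay ρ φ) (fun v hv => by
      have h := (hasDerivAt_decay hρ φ hv).neg
      rw [neg_neg] at h
      exact h) (integrableOn_decay hρ φ) ?_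
  · rw [h]; simp
  · rw [tendsto_zero_iff_norm_tendsto_zero]
    refine squeeze_zero (g := fun v => Real.exp (-v) * ‖φ‖) (fun v => norm_nonneg _) (fun v => ?_) ?_
    · rw [norm_neg, norm_smul, Real.norm_of_nonneg (Real.exp_pos _).le]
      exact mul_le_mul_of_nonneg_left (norm_heatS_le _ _) (Real.exp_pos _).le
    · simpa using (Real.tendsto_exp_neg_atTop_nhds_zero).mul_const ‖φ‖

theorem aestronglyMeasurable_decay {ρ : ℝ} (hρ : 0 < ρ) (φ : LSp n q) :
    AEStronglyMeasurable (decay ρ φ) (volume.restrict (Ioi 0)) :=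
  (integrableOn_decay hρ φ).aestronglyMeasurable

theorem integrableOn_rpow_smul_decay {α ρ : ℝ} (hα1 : α < 1) (hρ : 0 < ρ)
    (φ : LSp n q) : IntegrableOn (fun v : ℝ => v ^ (-α) • decay ρ φ v) (Ioi 0) := by
  have hw := integrableOn_bessel_weight (α := 1 - α) (by linarith)
  refine (hw.const_mul ((1 + 2 * (dotC n / ρ)) * ‖φ‖)).mono'
    ((aestronglyMeasurable_rpow _).smul (aestronglyMeasurable_decay hρ φ)) ?_
  filter_upwards [ae_restrict_mem measurableSet_Ioi] with v hv
  have hv : (0 : ℝ) < v := hv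
  rw [norm_smul, Real.norm_of_nonneg (by positivity)]
  calc _ ≤ v ^ (-α) * ((1 + 2 * (dotC n / ρ)) * ‖φ‖ * Real.exp (-v)) := by
        gcongr; exact norm_decay_le hρ φ hv.le
    _ = _ := by ring_nf

/-- Integration by parts against `r ^ (-α)` on the half-line. -/
theorem integrable_and_integral_rpow_smul {V : Type*} [NormedAddCommGroup V] [NormedSpace ℝ V]
    [CompleteSpace V] {F B : ℝ → V} {α K M : ℝ} (hα0 : 0 < α) (hα1 : α < 1) (hK0 : 0 ≤ K)
    (hder : ∀ r, 0 < r → HasDerivAt F (B r) r) (hF1 : ∀ r, 0 < r → ‖F r‖ ≤ K * r)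
    (hF2 : ∀ r, 0 < r → ‖F r‖ ≤ M) (hB : IntegrableOn (fun r : ℝ => r ^ (-α) • B r) (Ioi 0)) :
    IntegrableOn (fun r : ℝ => r ^ (-α - 1) • F r) (Ioi 0) ∧
    ∫ r in Ioi (0 : ℝ), r ^ (-α - 1) • F r = α⁻¹ • ∫ v in Ioi (0 : ℝ), v ^ (-α) • B v := by
  have hFm : AEStronglyMeasurable F (volume.restrict (Ioi 0)) :=
    ContinuousOn.aestronglyMeasurable
      (fun r hr => (hder r hr).continuousAt.continuousWithinAt) measurableSet_Ioi
  have hint : IntegrableOn (fun r : ℝ => r ^ (-α - 1) • F r) (Ioi 0) := by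
    refine (integrableOn_Ioi_of_rpow_bounds (A := K) (B := M) (a := 1 - α) (b := α)
      (ρ := 1) (by linarith) hα0 one_pos ((aestronglyMeasurable_rpow _).smul hFm) ?_ ?_).1
    · intro r hr _
      rw [Pi.smul_apply', norm_smul, Real.norm_of_nonneg (by positivity)]
      calc _ ≤ r ^ (-α - 1) * (K * r) := by gcongr; exact hF1 r hr
        _ = K * (r ^ (-α - 1) * r) := by ring
        _ = _ := by rw [← Real.rpow_add_one hr.ne']; ring_nf
    · intro r hr
      have hr0 : 0 < r := by linarith
      rw [Pi.smul_apply', norm_smul, Real.norm_of_nonneg (by positivity), mul_comm]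
      gcongr
      exact hF2 r hr0
  refine ⟨hint, ?_⟩
  have hB' : IntegrableOn (fun r : ℝ => α⁻¹ • r ^ (-α) • B r) (Ioi 0) := hB.smul α⁻¹
  -- By convention 0^{-α} = 0, so the primitive takes the value 0 at the endpoint; this is also its
  -- limit there, since r^{-α} ‖F r‖ ≤ K r^{1-α}.
  have h0 : -(α⁻¹ • (0 : ℝ) ^ (-α) • F 0) = 0 := by
    rw [Real.zero_rpow (by linarith), zero_smul, smul_zero, neg_zero]
  have hibp : ∫ r in Ioi (0 : ℝ), (r ^ (-α - 1) • F r - α⁻¹ • r ^ (-α) • B r) =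
      0 - -(α⁻¹ • (0 : ℝ) ^ (-α) • F 0) := by
    refine integral_Ioi_of_hasDerivAt_of_tendsto (f := fun r : ℝ => -(α⁻¹ • r ^ (-α) • F r))
      ?_ ?_ (hint.sub hB') ?_
    · rw [ContinuousWithinAt, h0, tendsto_zero_iff_norm_tendsto_zero]
      refine squeeze_zero' (g := fun r : ℝ => α⁻¹ * (K * r ^ (1 - α)))
        (by filter_upwards with r; positivity) ?_ ?_
      · filter_upwards [self_mem_nhdsWithin] with r hr
        rcases (show (0 : ℝ) ≤ r from hr).eq_or_lt with rfl | hr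
        · rw [h0, norm_zero]; positivity
        rw [norm_neg, norm_smul, norm_smul, Real.norm_of_nonneg (by positivity : 0 ≤ α⁻¹),
          Real.norm_of_nonneg (by positivity : 0 ≤ r ^ (-α))]
        refine mul_le_mul_of_nonneg_left ?_ (by positivity)
        calc _ ≤ r ^ (-α) * (K * r) := by gcongr; exact hF1 r hr
          _ = K * (r ^ (-α) * r) := by ring
          _ = _ := by rw [← Real.rpow_add_one hr.ne']; ring_nf
      · have hc : Continuous fun r : ℝ => α⁻¹ * (K * r ^ (1 - α)) :=
          continuous_const.mul (continuous_const.mul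
            (continuous_id.rpow_const fun _ => Or.inr (by linarith)))
        have := hc.tendsto 0
        rw [Real.zero_rpow (by linarith), mul_zero, mul_zero] at this
        exact this.mono_left nhdsWithin_le_nhds
    · intro r hr
      have hr : (0 : ℝ) < r := hr
      have h1 : HasDerivAt (fun r : ℝ => r ^ (-α) • F r)
          (r ^ (-α) • B r + (-α * r ^ (-α - 1)) • F r) r :=
        (Real.hasDerivAt_rpow_const (x := r) (p := -α) (Or.inl hr.ne')).smul (hder r hr)
      refine (h1.const_smul α⁻¹).neg.congr_deriv ?_
      rw [smul_add, smul_smul α⁻¹ (-α * _)]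
      have : α⁻¹ * (-α * r ^ (-α - 1)) = -r ^ (-α - 1) := by field_simp
      rw [this, neg_smul, neg_add, neg_neg, add_comm, ← sub_eq_add_neg]
    · rw [tendsto_zero_iff_norm_tendsto_zero]
      refine squeeze_zero' (g := fun r : ℝ => α⁻¹ * (r ^ (-α) * M))
        (by filter_upwards with r; positivity) ?_ ?_
      · filter_upwards [Ioi_mem_atTop 0] with r hr
        have hr : (0 : ℝ) < r := hr
        rw [norm_neg, norm_smul, norm_smul, Real.norm_of_nonneg (by positivity : 0 ≤ α⁻¹),
          Real.norm_of_nonneg (by positivity : 0 ≤ r ^ (-α))]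
        gcongr
        exact hF2 r hr
      · simpa using ((tendsto_rpow_neg_atTop hα0).mul_const M).const_mul α⁻¹
  rw [h0, sub_zero, integral_sub hint hB', integral_smul, sub_eq_zero] at hibp
  exact hibp

/-- `(Id - Δ)^α` on `S_ρ φ`. -/
theorem integrable_and_integral_rpow_smul_sub {α ρ : ℝ} (hα0 : 0 < α) (hα1 : α < 1) (hρ : 0 < ρ)
    (φ : LSp n q) :
    IntegrableOn (fun r : ℝ => r ^ (-α - 1) •
      (heatS n q ρ φ - Real.exp (-r) • heatS n q (2 * r) (heatS n q ρ φ))) (Ioi 0) ∧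
    ∫ r in Ioi (0 : ℝ), r ^ (-α - 1) •
      (heatS n q ρ φ - Real.exp (-r) • heatS n q (2 * r) (heatS n q ρ φ)) =
      α⁻¹ • ∫ v in Ioi (0 : ℝ), v ^ (-α) • decay ρ φ v := by
  have hd := dotC_pos n
  have hK0 : 0 ≤ (1 + 2 * (dotC n / ρ)) * ‖φ‖ := by positivity
  have hFd : ∀ r : ℝ, 0 ≤ r → heatS n q ρ φ - Real.exp (-r) • heatS n q (2 * r) (heatS n q ρ φ) =
      heatS n q ρ φ - Real.exp (-r) • heatS n q (2 * r + ρ) φ := by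
    intro r hr
    rw [← heatS_heatS (by positivity) hρ.le]
  refine integrable_and_integral_rpow_smul (M := 2 * ‖φ‖) hα0 hα1 hK0 ?_ ?_ ?_
    (integrableOn_rpow_smul_decay hα1 hρ φ)
  · intro r hr
    have h := (hasDerivAt_decay hρ φ hr.le).const_sub (heatS n q ρ φ)
    rw [neg_neg] at h
    refine h.congr_of_eventuallyEq ?_
    filter_upwards [lt_mem_nhds hr] with v hv
    exact hFd v hv.le
  · intro r hr
    have h1 := intervalIntegral.norm_integral_le_of_norm_le_const (a := 0) (b := r)
      (C := (1 + 2 * (dotC n / ρ)) * ‖φ‖) (f := decay ρ φ) (fun v hv => by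
        rw [uIoc_of_le hr.le] at hv
        refine (norm_decay_le hρ φ hv.1.le).trans ?_
        exact mul_le_of_le_one_right hK0 (Real.exp_le_one_iff.2 (by linarith [hv.1])))
    rw [integral_decay hρ φ hr.le, sub_zero, abs_of_pos hr] at h1
    exact h1
  · intro r hr
    refine (norm_sub_le _ _).trans ?_
    rw [norm_smul, Real.norm_of_nonneg (Real.exp_pos _).le]
    have h1 := norm_heatS_le ρ φ
    have h2 := (norm_heatS_le (2 * r) (heatS n q ρ φ)).trans h1
    have h3 : Real.exp (-r) ≤ 1 := Real.exp_le_one_iff.2 (by linarith)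
    have := mul_le_mul h3 h2 (norm_nonneg _) zero_le_one
    linarith

theorem heatS_decay {ρ : ℝ} (hρ : 0 < ρ) (φ : LSp n q) {s v : ℝ} (hs : 0 ≤ s) (hv : 0 ≤ v) :
    Real.exp (-s) • heatS n q (2 * s) (decay ρ φ v) = decay ρ φ (v + s) := by
  have e : 2 * s + (2 * v + ρ) = 2 * (v + s) + ρ := by ring
  rw [decay, decay, map_smul, map_sub, map_smul, heatS_heatS (by positivity) (by positivity),
    heatS_heatG (by positivity) (by positivity), e, smul_smul, ← Real.exp_add]
  congr 2
  ring

/-- The damped semigroup e^{-s} e^{sΔ} acts on `decay` as a shift by s, so the Bessel potential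
becomes a fractional integral of order α in the time variable. -/
theorem besselJ_decay {α ρ : ℝ} (hα0 : 0 < α) (hρ : 0 < ρ) (φ : LSp n q) {v : ℝ} (hv : 0 < v) :
    besselJ n q α (decay ρ φ v) =
      (Real.Gamma α)⁻¹ • ∫ w in Ioi v, (w - v) ^ (α - 1) • decay ρ φ w := by
  rw [besselJ_apply hα0]
  congr 1
  have h := (measurePreserving_add_right volume v).setIntegral_preimage_emb
    (measurableEmbedding_addRight v) (fun w => (w - v) ^ (α - 1) • decay ρ φ w) (Ioi v)
  rw [preimage_add_const_Ioi, sub_self] at h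
  rw [← h]
  refine setIntegral_congr_fun measurableSet_Ioi fun s hs => ?_
  have hs : (0 : ℝ) < s := hs
  rw [add_sub_cancel_right, mul_smul, heatS_decay hρ φ hs.le hv.le, add_comm]

/-- The kernel of the convolution of two powers. -/
def betaKer (α v w : ℝ) : ℝ := (Ioo 0 w).indicator (fun v => v ^ (-α) * (w - v) ^ (α - 1)) v

theorem measurable_betaKer (α : ℝ) : Measurable fun z : ℝ × ℝ => betaKer α z.1 z.2 := by
  have h : (fun z : ℝ × ℝ => betaKer α z.1 z.2) =
      ({z : ℝ × ℝ | 0 < z.1 ∧ z.1 < z.2}).indicator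
        (fun z => z.1 ^ (-α) * (z.2 - z.1) ^ (α - 1)) := by
    ext z
    by_cases hz : 0 < z.1 ∧ z.1 < z.2
    · rw [indicator_of_mem (show z ∈ {z : ℝ × ℝ | 0 < z.1 ∧ z.1 < z.2} from hz), betaKer,
        indicator_of_mem (show z.1 ∈ Ioo 0 z.2 from hz)]
    · rw [indicator_of_notMem (show z ∉ {z : ℝ × ℝ | 0 < z.1 ∧ z.1 < z.2} from hz), betaKer,
        indicator_of_notMem (show z.1 ∉ Ioo 0 z.2 from hz)]
  rw [h]
  refine Measurable.indicator (by fun_prop) ?_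
  exact (measurableSet_lt measurable_const measurable_fst).inter
    (measurableSet_lt measurable_fst measurable_snd)

theorem betaKer_nonneg (α v w : ℝ) : 0 ≤ betaKer α v w := by
  refine indicator_nonneg (fun v hv => ?_) v
  have := hv.1
  have : 0 < w - v := by linarith [hv.2]
  positivity

theorem integral_betaKer {α : ℝ} (hα0 : 0 < α) (hα1 : α < 1) {w : ℝ} (hw : 0 < w) :
    Integrable (fun v => betaKer α v w) (volume.restrict (Ioi 0)) ∧
      ∫ v in Ioi 0, betaKer α v w = Real.Gamma α * Real.Gamma (1 - α) := by
  have h := integral_rpow_mul_sub_rpow hα0 hα1 hw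
  have hne : ∫ v in (0 : ℝ)..w, v ^ (-α) * (w - v) ^ (α - 1) ≠ 0 := by
    rw [h]
    exact (mul_pos (Real.Gamma_pos_of_pos hα0) (Real.Gamma_pos_of_pos (by linarith))).ne'
  have hi := intervalIntegral.intervalIntegrable_of_integral_ne_zero hne
  rw [intervalIntegrable_iff_integrableOn_Ioo_of_le hw.le] at hi
  rw [intervalIntegral.integral_of_le hw.le, integral_Ioc_eq_integral_Ioo] at h
  unfold betaKer
  refine ⟨((integrable_indicator_iff measurableSet_Ioo).2 hi).restrict, ?_⟩
  rw [setIntegral_indicator measurableSet_Ioo, inter_eq_right.2 Ioo_subset_Ioi_self, h]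

theorem integrable_betaKer_smul {α : ℝ} (hα0 : 0 < α) (hα1 : α < 1) {V : Type*}
    [NormedAddCommGroup V] [NormedSpace ℝ V] {B : ℝ → V} (hB : IntegrableOn B (Ioi 0)) :
    Integrable (fun z : ℝ × ℝ => betaKer α z.1 z.2 • B z.2)
      ((volume.restrict (Ioi 0)).prod (volume.restrict (Ioi 0))) := by
  have hm : AEStronglyMeasurable (fun z : ℝ × ℝ => betaKer α z.1 z.2 • B z.2)
      ((volume.restrict (Ioi 0)).prod (volume.restrict (Ioi 0))) :=
    (measurable_betaKer α).aestronglyMeasurable.smul hB.aestronglyMeasurable.comp_snd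
  rw [integrable_prod_iff' hm]
  constructor
  · filter_upwards [ae_restrict_mem measurableSet_Ioi] with w hw
    exact (integral_betaKer hα0 hα1 hw).1.smul_const _
  · refine (hB.norm.const_mul (Real.Gamma α * Real.Gamma (1 - α))).congr ?_
    filter_upwards [ae_restrict_mem measurableSet_Ioi] with w hw
    simp only [norm_smul, Real.norm_of_nonneg (betaKer_nonneg _ _ _)]
    rw [integral_mul_const, (integral_betaKer hα0 hα1 hw).2]

/-- The Bessel potential inverts `(Id - Δ)^α` on the range of `S_ρ`. -/
theorem besselJ_integral_sub {α ρ : ℝ} (hα0 : 0 < α) (hα1 : α < 1) (hρ : 0 < ρ) (φ : LSp n q) :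
    besselJ n q α (fracC α • ∫ r in Ioi (0 : ℝ), r ^ (-α - 1) •
      (heatS n q ρ φ - Real.exp (-r) • heatS n q (2 * r) (heatS n q ρ φ))) = heatS n q ρ φ := by
  have hΓ := Real.Gamma_pos_of_pos hα0
  have hΓ' : 0 < Real.Gamma (1 - α) := Real.Gamma_pos_of_pos (by linarith)
  have hsw := integrable_betaKer_smul hα0 hα1 (integrableOn_decay hρ φ)
  rw [(integrable_and_integral_rpow_smul_sub hα0 hα1 hρ φ).2, map_smul, map_smul,
    ← (besselJ n q α).integral_comp_comm (integrableOn_rpow_smul_decay hα1 hρ φ)]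
  have h1 : ∫ v in Ioi (0 : ℝ), besselJ n q α (v ^ (-α) • decay ρ φ v) =
      ∫ v in Ioi (0 : ℝ), (Real.Gamma α)⁻¹ • ∫ w in Ioi (0 : ℝ), betaKer α v w • decay ρ φ w := by
    refine setIntegral_congr_fun measurableSet_Ioi fun v hv => ?_
    have hv : (0 : ℝ) < v := hv
    rw [map_smul, besselJ_decay hα0 hρ φ hv, smul_comm, ← integral_smul]
    congr 1
    have h2 : ∀ w, betaKer α v w • decay ρ φ w =
        (Ioi v).indicator (fun w => v ^ (-α) • (w - v) ^ (α - 1) • decay ρ φ w) w := by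
      intro w
      by_cases hw : v < w
      · rw [betaKer, indicator_of_mem (show v ∈ Ioo 0 w from ⟨hv, hw⟩),
          indicator_of_mem (show w ∈ Ioi v from hw), mul_smul]
      · rw [betaKer, indicator_of_notMem (fun h => hw h.2), zero_smul,
          indicator_of_notMem (show w ∉ Ioi v from hw)]
    simp only [h2]
    rw [setIntegral_indicator measurableSet_Ioi, inter_eq_right.2 (Ioi_subset_Ioi hv.le)]
  -- After Fubini the integral in v is the Beta constant Γ(α)Γ(1-α), and the remaining integral of
  -- `decay` over the half-line recovers S_ρ φ.
  rw [h1, integral_smul, integral_integral_swap (f := fun v w => betaKer α v w • decay ρ φ w) hsw]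
  have h3 : ∫ w in Ioi (0 : ℝ), ∫ v in Ioi (0 : ℝ), betaKer α v w • decay ρ φ w =
      (Real.Gamma α * Real.Gamma (1 - α)) • heatS n q ρ φ := by
    rw [← integral_Ioi_decay hρ φ, ← integral_smul]
    refine setIntegral_congr_fun measurableSet_Ioi fun w hw => ?_
    rw [integral_smul_const, (integral_betaKer hα0 hα1 hw).2]
  rw [h3, smul_smul (Real.Gamma α)⁻¹, smul_smul α⁻¹, smul_smul (fracC α), fracC]
  have : α / Real.Gamma (1 - α) * (α⁻¹ * ((Real.Gamma α)⁻¹ *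
      (Real.Gamma α * Real.Gamma (1 - α)))) = 1 := by field_simp
  rw [this, one_smul]

/-- Since (Id - Δ)^α = (-Δ)^α + `compOp`, the density of φ as a Bessel potential is g + `compOp α
φ`, controlled by ‖φ‖ + ‖g‖. The identity is proved for S_ρ φ, where the formula for (Id - Δ)^α
converges absolutely, and ρ then tends to zero. -/
theorem IsFracLap.eq_besselJ {α : ℝ} (hα0 : 0 < α) (hα1 : α < 1) {φ g : LSp n q}
    (h : IsFracLap α φ g) : φ = besselJ n q α (g + compOp α φ) := by
  have key : ∀ ρ, 0 < ρ → heatS n q ρ φ = besselJ n q α (heatS n q ρ (g + compOp α φ)) := by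
    intro ρ hρ
    have h1 := h.clm hα0 (heatS n q ρ) fun r f => heatS_comm ρ r f
    have i0 := (integrable_and_integral_rpow_smul_sub hα0 hα1 hρ φ).1
    have i2 := integrableOn_compOp hα0 hα1 (heatS n q ρ φ)
    have t1 := (tendsto_integral_Ioi i0).const_smul (fracC α)
    have t2 := (tendsto_integral_Ioi i2).const_smul (fracC α)
    have t3 : Tendsto (fun ε => fracLapTrunc α ε (heatS n q ρ φ) +
        fracC α • ∫ r in Ioi ε, (r ^ (-α - 1) * (1 - Real.exp (-r))) •
          heatS n q (2 * r) (heatS n q ρ φ)) (𝓝[>] 0)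
        (𝓝 (heatS n q ρ g + compOp α (heatS n q ρ φ))) := Tendsto.add h1 t2
    -- Before the limit ε → 0 the truncated integrals add up exactly: (f - S f) + (1 - e^{-r}) S f =
    -- f - e^{-r} S f.
    have t4 : fracC α • ∫ r in Ioi (0 : ℝ), r ^ (-α - 1) •
        (heatS n q ρ φ - Real.exp (-r) • heatS n q (2 * r) (heatS n q ρ φ)) =
        heatS n q ρ g + compOp α (heatS n q ρ φ) := by
      refine tendsto_nhds_unique t1 (t3.congr' ?_)
      filter_upwards [self_mem_nhdsWithin] with ε hε
      have hε : 0 < ε := hε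
      rw [fracLapTrunc, ← fracC, ← smul_add, ← integral_add
        (integrableOn_fracLap hα0 hε _) (i2.mono_set (Ioi_subset_Ioi hε.le))]
      congr 2
      ext1 r
      module
    rw [map_add, ← compOp_heatS hα0 hα1, ← t4, besselJ_integral_sub hα0 hα1 hρ]
  have t1 := tendsto_heatS φ
  have t2 := ((besselJ n q α).continuous.tendsto _).comp (tendsto_heatS (g + compOp α φ))
  refine tendsto_nhds_unique t1 (t2.congr' ?_)
  filter_upwards [self_mem_nhdsWithin] with ρ hρ
  exact (key ρ hρ).symm

end Bessel

/-! ### Estimates in Bessel potential spaces -/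

section BesselEst

variable {n : ℕ} {q : ℝ≥0∞} [Fact (1 ≤ q)] [Fact (q ≠ ⊤)]

open BesselSp

theorem Order.lt_one (α : Order) : (α : ℝ) < 1 := by linarith [α.2.2]

theorem norm_incl_le {α : Order} (φ : BesselSp n q α) : ‖incl φ‖ ≤ ‖φ‖ := by
  rw [BesselSp.norm_def]
  exact le_add_of_nonneg_right (norm_nonneg _)

theorem incl_injective {α : Order} : Function.Injective (incl : BesselSp n q α → LSp n q) :=
  Subtype.coe_injective

variable (n q) in
theorem exists_eq_besselJ (α : Order) :
    ∃ C, 0 ≤ C ∧ ∀ φ : BesselSp n q α, ∃ h, incl φ = besselJ n q α h ∧ ‖h‖ ≤ C * ‖φ‖ := by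
  obtain ⟨C, hC, h⟩ := norm_compOp_le (n := n) (q := q) α.2.1 (Order.lt_one α)
  refine ⟨1 + C, by positivity, fun φ =>
    ⟨_, (isFracLap φ).eq_besselJ α.2.1 (Order.lt_one α), ?_⟩⟩
  refine (norm_add_le _ _).trans ?_
  have h1 := h (inclₗ φ)
  rw [BesselSp.norm_def]
  have h2 := norm_nonneg (inclₗ φ)
  have h3 : 0 ≤ C * ‖fracLap φ‖ := by positivity
  linarith

theorem norm_clm_besselJ_le_of_bounds {α c ρ A B : ℝ} (hα : 0 < α) (hc : α < c) (hρ : 0 < ρ)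
    {V : Type*} [NormedAddCommGroup V] [NormedSpace ℝ V] [CompleteSpace V]
    (L : LSp n q →L[ℝ] V) (f : LSp n q)
    (h1 : ∀ r, 0 < r → r ≤ ρ → ‖L (heatS n q (2 * r) f)‖ ≤ A)
    (h2 : ∀ r, ρ < r → ‖L (heatS n q (2 * r) f)‖ ≤ B * r ^ (-c)) :
    ‖L (besselJ n q α f)‖ ≤
      (Real.Gamma α)⁻¹ * (A * (ρ ^ α / α) + B * (ρ ^ (α - c) / (c - α))) := by
  refine (norm_clm_besselJ_le hα L f).trans ?_
  refine mul_le_mul_of_nonneg_left ?_ (inv_nonneg.2 (Real.Gamma_pos_of_pos hα).le)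
  have hA : 0 ≤ A := (norm_nonneg _).trans (h1 ρ hρ le_rfl)
  have e : α - c = -(c - α) := by ring
  rw [e]
  have hm : AEStronglyMeasurable (fun r : ℝ => (r ^ (α - 1) * Real.exp (-r)) •
      L (heatS n q (2 * r) f)) (volume.restrict (Ioi 0)) :=
    (integrableOn_bessel_weight hα).aestronglyMeasurable.smul
      (L.continuous.comp_aestronglyMeasurable (aestronglyMeasurable_heatS_two_mul f))
  have hw : ∀ r, 0 < r → r ^ (α - 1) * Real.exp (-r) ≤ r ^ (α - 1) := fun r hr =>
    mul_le_of_le_one_right (by positivity) (Real.exp_le_one_iff.2 (by linarith))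
  refine (integrableOn_Ioi_of_rpow_bounds hα (by linarith) hρ hm ?_ ?_).2
  · intro r hr hrρ
    rw [norm_smul, Real.norm_of_nonneg (by positivity), mul_comm A]
    exact mul_le_mul (hw r hr) (h1 r hr hrρ) (norm_nonneg _) (by positivity)
  · intro r hr
    have hr0 : 0 < r := hρ.trans hr
    rw [norm_smul, Real.norm_of_nonneg (by positivity)]
    calc _ ≤ r ^ (α - 1) * (B * r ^ (-c)) :=
          mul_le_mul (hw r hr0) (h2 r hr) (norm_nonneg _) (by positivity)
      _ = B * (r ^ (α - 1) * r ^ (-c)) := by ring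
      _ = _ := by rw [← Real.rpow_add hr0]; ring_nf

variable (n q) in
-- With φ the Bessel potential of h, the integral over r is cut at |y|². Below the cut, τ_y S_{2r}h
-- - S_{2r}h is at most 2‖h‖; above it, smoothing gains |y|/√r, and the tail converges because α <
-- 1/2. Both parts are of order |y|^{2α}.
theorem exists_nikBound_incl (α : Order) :
    ∃ C, 0 ≤ C ∧ ∀ φ : BesselSp n q α, NikBound α (C * ‖φ‖) (incl φ) := by
  obtain ⟨C, hC, h⟩ := exists_eq_besselJ n q α
  have hα := α.2.1
  have hα2 := α.2.2
  have hs := two_le_shiftC n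
  have hΓ := Real.Gamma_pos_of_pos hα
  set D := (Real.Gamma α)⁻¹ * (2 * (1 / α) + shiftC n * (1 / (1 / 2 - α))) with hD
  have hD0 : 0 ≤ D := by
    have : 0 < 1 / 2 - (α : ℝ) := by linarith
    positivity
  refine ⟨D * C, by positivity, fun φ y => ?_⟩
  obtain ⟨g, hg, hgn⟩ := h φ
  rcases eq_or_ne y 0 with rfl | hy
  · rw [transl_zero, sub_self, norm_zero]; positivity
  have hy : 0 < ‖y‖ := norm_pos_iff.2 hy
  have key := norm_clm_besselJ_le_of_bounds (α := α) (c := 1 / 2) (ρ := ‖y‖ ^ 2)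
    (A := 2 * ‖g‖) (B := shiftC n * ‖y‖ * ‖g‖) hα hα2 (by positivity)
    (transl q y - ContinuousLinearMap.id ℝ _) g (fun r _ _ => ?_) (fun r hr => ?_)
  · rw [← hg] at key
    refine key.trans ?_
    have e1 : (‖y‖ ^ 2) ^ (α : ℝ) = ‖y‖ ^ (2 * (α : ℝ)) := by
      rw [← Real.rpow_natCast, ← Real.rpow_mul hy.le]; norm_num
    have e2 : ‖y‖ * (‖y‖ ^ 2) ^ ((α : ℝ) - 1 / 2) = ‖y‖ ^ (2 * (α : ℝ)) := by
      rw [← Real.rpow_natCast, ← Real.rpow_mul hy.le, ← Real.rpow_one_add' hy.le]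
      · congr 1; push_cast; ring
      · push_cast
        have : 1 + 2 * ((α : ℝ) - 1 / 2) = 2 * α := by ring
        rw [this]; positivity
    calc _ = D * ‖g‖ * ‖y‖ ^ (2 * (α : ℝ)) := by
          rw [hD]
          have : shiftC n * ‖y‖ * ‖g‖ * ((‖y‖ ^ 2) ^ ((α : ℝ) - 1 / 2) / (1 / 2 - α)) =
            shiftC n * ‖g‖ / (1 / 2 - α) * (‖y‖ * (‖y‖ ^ 2) ^ ((α : ℝ) - 1 / 2)) := by ring
          rw [this, e1, e2]; ring
      _ ≤ D * (C * ‖φ‖) * ‖y‖ ^ (2 * (α : ℝ)) := by gcongr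
      _ = _ := by ring
  · rw [sub_apply, ContinuousLinearMap.id_apply]
    refine (norm_sub_le _ _).trans ?_
    rw [norm_transl]
    linarith [norm_heatS_le (2 * r) g]
  · have hr0 : 0 < r := lt_trans (by positivity) hr
    rw [sub_apply, ContinuousLinearMap.id_apply]
    refine (norm_transl_heatS_sub_le (by positivity) y g).trans ?_
    have : ‖y‖ / √(2 * r) ≤ ‖y‖ * r ^ (-(1 / 2) : ℝ) := by
      rw [Real.rpow_neg hr0.le, ← Real.sqrt_eq_rpow, ← div_eq_mul_inv]
      gcongr
      linarith
    calc _ ≤ shiftC n * (‖y‖ * r ^ (-(1 / 2) : ℝ)) * ‖g‖ := by gcongr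
      _ = _ := by ring

variable (n q) in
theorem exists_norm_heatG_incl_le (α : Order) :
    ∃ C, 0 ≤ C ∧ ∀ (φ : BesselSp n q α) (t : ℝ), 0 < t →
      ‖heatG n q t (incl φ)‖ ≤ C * ‖φ‖ * t ^ ((α : ℝ) - 1) := by
  obtain ⟨C, hC, h⟩ := exists_nikBound_incl n q α
  have hd := dotC_pos n
  refine ⟨2 * dotC n ^ 2 * C, by positivity, fun φ t ht => ?_⟩
  refine ((h φ).norm_heatG_le α.2.1.le (Order.lt_one α).le (by positivity) ht).trans (le_of_eq ?_)
  ring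

variable (n q) in
theorem exists_norm_heatS_incl_sub_le (α : Order) :
    ∃ C, 0 ≤ C ∧ ∀ (φ : BesselSp n q α) (t : ℝ), 0 < t →
      ‖heatS n q t (incl φ) - incl φ‖ ≤ C * ‖φ‖ * t ^ (α : ℝ) := by
  obtain ⟨C, hC, h⟩ := exists_nikBound_incl n q α
  have hd := dotC_pos n
  refine ⟨dotC n * C, by positivity, fun φ t ht => ?_⟩
  refine ((h φ).norm_heatS_sub_le α.2.1.le (Order.lt_one α).le (by positivity) ht).trans
    (le_of_eq ?_)
  ring

variable (n q) in
/-- The Sobolev embedding of a Bessel potential space into the bounded functions. -/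
theorem exists_ae_abs_incl_le (α : Order) (hα : (n : ℝ) / (2 * q.toReal) < α) :
    ∃ C, 0 ≤ C ∧ ∀ φ : BesselSp n q α, ∀ᵐ ξ, |incl φ ξ| ≤ C * ‖φ‖ := by
  obtain ⟨C, hC, h⟩ := exists_eq_besselJ n q α
  have hα0 := α.2.1
  have hΓ := Real.Gamma_pos_of_pos hα0
  set ν := (n : ℝ) / (2 * q.toReal) with hν
  have hν0 : 0 ≤ ν := by positivity
  -- The sup bound on S_{2r} costs r^{-ν}, turning the weight of Γ(α) into that of Γ(α - ν), finite
  -- because ν < α.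
  have hw := integrableOn_bessel_weight (α := (α : ℝ) - ν) (by linarith)
  refine ⟨(Real.Gamma α)⁻¹ * Real.Gamma ((α : ℝ) - ν) * C, ?_, fun φ => ?_⟩
  · have := Real.Gamma_pos_of_pos (s := (α : ℝ) - ν) (by linarith)
    positivity
  obtain ⟨g, hg, hgn⟩ := h φ
  have hi := integrableOn_weight_smul (integrableOn_bessel_weight hα0)
    (aestronglyMeasurable_heatS_two_mul g) fun r _ => norm_heatS_le (2 * r) g
  have key := coeFn_integral (K := fun (r : ℝ) ξ => (r ^ ((α : ℝ) - 1) * Real.exp (-r)) *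
    ∫ y, gaussKernel n (2 * r) y * g (ξ - y)) hi ?_ ?_
  · rw [hg, besselJ_apply hα0]
    filter_upwards [key, Lp.coeFn_smul (Real.Gamma α)⁻¹
      (∫ r in Ioi (0 : ℝ), (r ^ ((α : ℝ) - 1) * Real.exp (-r)) • heatS n q (2 * r) g)]
      with ξ h1 h2
    rw [h2, Pi.smul_apply, h1, smul_eq_mul, abs_mul, abs_of_pos (inv_pos.2 hΓ), mul_assoc,
      mul_assoc]
    refine mul_le_mul_of_nonneg_left ?_ (inv_nonneg.2 hΓ.le)
    rw [← integral_bessel_weight (by linarith : 0 < (α : ℝ) - ν), ← integral_mul_const,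
      ← Real.norm_eq_abs]
    refine norm_integral_le_of_norm_le (hw.mul_const _) ?_
    filter_upwards [ae_restrict_mem measurableSet_Ioi] with r hr
    have hr : (0 : ℝ) < r := hr
    rw [norm_mul, Real.norm_of_nonneg (by positivity), Real.norm_eq_abs]
    have h3 := abs_integral_gaussKernel_mul_le (t := 2 * r) (by positivity) g ξ
    rw [neg_div, ← hν] at h3
    have h4 : (2 * r) ^ (-ν) ≤ r ^ (-ν) :=
      Real.rpow_le_rpow_of_nonpos hr (by linarith) (by linarith)
    calc _ ≤ r ^ ((α : ℝ) - 1) * Real.exp (-r) * (r ^ (-ν) * (C * ‖φ‖)) := by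
          gcongr
          exact h3.trans (by gcongr)
      _ = r ^ ((α : ℝ) - 1) * r ^ (-ν) * Real.exp (-r) * (C * ‖φ‖) := by ring
      _ = _ := by rw [← Real.rpow_add hr]; ring_nf
  · refine AEStronglyMeasurable.mul ?_ ?_
    · exact Measurable.aestronglyMeasurable (by fun_prop)
    · have hm : StronglyMeasurable fun z : (ℝ × Space n) × Space n =>
          gaussKernel n (2 * z.1.1) z.2 * g (z.1.2 - z.2) := by
        refine StronglyMeasurable.mul ?_ ?_
        · have : Measurable fun z : (ℝ × Space n) × Space n => gaussKernel n (2 * z.1.1) z.2 := by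
            unfold gaussKernel; fun_prop
          exact this.stronglyMeasurable
        · exact (Lp.stronglyMeasurable g).comp_measurable (by fun_prop)
      exact hm.integral_prod_right'.aestronglyMeasurable
  · filter_upwards [ae_restrict_mem measurableSet_Ioi] with r hr
    have hr : (0 : ℝ) < r := hr
    filter_upwards [Lp.coeFn_smul (r ^ ((α : ℝ) - 1) * Real.exp (-r)) (heatS n q (2 * r) g),
      coeFn_convLp (integrable_gaussKernel n (t := 2 * r) (by positivity)) (ae_eq_refl g)]
      with ξ h1 h2
    rw [h1, Pi.smul_apply, heatS_of_pos (by positivity), h2, smul_eq_mul]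

/-- A criterion for membership of `𝓑_{α,q}`. -/
theorem exists_incl_eq {α : Order} {a A : ℝ} (ha : (α : ℝ) < a) {f : LSp n q}
    (hf : ∀ r, 0 < r → ‖heatS n q (2 * r) f - f‖ ≤ A * r ^ a) :
    ∃ φ : BesselSp n q α, incl φ = f ∧ ∀ ρ, 0 < ρ →
      ‖φ‖ ≤ ‖f‖ + fracC α *
        (A * (ρ ^ (a - α) / (a - α)) + 2 * ‖f‖ * (ρ ^ (-(α : ℝ)) / α)) := by
  have hα0 := α.2.1
  have hα1 := Order.lt_one α
  -- The rate a > α makes the Balakrishnan integral absolutely convergent at zero, so (-Δ)^α f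
  -- exists; `IsFracLap.eq_besselJ` then supplies the Bessel representation.
  set F : ℝ → LSp n q := fun r => r ^ (-(α : ℝ) - 1) • (f - heatS n q (2 * r) f) with hF
  have hm : AEStronglyMeasurable F (volume.restrict (Ioi 0)) :=
    (aestronglyMeasurable_rpow _).smul
      (aestronglyMeasurable_const.sub (aestronglyMeasurable_heatS_two_mul f))
  have key : ∀ ρ, 0 < ρ → IntegrableOn F (Ioi 0) ∧
      ∫ r in Ioi 0, ‖F r‖ ≤ A * (ρ ^ (a - α) / (a - α)) + 2 * ‖f‖ * (ρ ^ (-(α : ℝ)) / α) := by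
    intro ρ hρ
    refine integrableOn_Ioi_of_rpow_bounds (by linarith) hα0 hρ hm ?_ ?_
    · intro r hr _
      rw [norm_smul, Real.norm_of_nonneg (by positivity), norm_sub_rev]
      calc _ ≤ r ^ (-(α : ℝ) - 1) * (A * r ^ a) := by gcongr; exact hf r hr
        _ = A * (r ^ (-(α : ℝ) - 1) * r ^ a) := by ring
        _ = _ := by rw [← Real.rpow_add hr]; ring_nf
    · intro r hr
      have hr0 : 0 < r := hρ.trans hr
      rw [norm_smul, Real.norm_of_nonneg (by positivity), mul_comm]
      gcongr
      refine (norm_sub_le _ _).trans ?_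
      linarith [norm_heatS_le (2 * r) f]
  have hlap : IsFracLap α f (fracC α • ∫ r in Ioi 0, F r) :=
    (tendsto_integral_Ioi (key 1 one_pos).1).const_smul (fracC α)
  refine ⟨⟨f, ⟨_, hlap.eq_besselJ hα0 hα1⟩, _, hlap⟩, rfl, fun ρ hρ => ?_⟩
  set φ : BesselSp n q α := ⟨f, ⟨_, hlap.eq_besselJ hα0 hα1⟩, _, hlap⟩
  have h1 : fracLap φ = fracC α • ∫ r in Ioi 0, F r := (isFracLap φ).unique hlap
  have hc := fracC_pos hα0 hα1
  rw [BesselSp.norm_def, h1, norm_smul, Real.norm_of_nonneg hc.le]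
  refine add_le_add le_rfl (mul_le_mul_of_nonneg_left ?_ hc.le)
  exact (norm_integral_le_integral_norm _).trans (key ρ hρ).2

theorem NikBound.exists_incl_eq {α : Order} {b M : ℝ} {f : LSp n q} (h : NikBound b M f)
    (hb : (α : ℝ) < b) (hb1 : b ≤ 1) (hM : 0 ≤ M) : ∃ φ : BesselSp n q α, incl φ = f := by
  obtain ⟨φ, h1, _⟩ := HeatRough.exists_incl_eq (α := α) (a := b) (A := dotC n * M * 2 ^ b) hb
    (f := f) fun r hr => by
      refine (h.norm_heatS_sub_le (α.2.1.trans hb).le hb1 hM (by positivity)).trans (le_of_eq ?_)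
      rw [Real.mul_rpow (by norm_num) hr.le]; ring
  exact ⟨φ, h1⟩

/-! ### Operators commuting with convolutions -/

/-- `L` commutes with all convolutions. -/
def Commutes (L : LSp n q →L[ℝ] LSp n q) : Prop :=
  ∀ k f, L (convLp q k f) = convLp q k (L f)

theorem Commutes.heatS {L : LSp n q →L[ℝ] LSp n q} (hL : Commutes L) (r : ℝ) (f : LSp n q) :
    L (HeatRough.heatS n q r f) = HeatRough.heatS n q r (L f) := by
  by_cases hr : 0 < r
  · rw [heatS_of_pos hr, hL]
  · simp [HeatRough.heatS, hr]

theorem commutes_heatS (t : ℝ) : Commutes (heatS n q t) := fun k f => heatS_convLp t k f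

theorem commutes_heatG (t : ℝ) : Commutes (heatG n q t) := fun k f => convLp_comm _ k f

theorem Commutes.sub {L L' : LSp n q →L[ℝ] LSp n q} (h : Commutes L) (h' : Commutes L') :
    Commutes (L - L') := fun k f => by
  rw [sub_apply, sub_apply, h, h', map_sub]

theorem Commutes.smul {L : LSp n q →L[ℝ] LSp n q} (h : Commutes L) (c : ℝ) :
    Commutes (c • L) := fun k f => by
  rw [smul_apply, smul_apply, h, map_smul]

theorem Commutes.comp {L L' : LSp n q →L[ℝ] LSp n q} (h : Commutes L) (h' : Commutes L') :
    Commutes (L.comp L') := fun k f => by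
  rw [ContinuousLinearMap.comp_apply, h', h, ContinuousLinearMap.comp_apply]

theorem commutes_zero : Commutes (0 : LSp n q →L[ℝ] LSp n q) := fun k f => by simp

theorem commutes_integral {Y : Type*} [MeasurableSpace Y] {ν : Measure Y}
    {F : Y → LSp n q →L[ℝ] LSp n q} (h : ∀ y, Commutes (F y)) : Commutes (∫ y, F y ∂ν) := by
  by_cases hF : Integrable F ν
  · intro k f
    rw [ContinuousLinearMap.integral_apply hF, ContinuousLinearMap.integral_apply hF,
      ← (convLp q k).integral_comp_comm (hF.apply_continuousLinearMap f)]
    simp only [h _ k]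
  · rw [integral_undef hF]; exact commutes_zero

theorem commutes_heatOp (y : ℝ → ℝ → ℝ) (t s : ℝ) : Commutes (heatOp (heatS n q) y t s) := by
  refine ((commutes_heatS _).smul _).sub ?_
  have h : ∀ r, Commutes ((y t s - y (t - r) s) • gen (heatS n q) r) := fun r =>
    ((commutes_heatG _).comp (commutes_heatS _)).smul _
  rw [intervalIntegral]
  exact (commutes_integral h).sub (commutes_integral h)

theorem Commutes.mem {L : LSp n q →L[ℝ] LSp n q} (hL : Commutes L) {α : Order} :
    ∀ φ ∈ besselSubmodule n q α, L.toLinearMap φ ∈ besselSubmodule n q α := by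
  rintro φ ⟨⟨f, hf⟩, g, hg⟩
  exact ⟨⟨L f, by rw [hf]; exact hL _ f⟩, L g, hg.clm α.2.1 L hL.heatS⟩

/-- The restriction to `𝓑_{α,q}` of an operator commuting with convolutions, as a linear map. -/
def liftBₗ {α : Order} (L : LSp n q →L[ℝ] LSp n q) (hL : Commutes L) :
    BesselSp n q α →ₗ[ℝ] BesselSp n q α :=
  LinearMap.restrict L.toLinearMap hL.mem

/-- The restriction to `𝓑_{α,q}` of an operator commuting with convolutions. -/
def liftB {α : Order} (L : LSp n q →L[ℝ] LSp n q) (hL : Commutes L) :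
    BesselSp n q α →L[ℝ] BesselSp n q α :=
  LinearMap.mkContinuous (liftBₗ L hL) ‖L‖ (fun φ => by
    rw [BesselSp.norm_def, BesselSp.norm_def, mul_add]
    have h : fracLap (liftBₗ L hL φ) = L (fracLap φ) :=
      IsFracLap.unique (isFracLap _) ((isFracLap φ).clm α.2.1 L hL.heatS)
    rw [h]
    exact add_le_add (L.le_opNorm _) (L.le_opNorm _))

theorem norm_liftB_le {α : Order} {L : LSp n q →L[ℝ] LSp n q} (hL : Commutes L) :
    ‖(liftB L hL : BesselSp n q α →L[ℝ] BesselSp n q α)‖ ≤ ‖L‖ :=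
  LinearMap.mkContinuous_norm_le _ (norm_nonneg _) _

theorem liftB_sub {α : Order} {L L' : LSp n q →L[ℝ] LSp n q} (hL : Commutes L)
    (hL' : Commutes L') : (liftB L hL - liftB L' hL' : BesselSp n q α →L[ℝ] BesselSp n q α) =
      liftB (L - L') (hL.sub hL') := rfl

/-- An operator commuting with convolutions commutes with (-Δ)^α, so its L^p operator norm controls
both terms of the 𝓑_{α,p} norm. Applied to differences of operators, this transfers continuity as
well. -/
theorem exists_restrictsTo {p : ℕ} [Fact (2 ≤ p)] (α : Order) {T μ : ℝ}
    {Z : ℝ → ℝ → (LSp n p →L[ℝ] LSp n p)} (hZ : HolderC2 T μ Z) (hc : ∀ t s, Commutes (Z t s)) :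
    ∃ Y : ℝ → ℝ → (BesselSp n p α →L[ℝ] BesselSp n p α),
      HeatOps.RestrictsTo T Z Y ∧ HolderC2 T μ Y := by
  obtain ⟨h1, C, h2⟩ := hZ
  refine ⟨fun t s => liftB (Z t s) (hc t s), fun s t _ _ _ φ => rfl, ?_, C, fun s t hs hst ht =>
    (norm_liftB_le _).trans (h2 s t hs hst ht)⟩
  intro z hz
  rw [ContinuousWithinAt, tendsto_iff_norm_sub_tendsto_zero]
  refine squeeze_zero (fun _ => norm_nonneg _) (fun w => ?_)
    (tendsto_iff_norm_sub_tendsto_zero.1 (h1 z hz))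
  rw [liftB_sub]
  exact norm_liftB_le _

/-! ### Lipschitz functions of compact support -/

/-- `φ` is a Lipschitz function of compact support. -/
structure IsLip (φ : Space n → ℝ) : Prop where
  lip : ∃ K, LipschitzWith K φ
  compact : HasCompactSupport φ

theorem IsTest.isLip {φ : Space n → ℝ} (h : IsTest φ) : IsLip φ :=
  ⟨(h.smooth.of_le (by exact_mod_cast le_top)).lipschitzWith_of_hasCompactSupport h.compact
    one_ne_zero, h.compact⟩

theorem IsLip.continuous {φ : Space n → ℝ} (h : IsLip φ) : Continuous φ :=
  h.lip.choose_spec.continuous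

theorem IsLip.memLp {φ : Space n → ℝ} (h : IsLip φ) (q : ℝ≥0∞) : MemLp φ q volume :=
  h.continuous.memLp_of_hasCompactSupport h.compact

theorem IsLip.exists_bound {φ : Space n → ℝ} (h : IsLip φ) : ∃ M, 0 ≤ M ∧ ∀ ξ, |φ ξ| ≤ M := by
  obtain ⟨M, hM⟩ := h.compact.exists_bound_of_continuous h.continuous
  exact ⟨M, (norm_nonneg _).trans (hM 0), hM⟩

theorem IsLip.exists_nikBound {φ : Space n → ℝ} (h : IsLip φ) :
    ∃ M, 0 ≤ M ∧ NikBound (1 / 2) M ((h.memLp q).toLp φ) := by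
  obtain ⟨K, hK⟩ := h.lip
  set f : LSp n q := (h.memLp q).toLp φ with hf
  obtain ⟨R, hR⟩ := h.compact.isCompact.isBounded.subset_closedBall (0 : Space n)
  set E := Metric.closedBall (0 : Space n) (R + 1) with hE
  have hEv : volume E ≠ ⊤ := measure_closedBall_lt_top.ne
  have hq0 : q ≠ 0 := (zero_lt_one.trans_le (Fact.out : 1 ≤ q)).ne'
  set D := (volume E).toReal ^ (1 / q.toReal) with hD
  refine ⟨K * D + 2 * ‖f‖, by positivity, fun y => ?_⟩
  have e1 : (2 * (1 / 2) : ℝ) = 1 := by norm_num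
  rw [e1, Real.rpow_one]
  -- For |y| ≤ 1 the increment is at most K|y| and lives in a ball of radius R + 1; for larger y the
  -- bound 2‖f‖ is absorbed by |y|.
  rcases le_or_gt ‖y‖ 1 with hy | hy
  · have hsub : transl q y f - f =ᵐ[volume] fun ξ => φ (ξ - y) - φ ξ := by
      have h1 := (measurePreserving_sub_right volume y).quasiMeasurePreserving.ae_eq_comp
        (h.memLp q).coeFn_toLp
      filter_upwards [Lp.coeFn_sub (transl q y f) f, coeFn_transl y f, (h.memLp q).coeFn_toLp, h1]
        with ξ k1 k2 k3 k4
      simp only [Function.comp_apply] at k4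
      rw [k1, Pi.sub_apply, k2, k3, k4]
    have hb : ‖transl q y f - f‖ ≤ ‖indicatorConstLp q measurableSet_closedBall hEv
        ((K : ℝ) * ‖y‖)‖ := by
      refine Lp.norm_le_norm_of_ae_le ?_
      filter_upwards [hsub, indicatorConstLp_coeFn (p := q) (hs := measurableSet_closedBall)
        (hμs := hEv) (c := (K : ℝ) * ‖y‖)] with ξ k1 k2
      rw [k1, k2]
      by_cases hξ : ξ ∈ E
      · rw [indicator_of_mem hξ, Real.norm_of_nonneg (by positivity : 0 ≤ (K : ℝ) * ‖y‖),
          ← dist_eq_norm]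
        refine (hK.dist_le_mul _ _).trans ?_
        rw [dist_eq_norm, sub_sub_cancel_left, norm_neg]
      · rw [indicator_of_notMem hξ, norm_zero]
        have hξ' : R + 1 < ‖ξ‖ := by simpa [hE] using hξ
        have z1 : φ ξ = 0 := by
          by_contra hne
          have := hR (subset_tsupport _ (Function.mem_support.2 hne))
          rw [mem_closedBall_zero_iff] at this
          linarith
        have z2 : φ (ξ - y) = 0 := by
          by_contra hne
          have := hR (subset_tsupport _ (Function.mem_support.2 hne))
          rw [mem_closedBall_zero_iff] at this
          linarith [norm_sub_norm_le ξ y]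
        rw [z1, z2, sub_zero, norm_zero]
    rw [norm_indicatorConstLp hq0 Fact.out, Real.norm_of_nonneg (by positivity)] at hb
    refine hb.trans ?_
    change (K : ℝ) * ‖y‖ * D ≤ _
    have : 0 ≤ 2 * ‖f‖ * ‖y‖ := by positivity
    linarith
  · refine (norm_sub_le _ _).trans ?_
    rw [norm_transl]
    have h1 : 0 ≤ K * D * ‖y‖ := by positivity
    have h2 : ‖f‖ * 1 ≤ ‖f‖ * ‖y‖ := by gcongr
    linarith

theorem IsLip.exists_incl_eq {φ : Space n → ℝ} (h : IsLip φ) (α : Order) :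
    ∃ φ' : BesselSp n q α, incl φ' = (h.memLp q).toLp φ := by
  obtain ⟨M, hM, hN⟩ := h.exists_nikBound (q := q)
  exact hN.exists_incl_eq α.2.2 (by norm_num) hM

/-! ### Integrating the generator from zero -/

theorem intervalIntegrable_heatG {θ M r : ℝ} (hθ : 0 < θ) (hr : 0 ≤ r) {f : LSp n q}
    (hf : ∀ v, 0 < v → ‖heatG n q v f‖ ≤ M * v ^ (θ - 1)) :
    IntervalIntegrable (fun v => heatG n q v f) volume 0 r :=
  intervalIntegrable_of_rpow_bound hθ hr
    (((continuousOn_heatG.mono fun _ hv => hv.1).clm_apply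
      continuousOn_const).aestronglyMeasurable measurableSet_Ioc) fun v hv _ => hf v hv

/-- An integrable bound r^{θ-1} together with strong continuity at zero extends the fundamental
theorem of calculus down to time zero. -/
theorem integral_heatG {θ M r : ℝ} (hθ : 0 < θ) (hr : 0 ≤ r) {f : LSp n q}
    (hf : ∀ v, 0 < v → ‖heatG n q v f‖ ≤ M * v ^ (θ - 1)) :
    ∫ v in (0 : ℝ)..r, heatG n q v f = heatS n q r f - f := by
  rcases hr.eq_or_lt with rfl | hr
  · simp [heatS_zero]
  refine intervalIntegral.integral_eq_sub_of_hasDerivAt_of_tendsto hr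
    (fun v hv => hasDerivAt_heatS hv.1 f) (intervalIntegrable_heatG hθ hr.le hf)
    (tendsto_heatS f) ?_
  exact (hasDerivAt_heatS hr f).continuousAt.continuousWithinAt

end BesselEst

/-! ### Drivers built on a path and its Lévy area -/

/-- The projection of `ℝ` onto `[0, T]`. -/
def clamp (T t : ℝ) : ℝ := max 0 (min T t)

theorem clamp_eq {T t : ℝ} (h0 : 0 ≤ t) (hT : t ≤ T) : clamp T t = t := by
  rw [clamp, min_eq_right hT, max_eq_right h0]

/-- The extension to the plane of a function on the simplex. -/
def extend (T : ℝ) (y : ℝ → ℝ → ℝ) (t s : ℝ) : ℝ := y (clamp T t) (min (clamp T s) (clamp T t))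

theorem extend_eq {T : ℝ} {y : ℝ → ℝ → ℝ} {s t : ℝ} (hs : 0 ≤ s) (hst : s ≤ t) (ht : t ≤ T) :
    extend T y t s = y t s := by
  rw [extend, clamp_eq (hs.trans hst) ht, clamp_eq hs (hst.trans ht), min_eq_left hst]

theorem continuous_extend {T : ℝ} (hT : 0 ≤ T) {y : ℝ → ℝ → ℝ}
    (hy : ContinuousOn (fun z : ℝ × ℝ => y z.1 z.2) (simplex T)) :
    Continuous fun z : ℝ × ℝ => extend T y z.1 z.2 := by
  refine hy.comp_continuous
    (f := fun z : ℝ × ℝ => (clamp T z.1, min (clamp T z.2) (clamp T z.1))) ?_ fun z => ?_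
  · unfold clamp; fun_prop
  · have h : ∀ t, 0 ≤ clamp T t ∧ clamp T t ≤ T := fun t =>
      ⟨le_max_left _ _, max_le hT (min_le_left _ _)⟩
    exact ⟨le_min (h _).1 (h _).1, min_le_right _ _, (h _).2⟩

theorem continuousOn_delta1 {T : ℝ} {x : ℝ → ℝ} (hx : ContinuousOn x (Icc 0 T)) :
    ContinuousOn (fun z : ℝ × ℝ => delta1 x z.1 z.2) (simplex T) :=
  (hx.comp continuous_fst.continuousOn fun _ hz => ⟨hz.1.trans hz.2.1, hz.2.2⟩).sub
    (hx.comp continuous_snd.continuousOn fun _ hz => ⟨hz.1, hz.2.1.trans hz.2.2⟩)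

theorem HolderC1.exists_abs_delta1_le {T μ : ℝ} (hμ : 0 < μ) {x : ℝ → ℝ} (hx : HolderC1 T μ x) :
    ∃ C, 0 ≤ C ∧ ∀ s t, 0 ≤ s → s ≤ t → t ≤ T → |delta1 x t s| ≤ C * (t - s) ^ μ := by
  obtain ⟨C, hC⟩ := hx.2
  refine ⟨|C|, abs_nonneg _, fun s t hs hst ht => ?_⟩
  rcases hst.eq_or_lt with rfl | hst
  · simp [delta1, Real.zero_rpow hμ.ne']
  · have : 0 < t - s := by linarith
    exact (hC s t hs hst ht).trans
      (mul_le_mul_of_nonneg_right (le_abs_self C) (by positivity))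

theorem isDriver_path {T γ : ℝ} (hT : 0 ≤ T) (hγ : 0 < γ) {x : ℝ → ℝ} (hx : HolderC1 T γ x) :
    ∃ C, IsDriver T γ γ C (extend T (delta1 x)) := by
  obtain ⟨C, hC0, hC⟩ := hx.exists_abs_delta1_le hγ
  refine ⟨C, hC0, hγ, le_rfl, continuous_extend hT (continuousOn_delta1 hx.1),
    fun s t hs hst ht => ?_, fun s u t hs hsu hut ht => ?_⟩
  · rw [extend_eq hs hst ht]; exact hC s t hs hst ht
  · rw [extend_eq hs (hsu.trans hut) ht, extend_eq hs hsu (hut.trans ht), sub_self, Real.rpow_zero,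
      mul_one]
    have := hC u t (hs.trans hsu) hut ht
    rwa [delta1, delta1, sub_sub_sub_cancel_right]

/-- By Chen's relation, y_{ts} - y_{us} = y_{tu} + (δx)_{tu}(δx')_{us}. Each term contains a factor
(t-u)^γ, and what is left is at most (t-s)^γ. -/
theorem isDriver_area {T γ : ℝ} (hT : 0 ≤ T) (hγ : 0 < γ) {x x' : ℝ → ℝ} {y : ℝ → ℝ → ℝ}
    (hx : HolderC1 T γ x) (hx' : HolderC1 T γ x') (hy : HolderC2 T (2 * γ) y)
    (hChen : ∀ s u t : ℝ, 0 ≤ s → s ≤ u → u ≤ t → t ≤ T →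
      delta2 y t u s = delta1 x t u * delta1 x' u s) :
    ∃ C, IsDriver T γ (2 * γ) C (extend T y) := by
  obtain ⟨C, hC0, hC⟩ := hx.exists_abs_delta1_le hγ
  obtain ⟨C', hC0', hC'⟩ := hx'.exists_abs_delta1_le hγ
  obtain ⟨D, hD⟩ := hy.2
  have hb : ∀ s t, 0 ≤ s → s ≤ t → t ≤ T → |y t s| ≤ |D| * (t - s) ^ (2 * γ) := by
    intro s t hs hst ht
    rcases hst.eq_or_lt with rfl | hst
    -- The Hölder bound is assumed only for s < t; on the diagonal Chen's relation itself forces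
    -- y_{ss} = 0.
    · have h := hChen s s s hs le_rfl le_rfl ht
      simp only [delta2, delta1, sub_self, mul_zero, zero_sub, neg_eq_zero] at h
      rw [h, abs_zero]; positivity
    · have : 0 < t - s := by linarith
      exact (hD s t hs hst ht).trans (mul_le_mul_of_nonneg_right (le_abs_self D) (by positivity))
  have hCC : 0 ≤ C * C' := by positivity
  refine ⟨|D| + C * C', by positivity, hγ, by linarith, continuous_extend hT hy.1,
    fun s t hs hst ht => ?_, fun s u t hs hsu hut ht => ?_⟩
  · rw [extend_eq hs hst ht]
    refine (hb s t hs hst ht).trans ?_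
    have : 0 ≤ t - s := by linarith
    exact mul_le_mul_of_nonneg_right (by linarith) (by positivity)
  · rw [extend_eq hs (hsu.trans hut) ht, extend_eq hs hsu (hut.trans ht)]
    have h := hChen s u t hs hsu hut ht
    have e : y t s - y u s = y t u + delta1 x t u * delta1 x' u s := by
      rw [← h, delta2]; ring
    have k0 : 0 ≤ t - u := by linarith
    have k1 : 0 ≤ u - s := by linarith
    have k2 : t - u ≤ t - s := by linarith
    have k3 : u - s ≤ t - s := by linarith
    have k4 : 0 ≤ t - s := by linarith
    have e2 : 2 * γ - γ = γ := by ring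
    have h1 : |y t u| ≤ |D| * ((t - u) ^ γ * (t - s) ^ γ) := by
      refine (hb u t (hs.trans hsu) hut ht).trans ?_
      rw [two_mul, Real.rpow_add_of_nonneg k0 hγ.le hγ.le]
      gcongr
    have h2 : |delta1 x t u * delta1 x' u s| ≤ C * C' * ((t - u) ^ γ * (t - s) ^ γ) := by
      rw [abs_mul]
      calc _ ≤ C * (t - u) ^ γ * (C' * (u - s) ^ γ) :=
            mul_le_mul (hC u t (hs.trans hsu) hut ht) (hC' s u hs hsu (hut.trans ht))
              (abs_nonneg _) (by positivity)
        _ ≤ C * (t - u) ^ γ * (C' * (t - s) ^ γ) := by gcongr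
        _ = _ := by ring
    rw [e, e2]
    calc _ ≤ _ := abs_add_le _ _
      _ ≤ _ := add_le_add h1 h2
      _ = _ := by ring

/-! ### Elementary properties of the operators -/

theorem HolderC2.exists_norm_le {V : Type*} [NormedAddCommGroup V] {T μ : ℝ} {y : ℝ → ℝ → V}
    (hy : HolderC2 T μ y) :
    ∃ C, 0 ≤ C ∧ ∀ s t, 0 ≤ s → s < t → t ≤ T → ‖y t s‖ ≤ C * (t - s) ^ μ := by
  obtain ⟨C, hC⟩ := hy.2
  refine ⟨|C|, abs_nonneg _, fun s t hs hst ht => (hC s t hs hst ht).trans ?_⟩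
  have : 0 < t - s := by linarith
  exact mul_le_mul_of_nonneg_right (le_abs_self C) (by positivity)

theorem hatDelta_eq {n : ℕ} {q : ℝ≥0∞} [Fact (1 ≤ q)] [Fact (q ≠ ⊤)] (y : ℝ → ℝ → LSp n q)
    (t u s : ℝ) : hatDelta y t u s = y t s - heatS n q (t - u) (y u s) - y t u := by
  rw [hatDelta, delta2, aOp, sub_apply, ContinuousLinearMap.id_apply]
  abel

open BesselSp in
theorem HolderC2.comp_incl {n : ℕ} {q : ℝ≥0∞} [Fact (1 ≤ q)] [Fact (q ≠ ⊤)] {α : Order} {T μ : ℝ}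
    {Z : ℝ → ℝ → (LSp n q →L[ℝ] LSp n q)} (hZ : HolderC2 T μ Z) :
    HolderC2 T μ (fun t s => ((Z t s).comp incl : BesselSp n q α →L[ℝ] LSp n q)) := by
  obtain ⟨C, hC0, hC⟩ := hZ.exists_norm_le
  refine ⟨hZ.1.clm_comp continuousOn_const, C, fun s t hs hst ht => ?_⟩
  have : 0 < t - s := by linarith
  refine ContinuousLinearMap.opNorm_le_bound _ (by positivity) fun φ => ?_
  refine ((Z t s).le_of_opNorm_le (hC s t hs hst ht) _).trans ?_
  gcongr
  exact norm_incl_le φ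

theorem heatOp_heatH_eq {n p : ℕ} [Fact (2 ≤ p)] {T γ C : ℝ} {y : ℝ → ℝ → ℝ}
    (hy : IsDriver T γ γ C y) (hγ : (n : ℝ) / (2 * p) < γ) {s t : ℝ} (hs : 0 ≤ s) (hst : s ≤ t)
    (ht : t ≤ T) {φ : LSp n p} {φ' : LSp n ((p : ℝ≥0∞) / 2)} (h : φ =ᵐ[volume] φ') :
    heatOp (heatH n p) y t s φ' = heatOp (heatS n p) y t s φ := by
  rcases hst.eq_or_lt with rfl | hst
  · rw [heatOp_self hy hs ht, heatOp_self hy hs ht, zero_apply, zero_apply]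
  rw [heatOp_apply isHeatFamily_heatH hy hγ hs hst.le ht,
    heatOp_apply isHeatFamily_heatS hy hy.order_pos hs hst.le ht,
    heatH_eq_heatS (by linarith) h]
  congr 1
  refine intervalIntegral.integral_congr_ae (ae_of_all _ fun r hr => ?_)
  rw [uIoc_of_le (by linarith)] at hr
  rw [gen, gen, ContinuousLinearMap.comp_apply, ContinuousLinearMap.comp_apply,
    heatH_eq_heatS (by linarith [hr.1]) h]

open BesselSp in
/-- The operators `X^{ax}` gain the regularity of their argument. -/
theorem holderC2_heatOp_sub_smul {n : ℕ} {q : ℝ≥0∞} [Fact (1 ≤ q)] [Fact (q ≠ ⊤)] {T γ C : ℝ}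
    {y : ℝ → ℝ → ℝ} (hy : IsDriver T γ γ C y) (α : Order) :
    HolderC2 T (γ + α) (fun t s => ((heatOp (heatS n q) y t s -
      y t s • ContinuousLinearMap.id ℝ _).comp incl : BesselSp n q α →L[ℝ] LSp n q)) := by
  obtain ⟨A, hA, hG⟩ := exists_norm_heatG_incl_le n q α
  obtain ⟨B, hB, hS⟩ := exists_norm_heatS_incl_sub_le n q α
  have hγ := hy.order_pos
  have hα := α.2.1
  have hC := hy.nonneg
  refine ⟨?_, C * B + C * A / (γ + α), fun s t hs hst ht => ?_⟩
  · refine ContinuousOn.clm_comp (ContinuousOn.sub ?_ ?_) continuousOn_const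
    · exact continuousOn_heatOp isHeatFamily_heatS hy hγ
    · exact (hy.cont.smul continuous_const).continuousOn
  · have hts : 0 < t - s := by linarith
    refine ContinuousLinearMap.opNorm_le_bound _ (by positivity) fun φ => ?_
    -- Subtracting y_{ts} Id replaces S_{t-s} φ by S_{t-s} φ - φ, which is of size (t-s)^α.
    have e : ((heatOp (heatS n q) y t s - y t s • ContinuousLinearMap.id ℝ _).comp incl) φ =
        y t s • (heatS n q (t - s) (incl φ) - incl φ) -
          ∫ r in (0 : ℝ)..(t - s), (y t s - y (t - r) s) • gen (heatS n q) r (incl φ) := by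
      rw [ContinuousLinearMap.comp_apply, sub_apply, smul_apply, ContinuousLinearMap.id_apply,
        heatOp_apply isHeatFamily_heatS hy hγ hs hst.le ht]
      module
    rw [e]
    have h1 : ‖y t s • (heatS n q (t - s) (incl φ) - incl φ)‖ ≤
        C * B * ‖φ‖ * (t - s) ^ (γ + α) := by
      rw [norm_smul, Real.norm_eq_abs]
      calc _ ≤ (C * (t - s) ^ γ) * (B * ‖φ‖ * (t - s) ^ (α : ℝ)) :=
            mul_le_mul (hy.bound s t hs hst.le ht) (hS φ _ hts) (norm_nonneg _) (by positivity)
        _ = C * B * ‖φ‖ * ((t - s) ^ γ * (t - s) ^ (α : ℝ)) := by ring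
        _ = _ := by rw [← Real.rpow_add hts]
    have h2 := norm_integral_le_of_rpow_bound (θ := γ + α) (K := C * A * ‖φ‖) (by linarith) hts.le
      (F := fun r => (y t s - y (t - r) s) • gen (heatS n q) r (incl φ)) fun r hr hrt => by
        have k1 := hy.incr s (t - r) t hs (by linarith) (by linarith) ht
        rw [sub_sub_cancel, sub_self, Real.rpow_zero, mul_one] at k1
        rw [norm_smul, Real.norm_eq_abs, gen_heatS hr]
        calc _ ≤ (C * r ^ γ) * (A * ‖φ‖ * r ^ ((α : ℝ) - 1)) :=
              mul_le_mul k1 (hG φ r hr) (norm_nonneg _) (by positivity)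
          _ = C * A * ‖φ‖ * (r ^ γ * r ^ ((α : ℝ) - 1)) := by ring
          _ = _ := by rw [← Real.rpow_add hr, add_sub_assoc]
    refine (norm_sub_le _ _).trans ((add_le_add h1 h2).trans (le_of_eq ?_))
    ring

/-! ### The operator `X^{xa}` -/

section Mul

variable {n p : ℕ} [Fact (2 ≤ p)]

variable (n p) in
/-- The pointwise product `𝓑_p × 𝓑_p → 𝓑_{p/2}`, as a continuous bilinear map. -/
def mulL : LSp n p →L[ℝ] LSp n p →L[ℝ] LSp n ((p : ℝ≥0∞) / 2) :=
  LinearMap.mkContinuous₂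
    (LinearMap.mk₂ ℝ mulHalf (fun f g h => Lp.smul_add f g h)
      (fun c f g => Lp.smul_assoc c f g)
      (fun f g h => Lp.add_smul f g h) (fun c f g => (Lp.smul_comm c f g).symm)) 1
    (fun f g => by
      rw [one_mul]
      exact Lp.norm_smul_le f g)

theorem mulL_apply (f g : LSp n p) : mulL n p f g = mulHalf f g := rfl

theorem coeFn_mulHalf (f g : LSp n p) : mulHalf f g =ᵐ[volume] fun ξ => f ξ * g ξ :=
  Lp.coeFn_lpSMul f g

end Mul

section XA

set_option maxSynthPendingDepth 3

variable {n : ℕ} {q : ℝ≥0∞} [Fact (1 ≤ q)] [Fact (q ≠ ⊤)]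
  {B E V W : Type*} [NormedAddCommGroup B] [NormedSpace ℝ B] [NormedAddCommGroup E]
  [NormedSpace ℝ E] [NormedAddCommGroup V] [NormedSpace ℝ V] [NormedAddCommGroup W]
  [NormedSpace ℝ W]

/-- The operators `A S_r` on the image of `B` in `L^p` are of size `r^(α - 1)`. -/
def GenBound (ι : B →L[ℝ] LSp n q) (α A : ℝ) : Prop :=
  ∀ φ r, 0 < r → ‖heatG n q r (ι φ)‖ ≤ A * ‖φ‖ * r ^ (α - 1)

/-- The integrand of `X^{xa}`. -/
def xaKer (X : ℝ → ℝ → (V →L[ℝ] W)) (m : LSp n q →L[ℝ] E →L[ℝ] V)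
    (ι : B →L[ℝ] LSp n q)
    (t s r : ℝ) : B →L[ℝ] E →L[ℝ] W :=
  (ContinuousLinearMap.compL ℝ E V W (X t (s + r))).comp
    (m.comp ((heatG n q r).comp ι))

/-- The operator `∫_s^t X_{tu}((A S_{us} φ) · ψ) du`. -/
def xaOp (X : ℝ → ℝ → (V →L[ℝ] W)) (m : LSp n q →L[ℝ] E →L[ℝ] V)
    (ι : B →L[ℝ] LSp n q)
    (t s : ℝ) : B →L[ℝ] E →L[ℝ] W :=
  ∫ r in (0 : ℝ)..(t - s), xaKer X m ι t s r

theorem xaKer_apply (X : ℝ → ℝ → (V →L[ℝ] W)) (m : LSp n q →L[ℝ] E →L[ℝ] V)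
    (ι : B →L[ℝ] LSp n q)
    (t s r : ℝ) (φ : B) (ψ : E) :
    xaKer X m ι t s r φ ψ = X t (s + r) (m (heatG n q r (ι φ)) ψ) := rfl

variable {X : ℝ → ℝ → (V →L[ℝ] W)} {m : LSp n q →L[ℝ] E →L[ℝ] V} {T ν α A : ℝ}
  {ι : B →L[ℝ] LSp n q}

theorem exists_norm_xaKer_le (hX : HolderC2 T ν X) (hν : 0 ≤ ν) (hA0 : 0 ≤ A)
    (hA : GenBound ι α A) :
    ∃ K, 0 ≤ K ∧ ∀ s t r, 0 ≤ s → t ≤ T → 0 < r → r < t - s →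
      ‖xaKer X m ι t s r‖ ≤ K * (t - s) ^ ν * r ^ (α - 1) := by
  obtain ⟨C, hC0, hC⟩ := hX.exists_norm_le
  refine ⟨C * ‖m‖ * A, by positivity, fun s t r hs ht hr hrt => ?_⟩
  have hts : 0 < t - s := by linarith
  refine ContinuousLinearMap.opNorm_le_bound₂ _ (by positivity) fun φ ψ => ?_
  have h1 := hC (s + r) t (by linarith) (by linarith) ht
  have h2 : (t - (s + r)) ^ ν ≤ (t - s) ^ ν :=
    Real.rpow_le_rpow (by linarith) (by linarith) hν
  rw [xaKer_apply]
  refine ((X t (s + r)).le_of_opNorm_le (h1.trans (by gcongr)) _).trans ?_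
  calc _ ≤ C * (t - s) ^ ν * (‖m‖ * (A * ‖φ‖ * r ^ (α - 1)) * ‖ψ‖) := by
        gcongr
        refine (m.le_opNorm₂ _ _).trans ?_
        gcongr
        exact hA φ r hr
    _ = _ := by ring

theorem aestronglyMeasurable_xaKer (hX : HolderC2 T ν X) {s t : ℝ} (hs : 0 ≤ s) (ht : t ≤ T) :
    AEStronglyMeasurable (xaKer X m ι t s) (volume.restrict (Ioc 0 (t - s))) := by
  refine ContinuousOn.aestronglyMeasurable ?_ measurableSet_Ioc
  refine ContinuousOn.clm_comp ?_ ?_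
  · refine (ContinuousLinearMap.continuous _).comp_continuousOn ?_
    refine hX.1.comp (f := fun r : ℝ => (t, s + r)) (by fun_prop) fun r hr => ?_
    exact ⟨by have := hr.1; simp only; linarith, by have := hr.2; simp only; linarith, ht⟩
  · exact continuousOn_const.clm_comp
      ((continuousOn_heatG.mono fun r hr => hr.1).clm_comp continuousOn_const)

theorem intervalIntegrable_xaKer (hX : HolderC2 T ν X) (hν : 0 ≤ ν) (hα : 0 < α) (hA0 : 0 ≤ A)
    (hA : GenBound ι α A) {s t : ℝ} (hs : 0 ≤ s) (hst : s ≤ t) (ht : t ≤ T) :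
    IntervalIntegrable (xaKer X m ι t s) volume 0 (t - s) := by
  obtain ⟨K, _, hK⟩ := exists_norm_xaKer_le (m := m) hX hν hA0 hA
  exact intervalIntegrable_of_rpow_bound hα (by linarith)
    (aestronglyMeasurable_xaKer hX hs ht) fun r hr hrt => hK s t r hs ht hr hrt

theorem holderC2_xaOp (hX : HolderC2 T ν X) (hν : 0 ≤ ν) (hα : 0 < α) (hA0 : 0 ≤ A)
    (hA : GenBound ι α A) : HolderC2 T (ν + α) (xaOp X m ι) := by
  obtain ⟨K, hK0, hK⟩ := exists_norm_xaKer_le (m := m) hX hν hA0 hA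
  refine ⟨?_, K / α, fun s t hs hst ht => ?_⟩
  · refine continuousOn_simplex_integral
      (b := fun r => K * T ^ ν * r ^ (α - 1)) ?_ ?_ ?_ ?_
    · rcases le_or_gt T 0 with hT | hT
      · rw [Ioc_eq_empty (by linarith)]; exact integrableOn_empty
      · rw [← intervalIntegrable_iff_integrableOn_Ioc_of_le hT.le]
        exact (intervalIntegral.intervalIntegrable_rpow' (by linarith)).const_mul _
    · rintro z ⟨h0, _, h2⟩
      exact aestronglyMeasurable_xaKer hX h0 h2
    · rintro z ⟨h0, h1, h2⟩ r hr hrt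
      refine (hK _ _ r h0 h2 hr hrt).trans ?_
      have h3 : 0 ≤ z.1 - z.2 := by linarith
      have : (z.1 - z.2) ^ ν ≤ T ^ ν := Real.rpow_le_rpow h3 (by linarith) hν
      gcongr
    · intro r hr
      refine ContinuousOn.clm_comp ?_ continuousOn_const
      refine (ContinuousLinearMap.continuous _).comp_continuousOn ?_
      refine hX.1.comp (f := fun z : ℝ × ℝ => (z.1, z.2 + r)) (by fun_prop) ?_
      rintro z ⟨⟨h0, h1, h2⟩, h3⟩
      have h3 : r < z.1 - z.2 := h3
      exact ⟨by simp only; linarith, by simp only; linarith, h2⟩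
  · have hts : 0 < t - s := by linarith
    have := norm_integral_le_of_rpow_bound (θ := α) (K := K * (t - s) ^ ν) hα hts.le
      fun r hr hrt => hK s t r hs ht hr hrt
    refine this.trans (le_of_eq ?_)
    rw [Real.rpow_add hts]
    ring

theorem intervalIntegrable_xaKer_apply (hX : HolderC2 T ν X) (hν : 0 ≤ ν) (hα : 0 < α)
    (hA0 : 0 ≤ A) (hA : GenBound ι α A) {s t : ℝ}
    (hs : 0 ≤ s) (hst : s ≤ t) (ht : t ≤ T) (φ : B) (ψ : E) :
    IntervalIntegrable (fun r => xaKer X m ι t s r φ ψ) volume 0 (t - s) := by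
  have := intervalIntegrable_xaKer (m := m) hX hν hα hA0 hA hs hst ht
  rw [intervalIntegrable_iff] at this ⊢
  exact (this.apply_continuousLinearMap φ).apply_continuousLinearMap ψ

theorem xaOp_apply [CompleteSpace W] (hX : HolderC2 T ν X) (hν : 0 ≤ ν) (hα : 0 < α) (hA0 : 0 ≤ A)
    (hA : GenBound ι α A) {s t : ℝ}
    (hs : 0 ≤ s) (hst : s ≤ t) (ht : t ≤ T) (φ : B) (ψ : E) :
    xaOp X m ι t s φ ψ =
      ∫ r in (0 : ℝ)..(t - s), X t (s + r) (m (heatG n q r (ι φ)) ψ) := by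
  have h := intervalIntegrable_xaKer (m := m) hX hν hα hA0 hA hs hst ht
  rw [xaOp, ContinuousLinearMap.intervalIntegral_apply h,
    ContinuousLinearMap.intervalIntegral_apply]
  · rfl
  · rw [intervalIntegrable_iff] at h ⊢
    exact h.apply_continuousLinearMap φ

/-- The integral over v in [s,t] is split at u. On [s,u], X_{tv} = P X_{uv} + X_{tu}, and the second
term integrates A S_{v-s} φ exactly to S_{u-s} φ - φ. On [u,t], A S_{v-s} φ = A S_{v-u} S_{u-s} φ,
which is the same operator started from S_{u-s} φ. In the application P is S_{t-u}. -/
theorem xaOp_chen [CompleteSpace W] (hX : HolderC2 T ν X) (hν : 0 ≤ ν) (hα : 0 < α) (hA0 : 0 ≤ A)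
    (hA : GenBound ι α A)
    {s u t : ℝ} {P : W →L[ℝ] W}
    (hchen : ∀ v, s ≤ v → v ≤ u → ∀ f, X t v f = P (X u v f) + X t u f)
    (hs : 0 ≤ s) (hsu : s ≤ u) (hut : u ≤ t) (ht : t ≤ T) {φ φ' : B}
    (hφ : ι φ' = heatS n q (u - s) (ι φ)) (ψ : E) :
    xaOp X m ι t s φ ψ = P (xaOp X m ι u s φ ψ) + xaOp X m ι t u φ' ψ +
      X t u (m (heatS n q (u - s) (ι φ) - ι φ) ψ) := by
  have hus : 0 ≤ u - s := by linarith
  have hi := intervalIntegrable_xaKer_apply (m := m) hX hν hα hA0 hA hs (hsu.trans hut) ht φ ψ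
  have hiu := intervalIntegrable_xaKer_apply (m := m) hX hν hα hA0 hA hs hsu (hut.trans ht) φ ψ
  have hsub1 : uIcc 0 (u - s) ⊆ uIcc 0 (t - s) := by
    rw [uIcc_of_le hus, uIcc_of_le (by linarith)]; exact Icc_subset_Icc_right (by linarith)
  have hsub2 : uIcc (u - s) (t - s) ⊆ uIcc 0 (t - s) := by
    rw [uIcc_of_le (by linarith), uIcc_of_le (by linarith)]; exact Icc_subset_Icc_left hus
  have hGi := intervalIntegrable_heatG hα hus (hA φ)
  set L : LSp n q →L[ℝ] W := (X t u).comp (m.flip ψ) with hL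
  have h1 : ∫ r in (0 : ℝ)..(u - s), xaKer X m ι t s r φ ψ =
      P (∫ r in (0 : ℝ)..(u - s), xaKer X m ι u s r φ ψ) +
        X t u (m (heatS n q (u - s) (ι φ) - ι φ) ψ) := by
    have e1 : X t u (m (heatS n q (u - s) (ι φ) - ι φ) ψ) =
        ∫ r in (0 : ℝ)..(u - s), L (heatG n q r (ι φ)) := by
      rw [L.intervalIntegral_comp_comm hGi, integral_heatG hα hus (hA φ)]
      rfl
    have hLi : IntervalIntegrable (fun r => L (heatG n q r (ι φ))) volume 0 (u - s) := by
      rw [intervalIntegrable_iff] at hGi ⊢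
      exact L.integrable_comp hGi
    have hSi : IntervalIntegrable (fun r => P (xaKer X m ι u s r φ ψ)) volume
        0 (u - s) := by
      rw [intervalIntegrable_iff] at hiu ⊢
      exact (P).integrable_comp hiu
    rw [e1, ← (P).intervalIntegral_comp_comm hiu,
      ← intervalIntegral.integral_add hSi hLi]
    refine intervalIntegral.integral_congr fun r hr => ?_
    rw [uIcc_of_le hus] at hr
    exact hchen (s + r) (by linarith [hr.1]) (by linarith [hr.2]) _
  have h2 : ∫ r in (u - s)..(t - s), xaKer X m ι t s r φ ψ = xaOp X m ι t u φ' ψ := by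
    have h3 := intervalIntegral.integral_comp_add_left (a := 0) (b := t - u)
      (fun r => xaKer X m ι t s r φ ψ) (u - s)
    have e1 : u - s + (t - u) = t - s := by ring
    rw [add_zero, e1] at h3
    rw [← h3, xaOp_apply hX hν hα hA0 hA (hs.trans hsu) hut ht]
    refine intervalIntegral.integral_congr_ae (ae_of_all _ fun r hr => ?_)
    rw [uIoc_of_le (by linarith)] at hr
    have e2 : s + (u - s + r) = u + r := by ring
    rw [xaKer_apply, e2, hφ, heatG_heatS hr.1 hus, add_comm r]
  have h0 : ∀ v, s ≤ v → v ≤ T → xaOp X m ι v s φ ψ =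
      ∫ r in (0 : ℝ)..(v - s), xaKer X m ι v s r φ ψ := fun v h1 h2 =>
    xaOp_apply hX hν hα hA0 hA hs h1 h2 φ ψ
  rw [h0 t (hsu.trans hut) ht, h0 u hsu (hut.trans ht),
    ← intervalIntegral.integral_add_adjacent_intervals (hi.mono_set hsub1) (hi.mono_set hsub2),
    h1, h2]
  abel

end XA

/-! ### Products of bounded functions -/

theorem exists_ae_eq_mul {n : ℕ} {q : ℝ≥0∞} (f : LSp n q) {h : Space n → ℝ} {M : ℝ}
    (hm : AEStronglyMeasurable h volume) (hM : ∀ᵐ ξ, |h ξ| ≤ M) :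
    ∃ w : LSp n q, (w =ᵐ[volume] fun ξ => f ξ * h ξ) ∧ ‖w‖ ≤ M * ‖f‖ := by
  have hb : ∀ᵐ ξ, ‖f ξ * h ξ‖ ≤ M * ‖f ξ‖ := by
    filter_upwards [hM] with ξ hξ
    rw [norm_mul, mul_comm, Real.norm_eq_abs (h ξ)]
    gcongr
  have hp : MemLp (fun ξ => f ξ * h ξ) q volume :=
    (Lp.memLp f).of_le_mul ((Lp.aestronglyMeasurable f).mul hm) hb
  refine ⟨hp.toLp, hp.coeFn_toLp, Lp.norm_le_mul_norm_of_ae_le_mul ?_⟩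
  filter_upwards [hb, hp.coeFn_toLp] with ξ h1 h2
  rw [h2]; exact h1

theorem NikBound.of_le {n : ℕ} {q : ℝ≥0∞} [Fact (1 ≤ q)] {a b M : ℝ} {f : LSp n q} (h : NikBound a M f) (hb : 0 ≤ b) (hba : b ≤ a)
    (hM : 0 ≤ M) : NikBound b (M + 2 * ‖f‖) f := by
  intro y
  rcases le_or_gt ‖y‖ 1 with hy | hy
  · refine (h y).trans ?_
    have h1 : ‖y‖ ^ (2 * a) ≤ ‖y‖ ^ (2 * b) := by
      rcases eq_or_ne b 0 with rfl | hb0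
      · rw [mul_zero, Real.rpow_zero]
        exact Real.rpow_le_one (norm_nonneg _) hy (by linarith)
      · exact Real.rpow_le_rpow_of_exponent_ge' (norm_nonneg _) hy (by positivity) (by linarith)
    have h2 : 0 ≤ 2 * ‖f‖ * ‖y‖ ^ (2 * b) := by positivity
    have h3 := mul_le_mul_of_nonneg_left h1 hM
    linarith
  · have h1 : 1 ≤ ‖y‖ ^ (2 * b) := Real.one_le_rpow hy.le (by linarith)
    refine (norm_sub_le _ _).trans ?_
    rw [norm_transl]
    have h2 := mul_le_mul_of_nonneg_left h1 (norm_nonneg f)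
    have h3 : 0 ≤ M * ‖y‖ ^ (2 * b) := by positivity
    linarith

/-- The increment of fg is (τ_y f - f) τ_y g + (τ_y g - g) f. Estimating the undifferenced factor in
sup norm keeps the product in L^q. -/
theorem exists_mul_nikBound {n : ℕ} {q : ℝ≥0∞} [Fact (1 ≤ q)] {f g : LSp n q} {Mf Mg : ℝ} (hf : ∀ᵐ ξ, |f ξ| ≤ Mf)
    (hg : ∀ᵐ ξ, |g ξ| ≤ Mg) (hMf : 0 ≤ Mf) (hMg : 0 ≤ Mg) :
    ∃ w : LSp n q, (w =ᵐ[volume] fun ξ => f ξ * g ξ) ∧ ‖w‖ ≤ Mg * ‖f‖ ∧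
      ∀ b Nf Ng, NikBound b Nf f → NikBound b Ng g → NikBound b (Mg * Nf + Mf * Ng) w := by
  obtain ⟨w, hw, hwn⟩ := exists_ae_eq_mul f (Lp.aestronglyMeasurable g) hg
  refine ⟨w, hw, hwn, fun b Nf Ng hNf hNg y => ?_⟩
  have hty := (measurePreserving_sub_right volume y).quasiMeasurePreserving
  have hg' : ∀ᵐ ξ, |transl q y g ξ| ≤ Mg := by
    filter_upwards [coeFn_transl y g, hty.ae hg] with ξ h1 h2
    rw [h1]; exact h2
  obtain ⟨w1, hw1, hw1n⟩ := exists_ae_eq_mul (transl q y f - f)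
    (Lp.aestronglyMeasurable (transl q y g)) hg'
  obtain ⟨w2, hw2, hw2n⟩ := exists_ae_eq_mul (transl q y g - g) (Lp.aestronglyMeasurable f) hf
  have e : transl q y w - w = w1 + w2 := by
    apply Lp.ext
    filter_upwards [Lp.coeFn_sub (transl q y w) w, Lp.coeFn_add w1 w2, hw, hw1, hw2,
      coeFn_transl y w, coeFn_transl y f, coeFn_transl y g, hty.ae_eq_comp hw,
      Lp.coeFn_sub (transl q y f) f, Lp.coeFn_sub (transl q y g) g]
      with ξ k1 k2 k3 k4 k5 k6 k7 k8 k9 k10 k11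
    simp only [Function.comp_apply] at k9
    rw [k1, k2, Pi.sub_apply, Pi.add_apply, k3, k4, k5, k6, k9, k10, k11, Pi.sub_apply,
      Pi.sub_apply, k7, k8]
    ring
  rw [e]
  have h1 := hNf y
  have h2 := hNg y
  calc _ ≤ ‖w1‖ + ‖w2‖ := norm_add_le _ _
    _ ≤ Mg * (Nf * ‖y‖ ^ (2 * b)) + Mf * (Ng * ‖y‖ ^ (2 * b)) := by
      refine add_le_add (hw1n.trans ?_) (hw2n.trans ?_) <;> gcongr
    _ = _ := by ring

/-! ### Regularity gained by smoothing, and of the values of the driven operators. -/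

section Product

variable {n : ℕ} {q : ℝ≥0∞} [Fact (1 ≤ q)] [Fact (q ≠ ⊤)]

open BesselSp

/-- Smoothing gains regularity in the sense of `NikBound`. -/
theorem nikBound_heatS {b t : ℝ} (hb : 0 ≤ b) (hb2 : b ≤ 1 / 2) (ht : 0 < t) (f : LSp n q) :
    NikBound b (shiftC n * t ^ (-b) * ‖f‖) (heatS n q t f) := by
  intro y
  have hs := two_le_shiftC n
  have ht' : 0 < √t := Real.sqrt_pos.2 ht
  have e : shiftC n * t ^ (-b) * ‖f‖ * ‖y‖ ^ (2 * b) =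
      shiftC n * (‖y‖ / √t) ^ (2 * b) * ‖f‖ := by
    rw [Real.div_rpow (norm_nonneg _) ht'.le, Real.sqrt_eq_rpow, ← Real.rpow_mul ht.le,
      Real.rpow_neg ht.le]
    have : (1 / 2 : ℝ) * (2 * b) = b := by ring
    rw [this]; ring
  rw [e]
  rcases le_or_gt (‖y‖ / √t) 1 with h | h
  · refine (norm_transl_heatS_sub_le ht y f).trans ?_
    have : ‖y‖ / √t ≤ (‖y‖ / √t) ^ (2 * b) := by
      rcases eq_or_ne b 0 with rfl | hb0
      · rw [mul_zero, Real.rpow_zero]; exact h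
      · calc ‖y‖ / √t = (‖y‖ / √t) ^ (1 : ℝ) := (Real.rpow_one _).symm
          _ ≤ _ := Real.rpow_le_rpow_of_exponent_ge' (by positivity) h (by positivity)
            (by linarith)
    gcongr
  · have h1 : 1 ≤ (‖y‖ / √t) ^ (2 * b) := Real.one_le_rpow h.le (by linarith)
    refine (norm_sub_le _ _).trans ?_
    rw [norm_transl]
    have h2 := norm_heatS_le t f
    have h3 : 2 * 1 * ‖f‖ ≤ shiftC n * (‖y‖ / √t) ^ (2 * b) * ‖f‖ := by gcongr
    linarith

theorem norm_heatS_add_sub_le {a d K : ℝ} {f : LSp n q} (ha : 0 < a) (hd : 0 ≤ d)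
    (h : ∀ v, a ≤ v → ‖heatG n q v f‖ ≤ K) : ‖heatS n q (a + d) f - heatS n q a f‖ ≤ K * d := by
  have := (convex_Ici a).norm_image_sub_le_of_norm_hasDerivWithin_le
    (f := fun r => heatS n q r f) (f' := fun r => heatG n q r f) (C := K)
    (fun x hx => (hasDerivAt_heatS (ha.trans_le hx) f).hasDerivWithinAt)
    (fun x hx => h x hx) (x := a) (y := a + d) (mem_Ici.2 le_rfl) (mem_Ici.2 (by linarith))
  rwa [add_sub_cancel_left, Real.norm_of_nonneg hd] at this

/-- For ρ ≤ a the derivative of the semigroup gives a multiple of ρ/a, and for ρ > a the bound 2‖f‖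
holds; any power θ in [0,1] lies above both. -/
theorem norm_heatS_sub_heatS_le {a ρ θ : ℝ} (hθ0 : 0 ≤ θ) (hθ : θ ≤ 1) (ha : 0 < a) (hρ : 0 < ρ)
    (f : LSp n q) : ‖heatS n q (2 * ρ) (heatS n q a f) - heatS n q a f‖ ≤
      (2 + 2 * dotC n) * (ρ / a) ^ θ * ‖f‖ := by
  have hd := dotC_pos n
  rcases le_or_gt (ρ / a) 1 with h | h
  · rw [heatS_heatS (by positivity) ha.le, add_comm]
    refine (norm_heatS_add_sub_le (K := dotC n / a * ‖f‖) ha (by positivity) fun v hv => ?_).trans ?_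
    · refine (norm_heatG_le (ha.trans_le hv) f).trans ?_
      gcongr
    · have h1 : ρ / a ≤ (ρ / a) ^ θ := by
        rcases eq_or_ne θ 0 with rfl | hb0
        · rw [Real.rpow_zero]; exact h
        · calc ρ / a = (ρ / a) ^ (1 : ℝ) := (Real.rpow_one _).symm
            _ ≤ _ := Real.rpow_le_rpow_of_exponent_ge' (by positivity) h (by positivity) hθ
      calc _ = (0 + 2 * dotC n) * (ρ / a) * ‖f‖ := by field_simp; ring
        _ ≤ _ := by gcongr; norm_num
  · have h1 : 1 ≤ (ρ / a) ^ θ := Real.one_le_rpow h.le hθ0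
    have h2 := norm_heatS_le a f
    have h3 := norm_heatS_le (2 * ρ) (heatS n q a f)
    refine (norm_sub_le _ _).trans ?_
    calc _ ≤ (2 + 0) * 1 * ‖f‖ := by linarith
      _ ≤ _ := by gcongr; positivity

/-- Raising the regularity from b to a costs v^{b-a}. For ρ ≤ v the mean value inequality is used
with ‖A S_σ w‖ ≲ σ^{b-1}; for ρ > v the modulus of w suffices. -/
theorem NikBound.norm_heatS_sub_heatS_le {a b ρ v M : ℝ} {w : LSp n q} (h : NikBound b M w)
    (hb0 : 0 ≤ b) (hba : b ≤ a) (ha : a ≤ 1) (hM : 0 ≤ M) (hv : 0 < v) (hρ : 0 < ρ) :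
    ‖heatS n q (2 * ρ) (heatS n q v w) - heatS n q v w‖ ≤
      (2 * dotC n + 4 * dotC n ^ 2) * M * ρ ^ a * v ^ (b - a) := by
  have hd := dotC_pos n
  rcases le_or_gt ρ v with hρv | hρv
  · rw [heatS_heatS (by positivity) hv.le, add_comm]
    refine (norm_heatS_add_sub_le (K := 2 * dotC n ^ 2 * M * v ^ (b - 1)) hv (by positivity)
      fun σ hσ => ?_).trans ?_
    · refine (h.norm_heatG_le hb0 (hba.trans ha) hM (hv.trans_le hσ)).trans ?_
      have := Real.rpow_le_rpow_of_nonpos hv hσ (by linarith : b - 1 ≤ 0)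
      gcongr
    · have h1 : ρ * v ^ (b - 1) ≤ ρ ^ a * v ^ (b - a) := by
        have e1 : ρ = ρ ^ a * ρ ^ (1 - a) := by
          rw [← Real.rpow_add hρ, add_sub_cancel, Real.rpow_one]
        have e2 : v ^ (b - a) = v ^ (1 - a) * v ^ (b - 1) := by
          rw [← Real.rpow_add hv]; ring_nf
        have h2 : ρ ^ (1 - a) ≤ v ^ (1 - a) := Real.rpow_le_rpow hρ.le hρv (by linarith)
        calc ρ * v ^ (b - 1) = ρ ^ a * (ρ ^ (1 - a) * v ^ (b - 1)) := by
              rw [← mul_assoc, ← e1]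
          _ ≤ ρ ^ a * (v ^ (1 - a) * v ^ (b - 1)) := by gcongr
          _ = _ := by rw [← e2]
      calc _ = (0 + 4 * dotC n ^ 2) * M * (ρ * v ^ (b - 1)) := by ring
        _ ≤ (2 * dotC n + 4 * dotC n ^ 2) * M * (ρ ^ a * v ^ (b - a)) := by gcongr; positivity
        _ = _ := by ring
  · rw [heatS_comm, ← map_sub]
    refine (norm_heatS_le _ _).trans ?_
    refine (h.norm_heatS_sub_le hb0 (hba.trans ha) hM (by positivity)).trans ?_
    have h1 : (2 * ρ) ^ b ≤ 2 * (ρ ^ a * v ^ (b - a)) := by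
      have e1 : ρ ^ b = ρ ^ a * ρ ^ (b - a) := by rw [← Real.rpow_add hρ]; ring_nf
      have h2 : ρ ^ (b - a) ≤ v ^ (b - a) := Real.rpow_le_rpow_of_nonpos hv hρv.le (by linarith)
      have h3 : (2 : ℝ) ^ b ≤ 2 := by
        calc (2 : ℝ) ^ b ≤ 2 ^ (1 : ℝ) :=
              Real.rpow_le_rpow_of_exponent_le (by norm_num) (hba.trans ha)
          _ = 2 := Real.rpow_one 2
      rw [Real.mul_rpow (by norm_num) hρ.le, e1]
      gcongr
    calc _ ≤ dotC n * M * (2 * (ρ ^ a * v ^ (b - a))) := by gcongr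
      _ = (2 * dotC n + 0) * M * ρ ^ a * v ^ (b - a) := by ring
      _ ≤ _ := by gcongr; positivity

/-- The time is halved: A S_{v/2} exploits the regularity b of w, and the increment of the other
S_{v/2} produces (ρ/v)^a. -/
theorem NikBound.norm_heatS_heatG_sub_le {a b ρ v M : ℝ} {w : LSp n q} (h : NikBound b M w)
    (hb0 : 0 ≤ b) (hb : b ≤ 1) (ha0 : 0 ≤ a) (ha : a ≤ 1) (hM : 0 ≤ M) (hv : 0 < v)
    (hρ : 0 < ρ) :
    ‖heatS n q (2 * ρ) (heatG n q v w) - heatG n q v w‖ ≤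
      (16 * (1 + dotC n) * dotC n ^ 2) * M * ρ ^ a * v ^ (b - a - 1) := by
  have hd := dotC_pos n
  have hv2 : 0 < v / 2 := by positivity
  have e : heatG n q v w = heatS n q (v / 2) (heatG n q (v / 2) w) := by
    rw [heatS_heatG hv2.le hv2, add_halves]
  rw [e]
  refine (HeatRough.norm_heatS_sub_heatS_le ha0 ha hv2 hρ _).trans ?_
  have h1 := h.norm_heatG_le hb0 hb hM hv2
  have h2 : (ρ / (v / 2)) ^ a * (v / 2) ^ (b - 1) ≤ 4 * (ρ ^ a * v ^ (b - a - 1)) := by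
    have h3 : (2 : ℝ) ^ (a + (1 - b)) ≤ 4 := by
      calc (2 : ℝ) ^ (a + (1 - b)) ≤ 2 ^ (2 : ℝ) :=
            Real.rpow_le_rpow_of_exponent_le (by norm_num) (by linarith)
        _ = 4 := by norm_num
    have e2 : (ρ / (v / 2)) ^ a * (v / 2) ^ (b - 1) =
        2 ^ (a + (1 - b)) * (ρ ^ a * v ^ (b - a - 1)) := by
      rw [Real.div_rpow hρ.le hv2.le, Real.div_rpow hv.le zero_le_two,
        Real.div_rpow hv.le zero_le_two, Real.rpow_add two_pos, Real.rpow_sub hv (b - a),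
        Real.rpow_sub hv b 1, Real.rpow_sub hv b a, Real.rpow_sub two_pos b,
        Real.rpow_sub two_pos 1]
      have k1 : 0 < v ^ a := by positivity
      have k2 : 0 < (2 : ℝ) ^ a := by positivity
      have k3 : 0 < (2 : ℝ) ^ b := by positivity
      field_simp
    rw [e2]
    gcongr
  calc _ ≤ (2 + 2 * dotC n) * (ρ / (v / 2)) ^ a * (2 * dotC n ^ 2 * M * (v / 2) ^ (b - 1)) := by
        gcongr
    _ = (2 + 2 * dotC n) * (2 * dotC n ^ 2 * M) * ((ρ / (v / 2)) ^ a * (v / 2) ^ (b - 1)) := by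
        ring
    _ ≤ (2 + 2 * dotC n) * (2 * dotC n ^ 2 * M) * (4 * (ρ ^ a * v ^ (b - a - 1))) := by gcongr
    _ = _ := by ring

/-- The regularity of the values of the driven operators. -/
theorem NikBound.exists_norm_heatS_heatOp_sub_le {T γ C a b : ℝ} {y : ℝ → ℝ → ℝ}
    (hy : IsDriver T γ γ C y) (hb0 : 0 ≤ b) (hba : b ≤ a) (ha : a ≤ 1) (hab : a < γ + b) :
    ∃ K, 0 ≤ K ∧ ∀ (w : LSp n q) (M : ℝ), NikBound b M w → 0 ≤ M →
      ∀ s t ρ, 0 ≤ s → s < t → t ≤ T → 0 < ρ →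
        ‖heatS n q (2 * ρ) (heatOp (heatS n q) y t s w) - heatOp (heatS n q) y t s w‖ ≤
          K * M * ρ ^ a * (t - s) ^ (γ + b - a) := by
  have hd := dotC_pos n
  have hC := hy.nonneg
  have hγ := hy.order_pos
  set K1 := 2 * dotC n + 4 * dotC n ^ 2 with hK1
  set K2 := 16 * (1 + dotC n) * dotC n ^ 2 with hK2
  -- Convergence of the integral of r^γ r^{b-a-1}: the driver allows any gain of regularity a - b
  -- below γ.
  have hpos : 0 < γ + b - a := by linarith
  refine ⟨C * K1 + C * K2 / (γ + b - a), by positivity,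
    fun w M hw hM s t ρ hs hst ht hρ => ?_⟩
  have hts : 0 < t - s := by linarith
  set Q : LSp n q →L[ℝ] LSp n q := heatS n q (2 * ρ) - ContinuousLinearMap.id ℝ _ with hQ
  have hQa : ∀ f, heatS n q (2 * ρ) f - f = Q f := fun f => rfl
  rw [hQa, heatOp_apply isHeatFamily_heatS hy hγ hs hst.le ht, map_sub, map_smul,
    ← Q.intervalIntegral_comp_comm
      (intervalIntegrable_smul_gen_apply isHeatFamily_heatS hy hγ hs hst.le ht w)]
  have h1 : ‖y t s • Q (heatS n q (t - s) w)‖ ≤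
      C * K1 * M * ρ ^ a * (t - s) ^ (γ + b - a) := by
    rw [norm_smul, Real.norm_eq_abs]
    calc _ ≤ (C * (t - s) ^ γ) * (K1 * M * ρ ^ a * (t - s) ^ (b - a)) :=
          mul_le_mul (hy.bound s t hs hst.le ht)
            (hw.norm_heatS_sub_heatS_le hb0 hba ha hM hts hρ) (norm_nonneg _) (by positivity)
      _ = C * K1 * M * ρ ^ a * ((t - s) ^ γ * (t - s) ^ (b - a)) := by ring
      _ = _ := by rw [← Real.rpow_add hts, add_sub_assoc]
  have h2 := norm_integral_le_of_rpow_bound (θ := γ + b - a) (K := C * K2 * M * ρ ^ a) hpos hts.le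
    (F := fun r => Q ((y t s - y (t - r) s) • gen (heatS n q) r w)) fun r hr hrt => by
      have k1 := hy.incr s (t - r) t hs (by linarith) (by linarith) ht
      rw [sub_sub_cancel, sub_self, Real.rpow_zero, mul_one] at k1
      rw [map_smul, norm_smul, Real.norm_eq_abs, gen_heatS hr]
      calc _ ≤ (C * r ^ γ) * (K2 * M * ρ ^ a * r ^ (b - a - 1)) :=
            mul_le_mul k1 (hw.norm_heatS_heatG_sub_le hb0 (hba.trans ha) (hb0.trans hba) ha hM hr hρ)
              (norm_nonneg _) (by positivity)
        _ = C * K2 * M * ρ ^ a * (r ^ γ * r ^ (b - a - 1)) := by ring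
        _ = _ := by rw [← Real.rpow_add hr]; ring_nf
  refine (norm_sub_le _ _).trans ((add_le_add h1 h2).trans (le_of_eq ?_))
  ring

theorem norm_le_of_norm_heatS_sub_le {α : Order} {a A : ℝ} (ha : (α : ℝ) < a)
    (θ : BesselSp n q α)
    (hf : ∀ r, 0 < r → ‖heatS n q (2 * r) (incl θ) - incl θ‖ ≤ A * r ^ a) {ρ : ℝ} (hρ : 0 < ρ) :
    ‖θ‖ ≤ ‖incl θ‖ + fracC α *
      (A * (ρ ^ (a - α) / (a - α)) + 2 * ‖incl θ‖ * (ρ ^ (-(α : ℝ)) / α)) := by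
  obtain ⟨φ, h1, h2⟩ := HeatRough.exists_incl_eq ha hf
  rw [← incl_injective h1]
  have := h2 ρ hρ
  rwa [← h1] at this

/-- A bilinear map with values in `𝓑_{α,q}` and bounded there factors through the inclusion. -/
theorem exists_bilinear_lift {α : Order} {B E : Type*} [NormedAddCommGroup B] [NormedSpace ℝ B]
    [NormedAddCommGroup E] [NormedSpace ℝ E] (L : B →L[ℝ] E →L[ℝ] LSp n q) {K : ℝ}
    (h : ∀ φ ψ, ∃ θ : BesselSp n q α, incl θ = L φ ψ ∧ ‖θ‖ ≤ K * ‖φ‖ * ‖ψ‖) :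
    ∃ Y : B →L[ℝ] E →L[ℝ] BesselSp n q α, ∀ φ ψ, incl (Y φ ψ) = L φ ψ := by
  choose θ hθ hK using h
  refine ⟨LinearMap.mkContinuous₂ (LinearMap.mk₂ ℝ θ ?_ ?_ ?_ ?_) K hK, fun φ ψ => hθ φ ψ⟩
  · intro a b c; apply incl_injective; rw [map_add, hθ, hθ, hθ, map_add, add_apply]
  · intro c a b; apply incl_injective; rw [map_smul, hθ, hθ, map_smul, smul_apply]
  · intro a b c; apply incl_injective; rw [map_add, hθ, hθ, hθ, map_add]
  · intro c a b; apply incl_injective; rw [map_smul, hθ, hθ, map_smul]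

end Product

/-! ### `X^{xa}` as an operator with values in `𝓑_{α,p}` -/

section XAB

open BesselSp

set_option maxSynthPendingDepth 3

theorem NikBound.mono {n : ℕ} {q : ℝ≥0∞} [Fact (1 ≤ q)] {b M M' : ℝ} {f : LSp n q}
    (h : NikBound b M f) (hM : M ≤ M') : NikBound b M' f := fun y =>
  (h y).trans (mul_le_mul_of_nonneg_right hM (by positivity))

variable {n p : ℕ} [Fact (2 ≤ p)]

theorem half_rpow_le {r a : ℝ} (hr : 0 < r) (ha : -1 ≤ a) : (r / 2) ^ a ≤ 2 * r ^ a := by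
  rw [Real.div_rpow hr.le zero_le_two, div_eq_mul_inv, ← Real.rpow_neg zero_le_two, mul_comm]
  have : (2 : ℝ) ^ (-a) ≤ 2 := by
    calc (2 : ℝ) ^ (-a) ≤ 2 ^ (1 : ℝ) :=
          Real.rpow_le_rpow_of_exponent_le one_le_two (by linarith)
      _ = 2 := Real.rpow_one 2
  gcongr

/-- The regularity of the products `(A S_r φ) · ψ`. -/
theorem exists_product_bound (α : Order) {b T : ℝ} (hκb : (n : ℝ) / (2 * p) ≤ b)
    (hκα : (n : ℝ) / (2 * p) < α) (hbα : b ≤ α) (hT : 0 ≤ T) :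
    ∃ E, 0 ≤ E ∧ ∀ (φ ψ : BesselSp n p α) (r : ℝ), 0 < r → r ≤ T → ∃ w : LSp n p,
      (w =ᵐ[volume] mulHalf (heatG n p r (incl φ)) (incl ψ)) ∧
      ‖w‖ ≤ E * ‖φ‖ * ‖ψ‖ * r ^ ((α : ℝ) - 1) ∧
      NikBound b (E * ‖φ‖ * ‖ψ‖ * r ^ ((α : ℝ) - b - 1)) w := by
  obtain ⟨A, hA0, hA⟩ := exists_norm_heatG_incl_le n p α
  obtain ⟨N, hN0, hN⟩ := exists_nikBound_incl n p α
  obtain ⟨D, hD0, hD⟩ := exists_ae_abs_incl_le n p α (by simpa using hκα)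
  have hs := two_le_shiftC n
  have hα0 := α.2.1
  have hα2 := α.2.2
  set κ := (n : ℝ) / (2 * p) with hκ
  have hκ0 : 0 ≤ κ := by positivity
  have hb0 : 0 ≤ b := hκ0.trans hκb
  refine ⟨D * A + (D * (4 * shiftC n * A) + 4 * A * T ^ (b - κ) * (N + 2)), by positivity,
    fun φ ψ r hr hrT => ?_⟩
  have hr2 : 0 < r / 2 := by positivity
  -- Half of the time makes A S_{r/2} φ of size r^{α-1} in L^p; the other half converts this into a
  -- sup bound at cost r^{-κ} and a modulus of order b at cost r^{-b}.
  set g := heatG n p (r / 2) (incl φ) with hg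
  have hgn : ‖g‖ ≤ 2 * A * ‖φ‖ * r ^ ((α : ℝ) - 1) := by
    refine (hA φ _ hr2).trans ?_
    calc _ ≤ A * ‖φ‖ * (2 * r ^ ((α : ℝ) - 1)) := by
          gcongr; exact half_rpow_le hr (by linarith)
      _ = _ := by ring
  have e : heatG n p r (incl φ) = heatS n p (r / 2) g := by
    rw [hg, heatS_heatG hr2.le hr2, add_halves]
  have hsup : ∀ᵐ ξ, |heatG n p r (incl φ) ξ| ≤
      4 * A * T ^ (b - κ) * ‖φ‖ * r ^ ((α : ℝ) - b - 1) := by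
    have h1 := ae_abs_heatS_le hr2 g
    rw [← e] at h1
    filter_upwards [h1] with ξ hξ
    refine hξ.trans ?_
    have e1 : -(n : ℝ) / (2 * (p : ℝ≥0∞).toReal) = -κ := by
      rw [ENNReal.toReal_natCast, neg_div]
    rw [e1]
    have e2 : r ^ (-κ) = r ^ (b - κ) * r ^ (-b) := by rw [← Real.rpow_add hr]; ring_nf
    have e3 : r ^ ((α : ℝ) - b - 1) = r ^ (-b) * r ^ ((α : ℝ) - 1) := by
      rw [← Real.rpow_add hr]; ring_nf
    -- Since κ ≤ b and r ≤ T, the cost r^{-κ} is absorbed into r^{-b}, so both factors of the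
    -- product estimate carry r^{α-b-1}.
    have h2 : r ^ (b - κ) ≤ T ^ (b - κ) := Real.rpow_le_rpow hr.le hrT (by linarith)
    calc _ ≤ (2 * r ^ (-κ)) * (2 * A * ‖φ‖ * r ^ ((α : ℝ) - 1)) := by
          gcongr; exact half_rpow_le hr (by linarith)
      _ = 4 * A * (r ^ (b - κ)) * ‖φ‖ * (r ^ (-b) * r ^ ((α : ℝ) - 1)) := by rw [e2]; ring
      _ ≤ _ := by rw [e3]; gcongr
  have hnik : NikBound b (4 * shiftC n * A * ‖φ‖ * r ^ ((α : ℝ) - b - 1))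
      (heatG n p r (incl φ)) := by
    rw [e]
    refine (nikBound_heatS hb0 (by linarith) hr2 g).mono ?_
    have e3 : r ^ ((α : ℝ) - b - 1) = r ^ (-b) * r ^ ((α : ℝ) - 1) := by
      rw [← Real.rpow_add hr]; ring_nf
    calc _ ≤ shiftC n * (2 * r ^ (-b)) * (2 * A * ‖φ‖ * r ^ ((α : ℝ) - 1)) := by
          gcongr; exact half_rpow_le hr (by linarith)
      _ = _ := by rw [e3]; ring
  have hψ : NikBound b ((N + 2) * ‖ψ‖) (incl ψ) := by
    refine ((hN ψ).of_le hb0 hbα (by positivity)).mono ?_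
    have := norm_incl_le ψ
    linarith
  obtain ⟨w, hw, hwn, hwb⟩ := exists_mul_nikBound hsup (hD ψ) (by positivity) (by positivity)
  refine ⟨w, hw.trans (coeFn_mulHalf _ _).symm, hwn.trans ?_, (hwb b _ _ hnik hψ).mono ?_⟩
  · calc _ ≤ D * ‖ψ‖ * (A * ‖φ‖ * r ^ ((α : ℝ) - 1)) := by gcongr; exact hA φ r hr
      _ = (D * A + 0) * ‖φ‖ * ‖ψ‖ * r ^ ((α : ℝ) - 1) := by ring
      _ ≤ _ := by gcongr; positivity
  · calc _ = (0 + (D * (4 * shiftC n * A) + 4 * A * T ^ (b - κ) * (N + 2))) * ‖φ‖ * ‖ψ‖ *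
          r ^ ((α : ℝ) - b - 1) := by ring
      _ ≤ _ := by gcongr; positivity

theorem genBound_incl (α : Order) :
    ∃ A, 0 ≤ A ∧ GenBound (incl : BesselSp n p α →L[ℝ] LSp n p) α A :=
  exists_norm_heatG_incl_le n p α

variable {T γ C : ℝ} {y : ℝ → ℝ → ℝ}

theorem holderC2_heatH (hy : IsDriver T γ γ C y) (hκγ : (n : ℝ) / (2 * p) < γ) :
    HolderC2 T (γ - n / (2 * p)) (heatOp (heatH n p) y) :=
  holderC2_heatOp isHeatFamily_heatH hy hκγ

set_option maxHeartbeats 1000000 in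
-- Each integrand is X^x_{t,s+r} applied to w = (A S_r φ)·ψ, which lies in L^p. The size r^{α-1} of
-- w gives the L^p bound; its modulus of order b, of size r^{α-b-1}, gives the regularity a, because
-- X^x raises b to a. Both powers of r are integrable.
theorem exists_xaOp_bounds (hy : IsDriver T γ γ C y) (hκγ : (n : ℝ) / (2 * p) < γ)
    (hγ : 1 / 3 < γ) (hT : 0 ≤ T) (α : Order) (hκα : (n : ℝ) / (2 * p) < α) {a : ℝ}
    (ha : a = α + 1 / 12) :
    ∃ K, 0 ≤ K ∧ ∀ (φ ψ : BesselSp n p α) (s t : ℝ), 0 ≤ s → s < t → t ≤ T →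
      ‖xaOp (heatOp (heatH n p) y) (mulL n p) incl t s φ (incl ψ)‖ ≤
          K * ‖φ‖ * ‖ψ‖ * (t - s) ^ (γ + α) ∧
      ∀ ρ, 0 < ρ → ‖heatS n p (2 * ρ)
          (xaOp (heatOp (heatH n p) y) (mulL n p) incl t s φ (incl ψ)) -
          xaOp (heatOp (heatH n p) y) (mulL n p) incl t s φ (incl ψ)‖ ≤
        K * ‖φ‖ * ‖ψ‖ * (t - s) ^ (γ + α - a) * ρ ^ a := by
  have hα0 := α.2.1
  have hα2 := α.2.2
  obtain ⟨A, hA0, hA⟩ := genBound_incl (n := n) (p := p) α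
  set κ := (n : ℝ) / (2 * p) with hκ
  have hκ0 : 0 ≤ κ := by positivity
  -- b ≥ κ serves the sup bound and b < α keeps r^{α-b-1} integrable. Since b ≥ α - 1/12 and a = α +
  -- 1/12, the required gain a - b is at most 1/6 < 1/3 < γ.
  set b := max κ (max ((α : ℝ) / 2) (α - 1 / 12)) with hb
  have hκb : κ ≤ b := le_max_left _ _
  have hbα : b < α := max_lt hκα (max_lt (by linarith) (by linarith))
  have hba : (α : ℝ) - 1 / 12 ≤ b := (le_max_right _ _).trans (le_max_right _ _)
  have hb0 : 0 ≤ b := hκ0.trans hκb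
  obtain ⟨E, hE0, hE⟩ := exists_product_bound (n := n) (p := p) α hκb hκα hbα.le hT
  obtain ⟨K1, hK1, hX⟩ := norm_heatOp_le (isHeatFamily_heatS (n := n) (q := p)) hy hy.order_pos
  obtain ⟨K2, hK2, hR⟩ := NikBound.exists_norm_heatS_heatOp_sub_le (n := n) (q := p) (a := a)
    (b := b) hy hb0 (by linarith) (by linarith) (by linarith)
  have hXH := holderC2_heatH (n := n) hy hκγ
  have hαb : 0 < (α : ℝ) - b := by linarith
  refine ⟨K1 * E / α + K2 * E / (α - b), by positivity, fun φ ψ s t hs hst ht => ?_⟩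
  have hts : 0 < t - s := by linarith
  set F : ℝ → LSp n p := fun r =>
    heatOp (heatH n p) y t (s + r) (mulL n p (heatG n p r (incl φ)) (incl ψ)) with hF
  have hU : xaOp (heatOp (heatH n p) y) (mulL n p) incl t s φ (incl ψ) =
      ∫ r in (0 : ℝ)..(t - s), F r :=
    xaOp_apply hXH (by linarith) hα0 hA0 hA hs hst.le ht φ (incl ψ)
  have hFi : IntervalIntegrable F volume 0 (t - s) :=
    intervalIntegrable_xaKer_apply (m := mulL n p) hXH (by linarith) hα0 hA0 hA hs hst.le ht φ
      (incl ψ)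
  have hFw : ∀ r, 0 < r → r < t - s → ∃ w : LSp n p,
      F r = heatOp (heatS n p) y t (s + r) w ∧ ‖w‖ ≤ E * ‖φ‖ * ‖ψ‖ * r ^ ((α : ℝ) - 1) ∧
      NikBound b (E * ‖φ‖ * ‖ψ‖ * r ^ ((α : ℝ) - b - 1)) w := by
    intro r hr hrt
    obtain ⟨w, h1, h2, h3⟩ := hE φ ψ r hr (by linarith)
    exact ⟨w, heatOp_heatH_eq hy hκγ (by linarith) (by linarith) ht h1, h2, h3⟩
  rw [hU]
  constructor
  · refine (norm_integral_le_of_rpow_bound (θ := (α : ℝ))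
      (K := K1 * (t - s) ^ γ * (E * ‖φ‖ * ‖ψ‖)) hα0 hts.le fun r hr hrt => ?_).trans ?_
    · obtain ⟨w, h1, h2, _⟩ := hFw r hr hrt
      have h3 := hX (s + r) t (by linarith) (by linarith) ht
      rw [sub_zero] at h3
      have h4 : (t - (s + r)) ^ γ ≤ (t - s) ^ γ :=
        Real.rpow_le_rpow (by linarith) (by linarith) hy.order_pos.le
      rw [h1]
      refine ((heatOp (heatS n p) y t (s + r)).le_of_opNorm_le
        (h3.trans (mul_le_mul_of_nonneg_left h4 hK1)) w).trans ?_
      calc _ ≤ K1 * (t - s) ^ γ * (E * ‖φ‖ * ‖ψ‖ * r ^ ((α : ℝ) - 1)) := by gcongr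
        _ = _ := by ring
    · calc _ = (K1 * E / α + 0) * ‖φ‖ * ‖ψ‖ * ((t - s) ^ γ * (t - s) ^ (α : ℝ)) := by ring
        _ ≤ (K1 * E / α + K2 * E / (α - b)) * ‖φ‖ * ‖ψ‖ * ((t - s) ^ γ * (t - s) ^ (α : ℝ)) := by
          gcongr; positivity
        _ = _ := by rw [← Real.rpow_add hts]
  · intro ρ hρ
    set Q : LSp n p →L[ℝ] LSp n p := heatS n p (2 * ρ) - ContinuousLinearMap.id ℝ _ with hQ
    have hQa : ∀ f, heatS n p (2 * ρ) f - f = Q f := fun f => rfl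
    rw [hQa, ← Q.intervalIntegral_comp_comm hFi]
    refine (norm_integral_le_of_rpow_bound (θ := (α : ℝ) - b)
      (K := K2 * (E * ‖φ‖ * ‖ψ‖) * ρ ^ a * (t - s) ^ (γ + b - a)) hαb hts.le
      fun r hr hrt => ?_).trans ?_
    · obtain ⟨w, h1, _, h2⟩ := hFw r hr hrt
      have h3 := hR w _ h2 (by positivity) (s + r) t ρ (by linarith) (by linarith) ht hρ
      have h4 : (t - (s + r)) ^ (γ + b - a) ≤ (t - s) ^ (γ + b - a) :=
        Real.rpow_le_rpow (by linarith) (by linarith) (by linarith)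
      rw [h1, ← hQa]
      calc _ ≤ _ := h3
        _ ≤ K2 * (E * ‖φ‖ * ‖ψ‖ * r ^ ((α : ℝ) - b - 1)) * ρ ^ a * (t - s) ^ (γ + b - a) := by
          gcongr
        _ = _ := by ring
    · calc _ = (0 + K2 * E / (α - b)) * ‖φ‖ * ‖ψ‖ *
            ((t - s) ^ (γ + b - a) * (t - s) ^ ((α : ℝ) - b)) * ρ ^ a := by ring
        _ ≤ (K1 * E / α + K2 * E / (α - b)) * ‖φ‖ * ‖ψ‖ *
            ((t - s) ^ (γ + b - a) * (t - s) ^ ((α : ℝ) - b)) * ρ ^ a := by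
          gcongr; positivity
        _ = _ := by rw [← Real.rpow_add hts]; ring_nf

/-- A small ρ is fixed first to make the regular term small, and only then does e tend to zero. This
upgrades continuity in L^q to continuity in 𝓑_{α,q}. -/
theorem tendsto_zero_of_interpolation {X : Type*} {l : Filter X} {d e : X → ℝ} {η A : ℝ}
    {c : ℝ → ℝ} (hη : 0 < η) (he : Tendsto e l (𝓝 0)) (hd0 : ∀ᶠ z in l, 0 ≤ d z)
    (hd : ∀ᶠ z in l, ∀ ρ, 0 < ρ → d z ≤ A * ρ ^ η + c ρ * e z) : Tendsto d l (𝓝 0) := by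
  rw [Metric.tendsto_nhds]
  intro ε hε
  have h1 : Tendsto (fun ρ : ℝ => A * ρ ^ η) (𝓝[>] 0) (𝓝 0) := by
    have hc : Continuous fun ρ : ℝ => A * ρ ^ η :=
      continuous_const.mul (continuous_id.rpow_const fun _ => Or.inr hη.le)
    have := hc.tendsto 0
    rw [Real.zero_rpow hη.ne', mul_zero] at this
    exact this.mono_left nhdsWithin_le_nhds
  obtain ⟨ρ, hρ, hρ0⟩ := ((h1.eventually (gt_mem_nhds (half_pos hε))).and
    self_mem_nhdsWithin).exists
  have hρ0 : 0 < ρ := hρ0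
  have h2 : Tendsto (fun z => c ρ * e z) l (𝓝 0) := by simpa using he.const_mul (c ρ)
  filter_upwards [h2.eventually (gt_mem_nhds (half_pos hε)), hd0, hd] with z k1 k2 k3
  rw [Real.dist_eq, sub_zero, abs_of_nonneg k2]
  linarith [k3 ρ hρ0]

set_option maxHeartbeats 1000000 in
/-- Lifting a family of bilinear operators with values in `L^q` to one with values in `𝓑_{α,q}`. -/
theorem exists_holderC2_bilinear_lift {q : ℝ≥0∞} [Fact (1 ≤ q)] [Fact (q ≠ ⊤)] {α : Order}
    {B E : Type*} [NormedAddCommGroup B] [NormedSpace ℝ B] [NormedAddCommGroup E]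
    [NormedSpace ℝ E] {L : ℝ → ℝ → (B →L[ℝ] E →L[ℝ] LSp n q)} {T a ν K : ℝ}
    (hL : ContinuousOn (fun z : ℝ × ℝ => L z.1 z.2) {z | 0 ≤ z.2 ∧ z.2 ≤ z.1 ∧ z.1 ≤ T})
    (hself : ∀ t, L t t = 0) (ha : (α : ℝ) < a) (haν : a ≤ ν) (hK : 0 ≤ K)
    (h1 : ∀ φ ψ s t, 0 ≤ s → s < t → t ≤ T →
      ‖L t s φ ψ‖ ≤ K * ‖φ‖ * ‖ψ‖ * (t - s) ^ ν)
    (h2 : ∀ φ ψ s t, 0 ≤ s → s < t → t ≤ T → ∀ ρ, 0 < ρ →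
      ‖heatS n q (2 * ρ) (L t s φ ψ) - L t s φ ψ‖ ≤
        K * ‖φ‖ * ‖ψ‖ * (t - s) ^ (ν - a) * ρ ^ a) :
    ∃ Y : ℝ → ℝ → (B →L[ℝ] E →L[ℝ] BesselSp n q α),
      (∀ s t, 0 ≤ s → s ≤ t → t ≤ T → ∀ φ ψ, incl (Y t s φ ψ) = L t s φ ψ) ∧
      HolderC2 T (ν - α) Y := by
  have hα0 := α.2.1
  have hf := fracC_pos hα0 (Order.lt_one α)
  have haα : 0 < a - α := by linarith
  -- The cut ρ = t - s balances the fractional Laplacian: (t-s)^{ν-a}(t-s)^{a-α} and (t-s)^ν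
  -- (t-s)^{-α} both equal (t-s)^{ν-α}. The L^q part is smaller by (t-s)^α ≤ T^α.
  set K' := K * T ^ (α : ℝ) + fracC α * (K / (a - α) + 2 * K / α) with hK'
  have hbd : ∀ (φ : B) (ψ : E) (s t : ℝ) (θ : BesselSp n q α), 0 ≤ s → s < t → t ≤ T →
      ‖θ‖ ≤ ‖L t s φ ψ‖ + fracC α *
        (K * ‖φ‖ * ‖ψ‖ * (t - s) ^ (ν - a) * ((t - s) ^ (a - α) / (a - α)) +
          2 * ‖L t s φ ψ‖ * ((t - s) ^ (-(α : ℝ)) / α)) →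
      ‖θ‖ ≤ K' * (t - s) ^ (ν - α) * ‖φ‖ * ‖ψ‖ := by
    intro φ ψ s t θ hs hst ht hθ
    have hd : 0 < t - s := by linarith
    have hL1 := h1 φ ψ s t hs hst ht
    have e1 : (t - s) ^ ν = (t - s) ^ (ν - α) * (t - s) ^ (α : ℝ) := by
      rw [← Real.rpow_add hd]; ring_nf
    have e2 : (t - s) ^ (ν - a) * (t - s) ^ (a - α) = (t - s) ^ (ν - α) := by
      rw [← Real.rpow_add hd]; ring_nf
    have e3 : (t - s) ^ ν * (t - s) ^ (-(α : ℝ)) = (t - s) ^ (ν - α) := by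
      rw [← Real.rpow_add hd]; ring_nf
    have e4 : (t - s) ^ (α : ℝ) ≤ T ^ (α : ℝ) := Real.rpow_le_rpow hd.le (by linarith) hα0.le
    refine hθ.trans ?_
    calc _ ≤ K * ‖φ‖ * ‖ψ‖ * (t - s) ^ ν + fracC α *
          (K * ‖φ‖ * ‖ψ‖ * (t - s) ^ (ν - a) * ((t - s) ^ (a - α) / (a - α)) +
            2 * (K * ‖φ‖ * ‖ψ‖ * (t - s) ^ ν) * ((t - s) ^ (-(α : ℝ)) / α)) := by gcongr
      _ = K * ‖φ‖ * ‖ψ‖ * ((t - s) ^ (ν - α) * (t - s) ^ (α : ℝ)) + fracC α *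
          (K * ‖φ‖ * ‖ψ‖ * ((t - s) ^ (ν - a) * (t - s) ^ (a - α)) / (a - α) +
            2 * K * ‖φ‖ * ‖ψ‖ * ((t - s) ^ ν * (t - s) ^ (-(α : ℝ))) / α) := by
          rw [← e1]; ring
      _ ≤ K * ‖φ‖ * ‖ψ‖ * ((t - s) ^ (ν - α) * T ^ (α : ℝ)) + fracC α *
          (K * ‖φ‖ * ‖ψ‖ * ((t - s) ^ (ν - a) * (t - s) ^ (a - α)) / (a - α) +
            2 * K * ‖φ‖ * ‖ψ‖ * ((t - s) ^ ν * (t - s) ^ (-(α : ℝ))) / α) := by gcongr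
      _ = _ := by rw [e2, e3, hK']; ring
  have hex : ∀ t s, ∃ Y : B →L[ℝ] E →L[ℝ] BesselSp n q α, 0 ≤ s → s ≤ t → t ≤ T →
      ∀ φ ψ, incl (Y φ ψ) = L t s φ ψ := by
    intro t s
    by_cases h : 0 ≤ s ∧ s < t ∧ t ≤ T
    · obtain ⟨hs, hst, ht⟩ := h
      obtain ⟨Y, hY⟩ := exists_bilinear_lift (α := α) (L t s) (K := K' * (t - s) ^ (ν - α))
        fun φ ψ => by
          obtain ⟨θ, hθ, hθ2⟩ := exists_incl_eq ha (h2 φ ψ s t hs hst ht)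
          exact ⟨θ, hθ, hbd φ ψ s t θ hs hst ht (hθ2 _ (by linarith))⟩
      exact ⟨Y, fun _ _ _ => hY⟩
    · refine ⟨0, fun hs hst ht φ ψ => ?_⟩
      have : s = t := by
        by_contra hne
        exact h ⟨hs, lt_of_le_of_ne hst hne, ht⟩
      rw [this, hself]
      simp
  choose Y hY using hex
  have hYa : ∀ s t, 0 ≤ s → s ≤ t → t ≤ T → ∀ φ ψ ρ, 0 < ρ →
      ‖heatS n q (2 * ρ) (incl (Y t s φ ψ)) - incl (Y t s φ ψ)‖ ≤
        K * ‖φ‖ * ‖ψ‖ * T ^ (ν - a) * ρ ^ a := by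
    intro s t hs hst ht φ ψ ρ hρ
    have hT : 0 ≤ T := by linarith
    rw [hY t s hs hst ht]
    rcases hst.eq_or_lt with rfl | hlt
    · rw [hself]
      simp only [zero_apply, map_zero, sub_zero, norm_zero]
      positivity
    · refine (h2 φ ψ s t hs hlt ht ρ hρ).trans ?_
      have : (t - s) ^ (ν - a) ≤ T ^ (ν - a) :=
        Real.rpow_le_rpow (by linarith) (by linarith) (by linarith)
      gcongr
  refine ⟨Y, fun s t => hY t s, ?_, K', fun s t hs hst ht => ?_⟩
  · rintro z₀ ⟨g1, g2, g3⟩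
    have hT : 0 ≤ T := by linarith
    have hz : ContinuousWithinAt (fun z : ℝ × ℝ => L z.1 z.2) _ z₀ := hL z₀ ⟨g1, g2, g3⟩
    rw [ContinuousWithinAt, tendsto_iff_norm_sub_tendsto_zero] at hz ⊢
    -- Differences of the lifted operators have regularity a uniformly on the simplex, while their
    -- L^q size tends to zero.
    refine tendsto_zero_of_interpolation (η := a - α)
      (A := fracC α * (2 * (K * T ^ (ν - a)) / (a - α)))
      (c := fun ρ => 1 + fracC α * (2 * (ρ ^ (-(α : ℝ)) / α))) haα hz
      (Eventually.of_forall fun z => norm_nonneg _) ?_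
    filter_upwards [self_mem_nhdsWithin] with z hz ρ hρ
    obtain ⟨k1, k2, k3⟩ := hz
    refine ContinuousLinearMap.opNorm_le_bound₂ _ (by positivity) fun φ ψ => ?_
    have e : incl ((Y z.1 z.2 - Y z₀.1 z₀.2) φ ψ) = (L z.1 z.2 - L z₀.1 z₀.2) φ ψ := by
      simp only [sub_apply, map_sub]
      rw [hY _ _ k1 k2 k3, hY _ _ g1 g2 g3]
    have e2 : ‖incl ((Y z.1 z.2 - Y z₀.1 z₀.2) φ ψ)‖ ≤
        ‖L z.1 z.2 - L z₀.1 z₀.2‖ * ‖φ‖ * ‖ψ‖ := by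
      rw [e]; exact ContinuousLinearMap.le_opNorm₂ _ _ _
    refine (norm_le_of_norm_heatS_sub_le ha _ (A := 2 * (K * ‖φ‖ * ‖ψ‖ * T ^ (ν - a)))
      (fun r hr => ?_) hρ).trans ?_
    · have m1 := hYa _ _ k1 k2 k3 φ ψ r hr
      have m2 := hYa _ _ g1 g2 g3 φ ψ r hr
      simp only [sub_apply, map_sub]
      rw [sub_sub_sub_comm]
      refine (norm_sub_le _ _).trans ?_
      linarith
    · calc _ ≤ ‖L z.1 z.2 - L z₀.1 z₀.2‖ * ‖φ‖ * ‖ψ‖ + fracC α *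
            (2 * (K * ‖φ‖ * ‖ψ‖ * T ^ (ν - a)) * (ρ ^ (a - α) / (a - α)) +
              2 * (‖L z.1 z.2 - L z₀.1 z₀.2‖ * ‖φ‖ * ‖ψ‖) * (ρ ^ (-(α : ℝ)) / α)) := by
            gcongr
        _ = _ := by ring
  · have hd : 0 < t - s := by linarith
    have hT : 0 ≤ T := by linarith
    refine ContinuousLinearMap.opNorm_le_bound₂ _ (by positivity) fun φ ψ => ?_
    refine hbd φ ψ s t _ hs hst ht ?_
    have := norm_le_of_norm_heatS_sub_le ha (Y t s φ ψ)
      (A := K * ‖φ‖ * ‖ψ‖ * (t - s) ^ (ν - a)) (fun r hr => by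
        rw [hY t s hs hst.le ht]; exact h2 φ ψ s t hs hst ht r hr) hd
    rwa [hY t s hs hst.le ht] at this

theorem xaOp_self {q : ℝ≥0∞} [Fact (1 ≤ q)] [Fact (q ≠ ⊤)] {B E V W : Type*}
    [NormedAddCommGroup B] [NormedSpace ℝ B] [NormedAddCommGroup E] [NormedSpace ℝ E]
    [NormedAddCommGroup V] [NormedSpace ℝ V] [NormedAddCommGroup W] [NormedSpace ℝ W]
    (X : ℝ → ℝ → (V →L[ℝ] W)) (m : LSp n q →L[ℝ] E →L[ℝ] V) (ι : B →L[ℝ] LSp n q) (t : ℝ) :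
    xaOp X m ι t t = 0 := by
  rw [xaOp, sub_self, intervalIntegral.integral_same]

theorem exists_holderC2_xaOp_lift (hy : IsDriver T γ γ C y) (hκγ : (n : ℝ) / (2 * p) < γ)
    (hγ : 1 / 3 < γ) (hT : 0 ≤ T) (α : Order) (hκα : (n : ℝ) / (2 * p) < α) :
    ∃ Y : ℝ → ℝ → (BesselSp n p α →L[ℝ] BesselSp n p α →L[ℝ] BesselSp n p α),
      (∀ s t, 0 ≤ s → s ≤ t → t ≤ T → ∀ φ ψ, incl (Y t s φ ψ) =
        xaOp (heatOp (heatH n p) y) (mulL n p) incl t s φ (incl ψ)) ∧ HolderC2 T γ Y := by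
  obtain ⟨K, hK0, hK⟩ := exists_xaOp_bounds (n := n) (p := p) hy hκγ hγ hT α hκα rfl
  obtain ⟨A, hA0, hA⟩ := genBound_incl (n := n) (p := p) α
  have hc := (holderC2_xaOp (m := mulL n p) (holderC2_heatH (n := n) hy hκγ) (by linarith) α.2.1
    hA0 hA).1
  -- R precomposes the second argument with the inclusion, so that both arguments range over
  -- 𝓑_{α,p}.
  let R := (ContinuousLinearMap.compL ℝ (BesselSp n p α) (LSp n p) (LSp n p)).flip incl
  obtain ⟨Y, h1, h2⟩ := exists_holderC2_bilinear_lift (α := α) (a := α + 1 / 12) (ν := γ + α)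
    (T := T) (K := K)
    (L := fun t s => R.comp (xaOp (heatOp (heatH n p) y) (mulL n p) incl t s))
    (continuousOn_const.clm_comp hc)
    (fun t => by simp only [xaOp_self, ContinuousLinearMap.comp_zero]) (by linarith)
    (by linarith) hK0
    (fun φ ψ s t hs hst ht => (hK φ ψ s t hs hst ht).1)
    (fun φ ψ s t hs hst ht => (hK φ ψ s t hs hst ht).2)
  refine ⟨Y, h1, ?_⟩
  rwa [add_sub_cancel_right] at h2

end XAB

/-! ### The integration by parts formulas -/

section IPP

variable {n : ℕ}

theorem genHeat_eq {r : ℝ} (hr : 0 < r) (φ : Space n → ℝ) (ξ : Space n) :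
    genHeat r φ ξ = ∫ y, gaussDot n r y * φ (ξ - y) := by
  simp only [genHeat, deriv_gaussKernel n hr]

theorem coeFn_heatG {q : ℝ≥0∞} [Fact (1 ≤ q)] [Fact (q ≠ ⊤)] {r : ℝ} (hr : 0 < r)
    {f : LSp n q} {φ : Space n → ℝ} (h : f =ᵐ[volume] φ) :
    heatG n q r f =ᵐ[volume] genHeat r φ := by
  filter_upwards [coeFn_convLp (integrable_gaussDot n hr) h] with ξ hξ
  rw [genHeat_eq hr]
  exact hξ

theorem measurable_integral_gaussDot_mul {Y : Type*} [MeasurableSpace Y] {ρ : Y → ℝ}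
    (hρ : Measurable ρ) {F : Y → Space n → ℝ} (hF : Measurable (Function.uncurry F)) :
    Measurable fun z : Y × Space n => ∫ y, gaussDot n (ρ z.1) y * F z.1 (z.2 - y) := by
  have h : Measurable fun w : (Y × Space n) × Space n =>
      gaussDot n (ρ w.1.1) w.2 * F w.1.1 (w.1.2 - w.2) :=
    ((measurable_gaussDot n).comp (((hρ.comp measurable_fst).comp measurable_fst).prodMk
      measurable_snd)).mul (hF.comp ((measurable_fst.comp measurable_fst).prodMk
        ((measurable_snd.comp measurable_fst).sub measurable_snd)))
  exact (h.stronglyMeasurable.integral_prod_right' (ν := volume)).measurable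

theorem IsLip.integrable_gaussDot_mul {φ : Space n → ℝ} (h : IsLip φ) {r : ℝ} (hr : 0 < r)
    (ξ : Space n) : Integrable (fun y => gaussDot n r y * φ (ξ - y)) volume := by
  obtain ⟨M, _, hM⟩ := h.exists_bound
  exact (integrable_gaussDot n hr).mul_bdd (c := M)
    (h.continuous.comp (continuous_const.sub continuous_id)).aestronglyMeasurable
    (Eventually.of_forall fun y => hM _)

/-- Convolution with the L¹ kernel of A S_r keeps Lipschitz functions bounded and Lipschitz, and ψ
supplies the compact support. The class is therefore stable under the product inside X^{xa}, so the
pointwise formula for X^x applies to it. -/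
theorem IsLip.genHeat_mul {φ ψ : Space n → ℝ} (hφ : IsLip φ) (hψ : IsLip ψ) {r : ℝ}
    (hr : 0 < r) : IsLip fun ξ => genHeat r φ ξ * ψ ξ := by
  obtain ⟨M, hM0, hM⟩ := hφ.exists_bound
  obtain ⟨N, hN0, hN⟩ := hψ.exists_bound
  obtain ⟨K, hK⟩ := hφ.lip
  obtain ⟨L, hL⟩ := hψ.lip
  have hi := (integrable_gaussDot n hr).norm
  set I := ∫ y, ‖gaussDot n r y‖ with hI
  have hI0 : 0 ≤ I := integral_nonneg fun _ => norm_nonneg _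
  have hb : ∀ ξ, |genHeat r φ ξ| ≤ I * M := by
    intro ξ
    rw [genHeat_eq hr, hI, ← integral_mul_const]
    refine norm_integral_le_of_norm_le (f := fun y => gaussDot n r y * φ (ξ - y))
      (hi.mul_const M) (Eventually.of_forall fun y => ?_)
    rw [norm_mul]
    exact mul_le_mul_of_nonneg_left (hM _) (norm_nonneg _)
  have hd : ∀ ξ ζ, |genHeat r φ ξ - genHeat r φ ζ| ≤ I * (K * dist ξ ζ) := by
    intro ξ ζ
    rw [genHeat_eq hr, genHeat_eq hr, hI, ← integral_mul_const,
      ← integral_sub (hφ.integrable_gaussDot_mul hr ξ) (hφ.integrable_gaussDot_mul hr ζ)]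
    refine norm_integral_le_of_norm_le
      (f := fun y => gaussDot n r y * φ (ξ - y) - gaussDot n r y * φ (ζ - y))
      (hi.mul_const _) (Eventually.of_forall fun y => ?_)
    rw [← mul_sub, norm_mul]
    refine mul_le_mul_of_nonneg_left ?_ (norm_nonneg _)
    rw [← dist_eq_norm]
    refine (hK.dist_le_mul _ _).trans (le_of_eq ?_)
    rw [dist_sub_right]
  refine ⟨⟨Real.toNNReal (I * K * N + I * M * L), LipschitzWith.of_dist_le_mul fun ξ ζ => ?_⟩,
    hψ.compact.mul_left⟩
  rw [Real.coe_toNNReal _ (by positivity), Real.dist_eq]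
  have e : genHeat r φ ξ * ψ ξ - genHeat r φ ζ * ψ ζ =
      (genHeat r φ ξ - genHeat r φ ζ) * ψ ξ + genHeat r φ ζ * (ψ ξ - ψ ζ) := by ring
  have h3 : |ψ ξ - ψ ζ| ≤ L * dist ξ ζ := hL.dist_le_mul ξ ζ
  rw [e]
  refine (abs_add_le _ _).trans ?_
  rw [abs_mul, abs_mul]
  calc _ ≤ I * (K * dist ξ ζ) * N + I * M * (L * dist ξ ζ) := by
        gcongr
        · exact hd ξ ζ
        · exact hN ξ
        · exact hb ζ
    _ = _ := by ring

variable {q : ℝ≥0∞} [Fact (1 ≤ q)] [Fact (q ≠ ⊤)] {T γ μ C : ℝ}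

theorem IsLip.exists_norm_heatG_le {φ : Space n → ℝ} (h : IsLip φ) :
    ∃ M, ∀ r, 0 < r → ‖heatG n q r ((h.memLp q).toLp φ)‖ ≤ M * r ^ ((1 / 2 : ℝ) - 1) := by
  obtain ⟨M, hM, hN⟩ := h.exists_nikBound (q := q)
  exact ⟨_, fun r hr => hN.norm_heatG_le (by norm_num) (by norm_num) hM hr⟩

/-- The integration by parts is undone: when A S_r f is O(r^{θ-1}), the constant y_{ts} can be
integrated separately, giving y_{ts}(S_{t-s} f - f) and cancelling the boundary term. -/
theorem heatOp_eq_add_integral {y : ℝ → ℝ → ℝ} (hy : IsDriver T γ μ C y) {s t : ℝ} (hs : 0 ≤ s)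
    (hst : s ≤ t) (ht : t ≤ T) {M θ : ℝ} (hθ : 0 < θ) {f : LSp n q}
    (hf : ∀ r, 0 < r → ‖heatG n q r f‖ ≤ M * r ^ (θ - 1)) :
    IntervalIntegrable (fun r => y (t - r) s • heatG n q r f) volume 0 (t - s) ∧
    heatOp (heatS n q) y t s f =
      y t s • f + ∫ r in (0 : ℝ)..(t - s), y (t - r) s • heatG n q r f := by
  have h0 : 0 ≤ t - s := by linarith
  have hi := intervalIntegrable_heatG hθ h0 hf
  have hc : Continuous fun r => y (t - r) s :=
    hy.cont.comp (f := fun r : ℝ => (t - r, s)) (by fun_prop)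
  have hi1 : IntervalIntegrable (fun r => y t s • heatG n q r f) volume 0 (t - s) :=
    hi.smul (y t s)
  have hi2 : IntervalIntegrable (fun r => y (t - r) s • heatG n q r f) volume 0 (t - s) :=
    hi.continuousOn_smul hc.continuousOn
  refine ⟨hi2, ?_⟩
  have e : ∫ r in (0 : ℝ)..(t - s), (y t s - y (t - r) s) • gen (heatS n q) r f =
      ∫ r in (0 : ℝ)..(t - s), (y t s • heatG n q r f - y (t - r) s • heatG n q r f) := by
    refine intervalIntegral.integral_congr_ae (Eventually.of_forall fun r hr => ?_)
    rw [uIoc_of_le h0] at hr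
    rw [gen_heatS hr.1, sub_smul]
  rw [heatOp_apply isHeatFamily_heatS hy hy.order_pos hs hst ht, e,
    intervalIntegral.integral_sub hi1 hi2, intervalIntegral.integral_smul,
    integral_heatG hθ h0 hf, smul_sub]
  abel

/-- On Lipschitz functions of compact support, the operators are given by the integration by parts
formula. -/
theorem IsLip.heatOp_ae_eq {z : ℝ → ℝ → ℝ} (hy : IsDriver T γ μ C (extend T z)) {s t : ℝ}
    (hs : 0 ≤ s) (hst : s ≤ t) (ht : t ≤ T) {φ : Space n → ℝ} (h : IsLip φ) :
    heatOp (heatS n q) (extend T z) t s ((h.memLp q).toLp φ) =ᵐ[volume] ippXX z t s φ := by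
  obtain ⟨M, hM⟩ := h.exists_norm_heatG_le (q := q)
  obtain ⟨hi, he⟩ := heatOp_eq_add_integral hy hs hst ht one_half_pos hM
  have h0 : 0 ≤ t - s := by linarith
  set f : LSp n q := (h.memLp q).toLp φ with hf
  have hfφ : f =ᵐ[volume] φ := (h.memLp q).coeFn_toLp
  rw [intervalIntegrable_iff_integrableOn_Ioc_of_le h0] at hi
  rw [intervalIntegral.integral_of_le h0] at he
  have hc : Continuous fun r => extend T z (t - r) s :=
    hy.cont.comp (f := fun r : ℝ => (t - r, s)) (by fun_prop)
  have hI := coeFn_integral (ν := volume.restrict (Ioc 0 (t - s)))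
    (K := fun r ξ => extend T z (t - r) s * ∫ y, gaussDot n r y * φ (ξ - y)) hi
    ((hc.measurable.comp measurable_fst).mul
      (measurable_integral_gaussDot_mul (F := fun _ => φ) measurable_id
        (h.continuous.measurable.comp measurable_snd))).aestronglyMeasurable
    (by
      filter_upwards [ae_restrict_mem measurableSet_Ioc] with r hr
      filter_upwards [Lp.coeFn_smul (extend T z (t - r) s) (heatG n q r f),
        coeFn_heatG hr.1 hfφ] with ξ h1 h2
      rw [h1, Pi.smul_apply, h2, smul_eq_mul, genHeat_eq hr.1])
  rw [he]
  filter_upwards [hI, hfφ, Lp.coeFn_smul (extend T z t s) f, Lp.coeFn_add (extend T z t s • f)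
    (∫ r in Ioc 0 (t - s), extend T z (t - r) s • heatG n q r f)] with ξ h1 h2 h3 h4
  rw [h4, Pi.add_apply, h3, Pi.smul_apply, h2, h1, ippXX, extend_eq hs hst ht, smul_eq_mul]
  congr 1
  have e := intervalIntegral.integral_comp_sub_left (a := 0) (b := t - s)
    (fun u => genHeat (t - u) φ ξ * z u s) t
  rw [sub_sub_cancel, sub_zero] at e
  rw [← e, intervalIntegral.integral_of_le h0]
  refine setIntegral_congr_fun measurableSet_Ioc fun r hr => ?_
  simp only [sub_sub_cancel]
  rw [genHeat_eq hr.1, extend_eq hs (by linarith [hr.2]) (by linarith [hr.1]), mul_comm]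

/-- A measurable version of the integrand of `ippXA`. -/
def ippKer (z : ℝ → ℝ → ℝ) (φ ψ : Space n → ℝ) (t s r : ℝ) (ξ : Space n) : ℝ :=
  z t (s + r) * ((∫ y, gaussDot n r y * φ (ξ - y)) * ψ ξ) +
    ∫ u, (Ioo (s + r) t).indicator (fun u => (∫ y, gaussDot n (t - u) y *
      ((∫ y', gaussDot n r y' * φ (ξ - y - y')) * ψ (ξ - y))) * z u (s + r)) u

theorem measurable_ippKer {z : ℝ → ℝ → ℝ} (hz : Continuous fun w : ℝ × ℝ => z w.1 w.2)
    {φ ψ : Space n → ℝ} (hφ : Continuous φ) (hψ : Continuous ψ) (s t : ℝ) :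
    Measurable (Function.uncurry (ippKer z φ ψ t s)) := by
  have h1 : Measurable fun w : ℝ × Space n => ∫ y, gaussDot n w.1 y * φ (w.2 - y) :=
    measurable_integral_gaussDot_mul (F := fun _ => φ) measurable_id
      (hφ.measurable.comp measurable_snd)
  have hF : Measurable (Function.uncurry fun (v : ℝ × ℝ) (ξ : Space n) =>
      (∫ y, gaussDot n v.1 y * φ (ξ - y)) * ψ ξ) :=
    (h1.comp ((measurable_fst.comp measurable_fst).prodMk measurable_snd)).mul
      (hψ.measurable.comp measurable_snd)
  have h2 : Measurable fun w : (ℝ × ℝ) × Space n => ∫ y, gaussDot n (t - w.1.2) y *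
      ((∫ y', gaussDot n w.1.1 y' * φ (w.2 - y - y')) * ψ (w.2 - y)) :=
    measurable_integral_gaussDot_mul (ρ := fun v : ℝ × ℝ => t - v.2)
      (F := fun v ξ => (∫ y, gaussDot n v.1 y * φ (ξ - y)) * ψ ξ) (by fun_prop) hF
  have hz1 : Measurable fun w : ℝ × Space n => z t (s + w.1) :=
    (hz.comp (f := fun w : ℝ × Space n => (t, s + w.1)) (by fun_prop)).measurable
  refine (hz1.mul (h1.mul (hψ.measurable.comp measurable_snd))).add ?_
  have hz2 : Measurable fun w : (ℝ × Space n) × ℝ => z w.2 (s + w.1.1) :=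
    (hz.comp (f := fun w : (ℝ × Space n) × ℝ => (w.2, s + w.1.1)) (by fun_prop)).measurable
  have h3 : Measurable fun w : (ℝ × Space n) × ℝ => (∫ y, gaussDot n (t - w.2) y *
      ((∫ y', gaussDot n w.1.1 y' * φ (w.1.2 - y - y')) * ψ (w.1.2 - y))) * z w.2 (s + w.1.1) :=
    (h2.comp (f := fun w : (ℝ × Space n) × ℝ => ((w.1.1, w.2), w.1.2)) (by fun_prop)).mul hz2
  have hS : MeasurableSet {w : (ℝ × Space n) × ℝ | s + w.1.1 < w.2 ∧ w.2 < t} :=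
    (measurableSet_lt (f := fun w : (ℝ × Space n) × ℝ => s + w.1.1) (g := fun w => w.2)
      (by fun_prop) (by fun_prop)).inter (measurableSet_lt
        (f := fun w : (ℝ × Space n) × ℝ => w.2) (g := fun _ => t) (by fun_prop) (by fun_prop))
  have h4 := (h3.indicator hS).stronglyMeasurable.integral_prod_right' (ν := volume)
  exact h4.measurable

/-- `genHeat` is rewritten through `gaussDot` only at positive times, so the comparison is made on
the open interval, whose endpoints are null. -/
theorem ippX_genHeat_mul_eq {x : ℝ → ℝ} {s t r : ℝ} (hs : 0 ≤ s) (hr : 0 < r)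
    (hrt : r ≤ t - s) (ht : t ≤ T) (φ ψ : Space n → ℝ) (ξ : Space n) :
    ippX x t (s + r) (fun ζ => genHeat r φ ζ * ψ ζ) ξ =
      ippKer (extend T (delta1 x)) φ ψ t s r ξ := by
  have h0 : s + r ≤ t := by linarith
  rw [ippX, ippKer, extend_eq (by linarith) h0 ht, genHeat_eq hr, intervalIntegral.integral_of_le h0,
    integral_Ioc_eq_integral_Ioo, integral_indicator measurableSet_Ioo]
  congr 1
  refine setIntegral_congr_fun measurableSet_Ioo fun u hu => ?_
  rw [genHeat_eq (by linarith [hu.2]), extend_eq (by linarith) hu.1.le (hu.2.le.trans ht)]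
  simp only [genHeat_eq hr]

open BesselSp in
-- For each r the product is Lipschitz of compact support, so X^x acts on it by the pointwise
-- formula. Joint measurability of `ippKer` then lets `coeFn_integral` bring the integral over r to
-- the pointwise level.
theorem xaOp_ae_eq {p : ℕ} [Fact (2 ≤ p)] {x : ℝ → ℝ} (hy : IsDriver T γ γ C (extend T (delta1 x)))
    (hκγ : (n : ℝ) / (2 * p) < γ) {α : Order} {s t : ℝ} (hs : 0 ≤ s) (hst : s ≤ t) (ht : t ≤ T)
    {φ ψ : Space n → ℝ} (hφ : IsLip φ) (hψ : IsLip ψ) {φ' : BesselSp n p α}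
    (h : incl φ' = (hφ.memLp p).toLp φ) :
    xaOp (heatOp (heatH n p) (extend T (delta1 x))) (mulL n p) incl t s φ'
      ((hψ.memLp p).toLp ψ) =ᵐ[volume] ippXA x t s φ ψ := by
  have h0 : 0 ≤ t - s := by linarith
  obtain ⟨A, hA0, hA⟩ := genBound_incl (n := n) (p := p) α
  have hXH := holderC2_heatH (n := n) (p := p) hy hκγ
  set f : LSp n p := (hφ.memLp p).toLp φ with hf
  set g : LSp n p := (hψ.memLp p).toLp ψ with hg
  have hfφ : f =ᵐ[volume] φ := (hφ.memLp p).coeFn_toLp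
  have hgψ : g =ᵐ[volume] ψ := (hψ.memLp p).coeFn_toLp
  have hi : IntervalIntegrable (fun r => heatOp (heatH n p) (extend T (delta1 x)) t (s + r)
      (mulL n p (heatG n p r (incl φ')) g)) volume 0 (t - s) :=
    intervalIntegrable_xaKer_apply (m := mulL n p) hXH (by linarith) α.2.1 hA0 hA hs hst ht φ' g
  rw [intervalIntegrable_iff_integrableOn_Ioc_of_le h0, h] at hi
  rw [xaOp_apply hXH (by linarith) α.2.1 hA0 hA hs hst ht φ' g, h,
    intervalIntegral.integral_of_le h0]
  have hI := coeFn_integral (ν := volume.restrict (Ioc 0 (t - s))) (K := ippKer (extend T (delta1 x)) φ ψ t s) hi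
    (measurable_ippKer hy.cont hφ.continuous hψ.continuous s t).aestronglyMeasurable (by
      filter_upwards [ae_restrict_mem measurableSet_Ioc] with r hr
      have hw := hφ.genHeat_mul hψ hr.1
      have hmul : (hw.memLp p).toLp _ =ᵐ[volume] mulHalf (heatG n p r f) g := by
        filter_upwards [(hw.memLp p).coeFn_toLp, coeFn_mulHalf (heatG n p r f) g,
          coeFn_heatG hr.1 hfφ, hgψ] with ξ h1 h2 h3 h4
        rw [h1, h2, h3, h4]
      have e : heatOp (heatH n p) (extend T (delta1 x)) t (s + r)
          (mulL n p (heatG n p r f) g) = heatOp (heatS n p) (extend T (delta1 x)) t (s + r)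
            ((hw.memLp p).toLp _) :=
        heatOp_heatH_eq hy hκγ (by linarith [hr.1]) (by linarith [hr.2]) ht hmul
      rw [e]
      filter_upwards [hw.heatOp_ae_eq (q := (p : ℝ≥0∞)) hy (by linarith [hr.1] : 0 ≤ s + r)
        (by linarith [hr.2]) ht] with ξ hξ
      rw [hξ]
      exact ippX_genHeat_mul_eq hs hr.1 hr.2 ht φ ψ ξ)
  filter_upwards [hI] with ξ hξ
  rw [hξ, ippXA]
  have e := intervalIntegral.integral_comp_add_left (a := 0) (b := t - s)
    (fun u => ippX x t u (fun ζ => genHeat (u - s) φ ζ * ψ ζ) ξ) s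
  rw [add_zero, add_sub_cancel] at e
  rw [← e, intervalIntegral.integral_of_le h0]
  refine setIntegral_congr_fun measurableSet_Ioc fun r hr => ?_
  simp only [add_sub_cancel_left]
  exact (ippX_genHeat_mul_eq hs hr.1 hr.2 ht φ ψ ξ).symm

end IPP

/-! ### The heat equation rough path built on a path and its Lévy area -/

section RoughPath

open BesselSp

variable {n p N : ℕ} [Fact (2 ≤ p)] {T γ C : ℝ}

variable (n p) in
/-- The operators above a path `x` and its Lévy area `x2`. -/
def heatOps (T : ℝ) (x : Fin N → ℝ → ℝ) (x2 : Fin N → Fin N → ℝ → ℝ → ℝ) : HeatOps n p N where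
  Xx i t s := heatOp (heatS n p) (extend T (delta1 (x i))) t s
  XxHalf i t s := heatOp (heatH n p) (extend T (delta1 (x i))) t s
  Xax i t s := heatOp (heatS n p) (extend T (delta1 (x i))) t s -
    extend T (delta1 (x i)) t s • ContinuousLinearMap.id ℝ _
  Xxa i _ t s := xaOp (heatOp (heatH n p) (extend T (delta1 (x i)))) (mulL n p) incl t s
  Xxx i j t s := heatOp (heatS n p) (extend T (x2 i j)) t s

theorem div_lt_of_lt_mul {α : ℝ} (h : (n : ℝ) < 2 * α * p) : (n : ℝ) / (2 * p) < α := by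
  have hp : (0 : ℝ) < p := by
    have := (Fact.out : 2 ≤ p)
    exact_mod_cast (by omega : 0 < p)
  rw [div_lt_iff₀ (by positivity)]
  linarith

theorem extend_delta1_sub {x : ℝ → ℝ} {s u v : ℝ} (hs : 0 ≤ s) (hsu : s ≤ u) (huv : u ≤ v)
    (hv : v ≤ T) :
    extend T (delta1 x) v s - extend T (delta1 x) u s = extend T (delta1 x) v u := by
  rw [extend_eq hs (hsu.trans huv) hv, extend_eq hs hsu (huv.trans hv),
    extend_eq (hs.trans hsu) huv hv]
  simp only [delta1]
  ring

set_option maxHeartbeats 1000000 in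
theorem hatDelta_xaOp {x : ℝ → ℝ} (hy : IsDriver T γ γ C (extend T (delta1 x)))
    (hκγ : (n : ℝ) / (2 * p) < γ) {α : Order} {s u t : ℝ} (hs : 0 ≤ s) (hsu : s ≤ u)
    (hut : u ≤ t) (ht : t ≤ T) (φ : BesselSp n p α) (ψ : LSp n p) :
    hatDelta (fun t s => xaOp (heatOp (heatH n p) (extend T (delta1 x))) (mulL n p) incl t s φ ψ)
        t u s =
      xaOp (heatOp (heatH n p) (extend T (delta1 x))) (mulL n p) incl t u (aOpB u s φ) ψ +
      heatOp (heatH n p) (extend T (delta1 x)) t u (mulHalf (aOp u s (incl φ)) ψ) := by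
  obtain ⟨A, hA0, hA⟩ := genBound_incl (n := n) (p := p) α
  have h := xaOp_chen (m := mulL n p) (P := heatS n p (t - u))
    (holderC2_heatH (n := n) (p := p) hy hκγ) (by linarith) α.2.1 hA0 hA
    (fun v hsv hvu f => by
      rw [← heatOp_chen isHeatFamily_heatH hy hκγ (hs.trans hsv) hvu hut ht
        (fun w huw hwt => extend_delta1_sub (hs.trans hsv) hvu huw (hwt.trans ht)) f]
      abel) hs hsu hut ht (incl_heatB (u - s) φ) ψ
  have e1 : ∀ Q : BesselSp n p α →L[ℝ] LSp n p →L[ℝ] LSp n p,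
      Q (aOpB u s φ) ψ = Q (heatB (u - s) φ) ψ - Q φ ψ := fun Q => by
    rw [← sub_apply, ← map_sub]; rfl
  have e2 : heatS n p (u - s) (incl φ) - incl φ = aOp u s (incl φ) := rfl
  rw [hatDelta_eq, h, e1, e2, mulL_apply, add_assoc, add_sub_cancel_left, add_sub_right_comm]

variable {x : Fin N → ℝ → ℝ} {x2 : Fin N → Fin N → ℝ → ℝ → ℝ} {Cx : Fin N → ℝ}
  {Cxx : Fin N → Fin N → ℝ}

theorem heatOps_extendsIPP (hx : ∀ i, IsDriver T γ γ (Cx i) (extend T (delta1 (x i))))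
    (hxx : ∀ i j, IsDriver T γ (2 * γ) (Cxx i j) (extend T (x2 i j)))
    (hκγ : (n : ℝ) / (2 * p) < γ) : (heatOps n p T x x2).ExtendsIPP T x x2 where
  opX i s t hs hst ht φ hφ := hφ.isLip.heatOp_ae_eq (hx i) hs hst ht
  opXHalf i s t hs hst ht φ hφ := by
    have h : hφ.toLp (p : ℝ≥0∞) =ᵐ[volume] hφ.toLp ((p : ℝ≥0∞) / 2) :=
      (MemLp.coeFn_toLp _).trans (MemLp.coeFn_toLp _).symm
    have e : (heatOps n p T x x2).XxHalf i t s (hφ.toLp _) =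
        heatOp (heatS n p) (extend T (delta1 (x i))) t s (hφ.toLp p) :=
      heatOp_heatH_eq (hx i) hκγ hs hst ht h
    rw [e]
    exact hφ.isLip.heatOp_ae_eq (hx i) hs hst ht
  opAX i s t hs hst ht φ hφ := by
    have h : heatOp (heatS n p) (extend T (delta1 (x i))) t s (hφ.toLp p) =ᵐ[volume]
        ippXX (delta1 (x i)) t s φ := hφ.isLip.heatOp_ae_eq (hx i) hs hst ht
    have hφ2 : hφ.toLp (p : ℝ≥0∞) =ᵐ[volume] φ := MemLp.coeFn_toLp _
    have e : (heatOps n p T x x2).Xax i t s (hφ.toLp p) =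
        heatOp (heatS n p) (extend T (delta1 (x i))) t s (hφ.toLp p) -
          delta1 (x i) t s • hφ.toLp p := by
      rw [← extend_eq (y := delta1 (x i)) hs hst ht]; rfl
    rw [e]
    filter_upwards [h, hφ2, Lp.coeFn_smul (delta1 (x i) t s) (hφ.toLp (p : ℝ≥0∞)),
      Lp.coeFn_sub (heatOp (heatS n p) (extend T (delta1 (x i))) t s (hφ.toLp p))
        (delta1 (x i) t s • hφ.toLp p)] with ξ h1 h2 h3 h4
    rw [h4, Pi.sub_apply, h1, h3, Pi.smul_apply, h2, ippXX, ippAX, smul_eq_mul,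
      add_sub_cancel_left]
  opXA i α _ s t hs hst ht φ ψ hφ hψ := by
    obtain ⟨φ', h⟩ := hφ.isLip.exists_incl_eq (q := (p : ℝ≥0∞)) α
    exact ⟨φ', h, xaOp_ae_eq (hx i) hκγ hs hst ht hφ.isLip hψ.isLip h⟩
  opXX i j s t hs hst ht φ hφ := hφ.isLip.heatOp_ae_eq (hxx i j) hs hst ht

theorem heatOps_coherent (hx : ∀ i, IsDriver T γ γ (Cx i) (extend T (delta1 (x i))))
    (hκγ : (n : ℝ) / (2 * p) < γ) : (heatOps n p T x x2).Coherent T where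
  half i s t hs hst ht φ φ' h := heatOp_heatH_eq (hx i) hκγ hs hst ht h
  xa i α β _ _ s t hs hst ht φ φ' ψ h := by
    have hX := holderC2_heatH (n := n) (p := p) (hx i) hκγ
    obtain ⟨A, hA0, hA⟩ := genBound_incl (n := n) (p := p) α
    obtain ⟨B, hB0, hB⟩ := genBound_incl (n := n) (p := p) β
    refine (xaOp_apply hX (by linarith) α.2.1 hA0 hA hs hst ht φ ψ).trans ?_
    rw [h]
    exact (xaOp_apply hX (by linarith) β.2.1 hB0 hB hs hst ht φ' ψ).symm

theorem heatOps_algebraic (hx : ∀ i, IsDriver T γ γ (Cx i) (extend T (delta1 (x i))))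
    (hxx : ∀ i j, IsDriver T γ (2 * γ) (Cxx i j) (extend T (x2 i j)))
    (hChen : ∀ i j, ∀ s u t : ℝ, 0 ≤ s → s ≤ u → u ≤ t → t ≤ T →
      delta2 (x2 i j) t u s = delta1 (x i) t u * delta1 (x j) u s)
    (hκγ : (n : ℝ) / (2 * p) < γ) : (heatOps n p T x x2).Algebraic T x where
  opX i s u t hs hsu hut ht φ := by
    rw [hatDelta_eq, sub_eq_zero]
    exact heatOp_chen isHeatFamily_heatS (hx i) (hx i).order_pos hs hsu hut ht
      (fun v huv hvt => extend_delta1_sub hs hsu huv (hvt.trans ht)) φ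
  opXHalf i s u t hs hsu hut ht φ := by
    rw [hatDelta_eq, sub_eq_zero]
    exact heatOp_chen isHeatFamily_heatH (hx i) hκγ hs hsu hut ht
      (fun v huv hvt => extend_delta1_sub hs hsu huv (hvt.trans ht)) φ
  opAX i s t hs hst ht φ := by
    rw [← extend_eq (y := delta1 (x i)) hs hst ht]
    exact (sub_add_cancel _ _).symm
  opXA i α _ s u t hs hsu hut ht φ ψ := hatDelta_xaOp (hx i) hκγ hs hsu hut ht φ ψ
  opXX i j s u t hs hsu hut ht φ := by
    rw [hatDelta_eq]
    -- Chen's relation at (v,u,s) gives the driver x²_{vu} + (δx^j)_{us} (δx^i)_{vu} on [u,t];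
    -- linearity in the driver splits its operator into X^{xx}_{tu} + (δx^j)_{us} X^x_{tu}.
    have h := heatOp_chen (n := n) (q := (p : ℝ≥0∞)) (y' := fun v w => extend T (x2 i j) v w +
      delta1 (x j) u s * extend T (delta1 (x i)) v w) isHeatFamily_heatS (hxx i j)
      (hxx i j).order_pos hs hsu hut ht (fun v huv hvt => by
        have := hChen i j s u v hs hsu huv (hvt.trans ht)
        rw [delta2] at this
        rw [extend_eq hs (hsu.trans huv) (hvt.trans ht), extend_eq hs hsu (hut.trans ht),
          extend_eq (hs.trans hsu) huv (hvt.trans ht), extend_eq (hs.trans hsu) huv (hvt.trans ht)]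
        linarith) φ
    rw [heatOp_add_mul isHeatFamily_heatS (hxx i j) (hx i) (hx i).order_pos _ (hs.trans hsu) hut
      ht, add_apply, smul_apply] at h
    exact sub_eq_iff_eq_add'.2 h

theorem heatOps_analytic (hT : 0 ≤ T) (hγ : 1 / 3 < γ)
    (hx : ∀ i, IsDriver T γ γ (Cx i) (extend T (delta1 (x i))))
    (hxx : ∀ i j, IsDriver T γ (2 * γ) (Cxx i j) (extend T (x2 i j)))
    (hκγ : (n : ℝ) / (2 * p) < γ) : (heatOps n p T x x2).Analytic T γ := by
  have hX : ∀ i, HolderC2 T γ ((heatOps n p T x x2).Xx i) := fun i => by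
    have := holderC2_heatOp (isHeatFamily_heatS (n := n) (q := (p : ℝ≥0∞))) (hx i)
      (hx i).order_pos
    rwa [sub_zero] at this
  have hXX : ∀ i j, HolderC2 T (2 * γ) ((heatOps n p T x x2).Xxx i j) := fun i j => by
    have := holderC2_heatOp (isHeatFamily_heatS (n := n) (q := (p : ℝ≥0∞))) (hxx i j)
      (hxx i j).order_pos
    rwa [sub_zero] at this
  exact
  { opX := hX
    opXB := fun i α _ => exists_restrictsTo α (hX i) fun t s => commutes_heatOp _ t s
    opXHalf := fun i => holderC2_heatH (hx i) hκγ
    opAX := fun i α _ => holderC2_heatOp_sub_smul (hx i) α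
    opXA := fun i α _ => by
      obtain ⟨A, hA0, hA⟩ := genBound_incl (n := n) (p := p) α
      have := holderC2_xaOp (m := mulL n p) (holderC2_heatH (n := n) (p := p) (hx i) hκγ)
        (by linarith) α.2.1 hA0 hA
      rwa [sub_add_eq_add_sub] at this
    opXAB := fun i α hα => exists_holderC2_xaOp_lift (hx i) hκγ hγ hT α (div_lt_of_lt_mul hα)
    opXX := hXX
    opXXB := fun i j α _ => exists_restrictsTo α (hXX i j) fun t s => commutes_heatOp _ t s
    opXXBp := fun i j α _ => (hXX i j).comp_incl }

end RoughPath

end HeatRough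

end

theorem mainTheorem5 (n N p : ℕ) [Fact (2 ≤ p)] (T γ : ℝ) (hT : 0 < T) (hγ : 1 / 3 < γ)
    (hp : (n : ℝ) / (2 * p) < γ)
    (x : Fin N → ℝ → ℝ) (x2 : Fin N → Fin N → ℝ → ℝ → ℝ)
    (hx : ∀ i, HeatRough.HolderC1 T γ (x i))
    (hx2 : ∀ i j, HeatRough.HolderC2 T (2 * γ) (x2 i j))
    (hChen : ∀ i j, ∀ s u t : ℝ, 0 ≤ s → s ≤ u → u ≤ t → t ≤ T →
      HeatRough.delta2 (x2 i j) t u s =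
        HeatRough.delta1 (x i) t u * HeatRough.delta1 (x j) u s) :
    ∃ X : HeatRough.HeatOps n p N,
      X.ExtendsIPP T x x2 ∧ X.Coherent T ∧ X.Algebraic T x ∧ X.Analytic T γ := by
  have hγ0 : 0 < γ := by linarith
  choose Cx hCx using fun i => HeatRough.isDriver_path hT.le hγ0 (hx i)
  choose Cxx hCxx using fun i j =>
    HeatRough.isDriver_area hT.le hγ0 (hx i) (hx j) (hx2 i j) (hChen i j)
  exact ⟨HeatRough.heatOps n p T x x2, HeatRough.heatOps_extendsIPP hCx hCxx hp,
    HeatRough.heatOps_coherent hCx hp, HeatRough.heatOps_algebraic hCx hCxx hChen hp,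
    HeatRough.heatOps_analytic hT.le hγ hCx hCxx hp⟩
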